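/- A \emph{planar map} is a 2-cell decomposition of the oriented sphere into vertices, edges and faces (loops and multiple edges are allowed), considered up to orientation-preserving homeomorphisms preserving cells and incidences. The degree of a face is the number of incidences of edges to it. A map is \emph{rooted} if one of its edges is distinguished and oriented; the face lying to the right of the root edge is called the infinite face, its degree is the outer-degree, and all other faces are called finite. By convention, the map reduced to a single vertex (no edge, one infinite face, of degree $0$) is counted as a rooted planar map. Let $m\ge 1$. Let $$F(t,u;z_1,\ldots,z_m)=\sum_{M} t^{e(M)}\,u^{d(M)}\prod_{i=1}^m z_i^{f_i(M)},$$ where the sum runs over all rooted planar maps $M$ in which no finite face has degree larger than $m$, and where $e(M)$ is the number of edges of $M$, $d(M)$ its outer-degree, and $f_i(M)$ the number of finite faces of degree $i$. Let $$G(t;z_1,\ldots,z_m)=\sum_{M} t^{e(M)}\prod_{i=1}^m z_i^{g_i(M)},$$ where the sum runs over all rooted planar maps $M$ in which no face, finite or infinite, has degree larger than $m$, and where $g_i(M)$ is the number of all faces of degree $i$, including the infinite one. Then the formal power series $F$ is algebraic over $\mathbb{Q}(t,u,z_1,\ldots,z_m)$ and the formal power series $G$ is algebraic over $\mathbb{Q}(t,z_1,\ldots,z_m)$;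 that is, each satisfies a non-trivial polynomial equation whose coefficients are polynomials in its variables with rational coefficients. -/

import Mathlib

/-- A rooted planar map with at least one edge, given by its rotation system on the set `D` of
darts (oriented edges, i.e. each edge together with one of its two orientations).
`σ d` is the dart that follows `d` in counterclockwise order around the starting point of `d`,
`α d` is the dart opposite to `d`, and `root` is the oriented root edge. The vertices, edges and
faces are the cycles (fixed points included) of `σ`, of `α` and of `σ * α`. The map is
connected and, by Euler's relation, drawn on the sphere. Loops and multiple edges are allowed. -/
structure DartMap (D : Type*) where
  σ : Equiv.Perm D
  α : Equiv.Perm D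
  root : D
  α_invol : ∀ d, α (α d) = d
  α_ne : ∀ d, α d ≠ d
  connected : MulAction.IsPretransitive (Subgroup.closure {σ, α}) D
  euler : Nat.card (Quotient (Equiv.Perm.SameCycle.setoid σ))
      + Nat.card (Quotient (Equiv.Perm.SameCycle.setoid (σ * α)))
      = Nat.card (Quotient (Equiv.Perm.SameCycle.setoid α)) + 2

namespace DartMap

variable {D E : Type*}

/-- Faces: the cycle of `d` under `d ↦ σ (α d)` is the face lying to the right of `d`. -/
def Face (M : DartMap D) : Type _ := Quotient (Equiv.Perm.SameCycle.setoid (M.σ * M.α))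

/-- The face lying to the right of the dart `d`. -/
def faceOf (M : DartMap D) (d : D) : M.Face := Quotient.mk _ d

/-- The infinite face is the one to the right of the root edge. -/
def rootFace (M : DartMap D) : M.Face := M.faceOf M.root

/-- The degree of a face: the number of incidences of edges to it. -/
noncomputable def faceDegree (M : DartMap D) (f : M.Face) : ℕ :=
  Nat.card {d : D // M.faceOf d = f}

noncomputable def outerDegree (M : DartMap D) : ℕ := M.faceDegree M.rootFace

/-- The number of faces of degree `i`, the infinite face included. -/
noncomputable def faceCount (M : DartMap D) (i : ℕ) : ℕ :=
  Nat.card {f : M.Face // M.faceDegree f = i}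

/-- The number of finite faces of degree `i`. -/
noncomputable def finiteFaceCount (M : DartMap D) (i : ℕ) : ℕ :=
  Nat.card {f : M.Face // f ≠ M.rootFace ∧ M.faceDegree f = i}

/-- Isomorphism of rooted maps: a relabelling of the darts that respects the root, the
orientation and the incidences. -/
def Iso (M : DartMap D) (N : DartMap E) : Prop :=
  ∃ e : D ≃ E, (∀ d, e (M.σ d) = N.σ (e d)) ∧ (∀ d, e (M.α d) = N.α (e d)) ∧ e M.root = N.root

theorem Iso.refl (M : DartMap D) : M.Iso M := ⟨Equiv.refl D, by simp⟩

theorem Iso.symm {M : DartMap D} {N : DartMap E} : M.Iso N → N.Iso M := by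
  rintro ⟨e, h1, h2, h3⟩
  refine ⟨e.symm, fun d => ?_, fun d => ?_, ?_⟩
  · rw [Equiv.symm_apply_eq, h1, Equiv.apply_symm_apply]
  · rw [Equiv.symm_apply_eq, h2, Equiv.apply_symm_apply]
  · rw [Equiv.symm_apply_eq, h3]

theorem Iso.trans {F : Type*} {M : DartMap D} {N : DartMap E} {P : DartMap F} :
    M.Iso N → N.Iso P → M.Iso P := by
  rintro ⟨e, h1, h2, h3⟩ ⟨f, k1, k2, k3⟩
  exact ⟨e.trans f, by simp [h1, k1], by simp [h2, k2], by simp [h3, k3]⟩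

theorem Iso.exists_face_equiv {M : DartMap D} {N : DartMap E} (h : M.Iso N) :
    ∃ g : M.Face ≃ N.Face, g M.rootFace = N.rootFace ∧
      ∀ f, N.faceDegree (g f) = M.faceDegree f := by
  obtain ⟨e, h1, h2, h3⟩ := h
  have hφ : e.permCongrHom (M.σ * M.α) = N.σ * N.α := by
    ext x
    simp [Equiv.permCongrHom, Equiv.permCongr_apply, h1, h2]
  have hs : ∀ a b, (M.σ * M.α).SameCycle a b ↔ (N.σ * N.α).SameCycle (e a) (e b) := by
    intro a b
    rw [← hφ]
    unfold Equiv.Perm.SameCycle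
    refine exists_congr fun k => ?_
    rw [← map_zpow]
    simp [Equiv.permCongrHom, Equiv.permCongr_apply]
  let g : M.Face ≃ N.Face := Quotient.congr e hs
  have hg : ∀ d, g (M.faceOf d) = N.faceOf (e d) := fun d => rfl
  refine ⟨g, ?_, fun f => ?_⟩
  · rw [rootFace, hg, h3, rootFace]
  · refine (Nat.card_congr (Equiv.subtypeEquiv e fun d => ?_)).symm
    rw [← hg, g.apply_eq_iff_eq]

theorem Iso.outerDegree_eq {M : DartMap D} {N : DartMap E} (h : M.Iso N) :
    M.outerDegree = N.outerDegree := by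
  obtain ⟨g, h1, h2⟩ := h.exists_face_equiv
  rw [outerDegree, outerDegree, ← h1, h2]

theorem Iso.faceCount_eq {M : DartMap D} {N : DartMap E} (h : M.Iso N) :
    M.faceCount = N.faceCount := by
  obtain ⟨g, h1, h2⟩ := h.exists_face_equiv
  funext i
  exact Nat.card_congr (Equiv.subtypeEquiv g fun f => by rw [h2])

theorem Iso.finiteFaceCount_eq {M : DartMap D} {N : DartMap E} (h : M.Iso N) :
    M.finiteFaceCount = N.finiteFaceCount := by
  obtain ⟨g, h1, h2⟩ := h.exists_face_equiv
  funext i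
  exact Nat.card_congr (Equiv.subtypeEquiv g fun f => by
    rw [h2, ← h1, ne_eq, ne_eq, g.apply_eq_iff_eq])

/-- Isomorphism of rooted maps with `n` edges, the darts being labelled by `Fin (2 * n)`. -/
def isoSetoid (n : ℕ) : Setoid (DartMap (Fin (2 * n))) where
  r M N := M.Iso N
  iseqv := ⟨Iso.refl, Iso.symm, Iso.trans⟩

end DartMap

/-- Rooted planar maps up to isomorphism: the map reduced to a single vertex, which has no edge
and a single (infinite) face of degree `0`, and the maps with `n` edges, `n ≥ 1` (there is no
`DartMap` on the empty type). -/
inductive RootedPlanarMap : Type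
  | vertex : RootedPlanarMap
  | ofEdges (n : ℕ) (M : Quotient (DartMap.isoSetoid n)) : RootedPlanarMap

namespace RootedPlanarMap

/-- The number of edges. -/
def edges : RootedPlanarMap → ℕ
  | vertex => 0
  | ofEdges n _ => n

/-- The degree of the infinite face. -/
noncomputable def outerDegree : RootedPlanarMap → ℕ
  | vertex => 0
  | ofEdges _ M => Quotient.lift (fun M => DartMap.outerDegree M)
      (fun _ _ h => DartMap.Iso.outerDegree_eq h) M

/-- The number of faces of degree `i`, the infinite face included. -/
noncomputable def faceCount : RootedPlanarMap → ℕ → ℕ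
  | vertex => fun i => if i = 0 then 1 else 0
  | ofEdges _ M => Quotient.lift (fun M => DartMap.faceCount M)
      (fun _ _ h => DartMap.Iso.faceCount_eq h) M

/-- The number of finite faces of degree `i`. -/
noncomputable def finiteFaceCount : RootedPlanarMap → ℕ → ℕ
  | vertex => fun _ => 0
  | ofEdges _ M => Quotient.lift (fun M => DartMap.finiteFaceCount M)
      (fun _ _ h => DartMap.Iso.finiteFaceCount_eq h) M

/-- There are finitely many rooted planar maps with a given number of edges, so that the
cardinalities below are those of finite sets. -/
theorem finite_edges_eq (n : ℕ) : {M : RootedPlanarMap | M.edges = n}.Finite := by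
  have h1 : Finite (DartMap (Fin (2 * n))) :=
    Finite.of_injective
      (fun M : DartMap (Fin (2 * n)) => (M.σ, M.α, M.root)) (by
        rintro ⟨⟩ ⟨⟩ h
        simp only [Prod.mk.injEq] at h
        obtain ⟨rfl, rfl, rfl⟩ := h
        rfl)
  refine ((Set.finite_range fun M => ofEdges n M).insert vertex).subset ?_
  rintro (_ | ⟨k, M⟩) h
  · exact Set.mem_insert _ _
  · obtain rfl : k = n := h
    exact Set.mem_insert_of_mem _ ⟨M, rfl⟩

end RootedPlanarMap

/-- The variables `t, u, z₁, …, z_m`; `z i` with `i : Fin m` stands for `z_{i+1}`. -/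
inductive FVar (m : ℕ) : Type
  | t : FVar m
  | u : FVar m
  | z (i : Fin m) : FVar m

/-- The variables `t, z₁, …, z_m`; `z i` with `i : Fin m` stands for `z_{i+1}`. -/
inductive GVar (m : ℕ) : Type
  | t : GVar m
  | z (i : Fin m) : GVar m

/-- The exponent of `t^{edges} u^{outer degree} ∏ z_i^{number of finite faces of degree i}`. -/
noncomputable def RootedPlanarMap.fWeight (m : ℕ) (M : RootedPlanarMap) : FVar m →₀ ℕ :=
  Finsupp.single FVar.t M.edges + Finsupp.single FVar.u M.outerDegree
    + ∑ i : Fin m, Finsupp.single (FVar.z i) (M.finiteFaceCount (i + 1))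

/-- The exponent of `t^{edges} ∏ z_i^{number of faces of degree i}`. -/
noncomputable def RootedPlanarMap.gWeight (m : ℕ) (M : RootedPlanarMap) : GVar m →₀ ℕ :=
  Finsupp.single GVar.t M.edges
    + ∑ i : Fin m, Finsupp.single (GVar.z i) (M.faceCount (i + 1))

/-- `F(t, u; z₁, …, z_m)`: the generating function of the rooted planar maps in which no finite
face has degree larger than `m`. -/
noncomputable def finiteFaceGF (m : ℕ) : MvPowerSeries (FVar m) ℚ := fun e =>
  (Nat.card {M : RootedPlanarMap //
    (∀ i, m < i → M.finiteFaceCount i = 0) ∧ M.fWeight m = e} : ℚ)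

/-- `G(t; z₁, …, z_m)`: the face-distribution generating function of the rooted planar maps in
which no face has degree larger than `m`. -/
noncomputable def allFaceGF (m : ℕ) : MvPowerSeries (GVar m) ℚ := fun e =>
  (Nat.card {M : RootedPlanarMap //
    (∀ i, m < i → M.faceCount i = 0) ∧ M.gWeight m = e} : ℚ)

/-!
A map with at least one edge is taken apart at its root edge. If the root edge is a bridge, deleting
it leaves two maps that share the infinite face; otherwise it cuts a finite face off the infinite
face of a smaller map. Both constructions stay within the sphere, in both directions, by Euler's
inequality for the cycles of a pair of permutations. Writing `Δ` for the divided difference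
`(f(u) - f(0)) / u`, the decomposition reads `F = 1 + t (u² F² + u ∑ z_{k+1} Δ ^ k F)`. This is
Tutte's equation; its right-hand side is contracting in powers of `t`, so that `F` is its only
solution.

The solution can be written down. Put `w = 1 / u` and let `y` be the small root of
`w = 1 / y + S + R y`. For a suitable choice of the series `R` and `S` in `t, z₁, …, z_m`, the
Laurent polynomial `w - t ∑ z_{k+1} w ^ k` in `y` is `A(1 / y) + A(R y)` for a polynomial `A` with
`A(0) = 0`, and then `t u F = A(R y)`: the product `A(1 / y) A(R y)` is symmetric in `1 / y` and
`R y`, hence a polynomial in `w`, and this is Tutte's equation up to terms killed by a power of `Δ`.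

The conditions on `R` and `S` have the form `R = t P(R, S)` and `S = t Q(R, S)` with polynomials `P`
and `Q`. Hence the Kähler differentials `Ω` of the algebra generated by `R` and `S` satisfy
`Ω = t Ω`, a nonzero element annihilates `Ω` by Nakayama's lemma, the fraction field is unramified,
and `R` and `S` are algebraic. So are `y` and `F`. Up to the map without edges, `G` arises from `F`
when `u ^ k` is replaced by `z_k`, and the coefficients of an algebraic series with respect to `u`
are algebraic.
-/

/-! ### Class sizes of a setoid -/

namespace SetoidClass

variable {D E : Type*}

/-- The size of the class of `a`, as a natural number (`0` for an infinite class). -/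
noncomputable def classSize (s : Setoid D) (a : D) : ℕ := Nat.card {d // s d a}

theorem classSize_congr (s : Setoid D) {a b : D} (h : s a b) : classSize s a = classSize s b :=
  Nat.card_congr (Equiv.subtypeEquivRight fun _ =>
    ⟨fun hda => s.trans' hda h, fun hdb => s.trans' hdb (s.symm' h)⟩)

theorem classSize_pos [Finite D] (s : Setoid D) (a : D) : 0 < classSize s a :=
  haveI : Nonempty {d // s d a} := ⟨⟨a, s.refl' a⟩⟩
  Nat.card_pos

theorem classSize_eq_of_equiv {s : Setoid D} {t : Setoid E} (e : D ≃ E)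
    (h : ∀ x y, s x y ↔ t (e x) (e y)) (a : D) : classSize s a = classSize t (e a) :=
  Nat.card_congr (Equiv.subtypeEquiv e fun d => h d a)

/-- `classSize` as a function on the classes. -/
noncomputable def quotientSize (s : Setoid D) : Quotient s → ℕ :=
  Quotient.lift (classSize s) fun _ _ => classSize_congr s

@[simp]
theorem quotientSize_mk (s : Setoid D) (a : D) : quotientSize s (Quotient.mk s a) = classSize s a :=
  rfl

theorem natCard_fiber_mk (s : Setoid D) (q : Quotient s) :
    Nat.card {d // Quotient.mk s d = q} = quotientSize s q := by
  induction q using Quotient.inductionOn with | _ a =>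
  exact Nat.card_congr (Equiv.subtypeEquivRight fun _ => Quotient.eq)

section Finite

variable [Finite D] [Finite E]

open Classical in
/-- The multiset of the sizes of the classes of a setoid. -/
noncomputable def classSizes (s : Setoid D) : Multiset ℕ :=
  letI := Fintype.ofFinite (Quotient s)
  Finset.univ.val.map (quotientSize s)

open Classical in
/-- The multiset of the sizes of the classes that do not contain `a`. -/
noncomputable def otherClassSizes (s : Setoid D) (a : D) : Multiset ℕ :=
  letI := Fintype.ofFinite (Quotient s)
  (Finset.univ.erase (Quotient.mk s a)).val.map (quotientSize s)

theorem card_classSizes (s : Setoid D) :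
    Multiset.card (classSizes s) = Nat.card (Quotient s) := by
  classical
  let _ := Fintype.ofFinite (Quotient s)
  simp [classSizes, Nat.card_eq_fintype_card]

theorem classSizes_eq_cons (s : Setoid D) (a : D) :
    classSizes s = classSize s a ::ₘ otherClassSizes s a := by
  classical
  let _ := Fintype.ofFinite (Quotient s)
  rw [otherClassSizes, ← quotientSize_mk, ← Multiset.map_cons,
    ← Finset.insert_val_of_notMem (Finset.notMem_erase _ _),
    Finset.insert_erase (Finset.mem_univ _), classSizes]

theorem count_classSizes (s : Setoid D) (i : ℕ) :
    (classSizes s).count i = Nat.card {q : Quotient s // quotientSize s q = i} := by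
  classical
  let _ := Fintype.ofFinite (Quotient s)
  rw [classSizes, Multiset.count_map, Nat.card_eq_fintype_card, Fintype.card_subtype]
  simp only [eq_comm]
  rfl

theorem pos_of_mem_classSizes (s : Setoid D) {i : ℕ} (h : i ∈ classSizes s) : 0 < i := by
  classical
  obtain ⟨q, -, rfl⟩ := Multiset.mem_map.1 h
  induction q using Quotient.inductionOn with | _ a =>
  exact classSize_pos s a

theorem classSizes_of_unique [Unique D] (s : Setoid D) : classSizes s = {1} := by
  have card_eq_one : Multiset.card (classSizes s) = 1 := by
    rw [card_classSizes]
    exact Nat.card_unique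
  have size_eq_one : classSize s default = 1 :=
    Nat.card_eq_one_iff_unique.2 ⟨inferInstance, ⟨⟨default, s.refl' _⟩⟩⟩
  rw [classSizes_eq_cons s default, size_eq_one, Multiset.card_cons, Nat.add_eq_right,
    Multiset.card_eq_zero] at card_eq_one
  rw [classSizes_eq_cons s default, size_eq_one, card_eq_one, Multiset.cons_zero]

theorem classSizes_eq_of_equiv {s : Setoid D} {t : Setoid E} (e : D ≃ E)
    (h : ∀ x y, s x y ↔ t (e x) (e y)) : classSizes s = classSizes t := by
  classical
  let _ := Fintype.ofFinite (Quotient s)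
  let _ := Fintype.ofFinite (Quotient t)
  let g : Quotient s ≃ Quotient t := Quotient.congr e h
  have quotientSize_g : ∀ q, quotientSize t (g q) = quotientSize s q := fun q => by
    induction q using Quotient.inductionOn with | _ a =>
    exact (classSize_eq_of_equiv e h a).symm
  rw [classSizes, classSizes, ← Multiset.map_univ_val_equiv g, Multiset.map_map]
  exact Multiset.map_congr rfl fun q _ => (quotientSize_g q).symm

end Finite

section Merge

/-- The setoid obtained from `s` by merging the classes of `a` and `b`. -/
def merge (s : Setoid D) (a b : D) : Setoid D where
  r x y := s x y ∨ (s x a ∨ s x b) ∧ (s y a ∨ s y b)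
  iseqv := by
    refine ⟨fun x => Or.inl (s.refl' x), fun h => h.imp s.symm' And.symm, ?_⟩
    rintro x y z (hxy | ⟨hx, hy⟩) (hyz | ⟨hy', hz⟩)
    · exact Or.inl (s.trans' hxy hyz)
    · exact Or.inr ⟨hy'.imp (s.trans' hxy) (s.trans' hxy), hz⟩
    · exact Or.inr ⟨hx, hy.imp (s.trans' (s.symm' hyz)) (s.trans' (s.symm' hyz))⟩
    · exact Or.inr ⟨hx, hz⟩

theorem merge_rel (s : Setoid D) (a b x y : D) :
    merge s a b x y ↔ s x y ∨ (s x a ∨ s x b) ∧ (s y a ∨ s y b) := Iff.rfl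

theorem le_merge (s : Setoid D) (a b : D) : s ≤ merge s a b := fun _ _ h => Or.inl h

theorem merge_rel_self (s : Setoid D) (a b : D) : merge s a b a b :=
  Or.inr ⟨Or.inl (s.refl' a), Or.inr (s.refl' b)⟩

theorem merge_le {s t : Setoid D} {a b : D} (h : s ≤ t) (hab : t a b) : merge s a b ≤ t := by
  have rel_a : ∀ {x}, s x a ∨ s x b → t x a := fun hx =>
    hx.elim (fun hxa => h hxa) fun hxb => t.trans' (h hxb) (t.symm' hab)
  rintro x y (hxy | ⟨hx, hy⟩)
  · exact h hxy
  · exact t.trans' (rel_a hx) (t.symm' (rel_a hy))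

theorem merge_eq_self {s : Setoid D} {a b : D} (h : s a b) : merge s a b = s :=
  le_antisymm (merge_le le_rfl h) (le_merge s a b)

theorem merge_rel_left_iff (s : Setoid D) {a b x : D} : merge s a b x a ↔ s x a ∨ s x b := by
  have := s.refl' a
  rw [merge_rel]
  tauto

theorem rel_right_of_merge_eq_top {s : Setoid D} {a b x : D} (h : merge s a b = ⊤)
    (hx : ¬ s x a) : s x b :=
  ((merge_rel_left_iff s).1 (h ▸ trivial : merge s a b x a)).resolve_left hx

theorem merge_rel_iff_of_not_rel {s : Setoid D} {a b x y : D} (hy : ¬ (s y a ∨ s y b)) :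
    merge s a b x y ↔ s x y := or_iff_left fun h => hy h.2

variable [Finite D]

theorem classSize_merge {s : Setoid D} {a b : D} (h : ¬ s a b) :
    classSize (merge s a b) a = classSize s a + classSize s b := by
  classical
  have disjoint_classes : Disjoint (fun d => s d a) fun d => s d b := by
    rw [Pi.disjoint_iff]
    exact fun d => Prop.disjoint_iff.2 fun hd => h (s.trans' (s.symm' hd.1) hd.2)
  rw [classSize, classSize, classSize, ← Nat.card_sum]
  exact Nat.card_congr ((Equiv.subtypeEquivRight fun _ => merge_rel_left_iff s).trans
    (subtypeOrEquiv _ _ disjoint_classes))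

theorem otherClassSizes_eq_cons {s : Setoid D} {a b : D} (h : ¬ s a b) :
    otherClassSizes s a = classSize s b ::ₘ otherClassSizes (merge s a b) a := by
  classical
  let _ := Fintype.ofFinite (Quotient s)
  let _ := Fintype.ofFinite (Quotient (merge s a b))
  let p : Quotient s → Quotient (merge s a b) := Setoid.map_of_le (le_merge s a b)
  let R : Finset (Quotient s) := (Finset.univ.erase (Quotient.mk s a)).erase (Quotient.mk s b)
  have mem_R : ∀ x, Quotient.mk s x ∈ R ↔ ¬ (s x a ∨ s x b) := fun x => by
    simp only [R, Finset.mem_erase, Finset.mem_univ, and_true, ne_eq]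
    rw [Quotient.eq, Quotient.eq, not_or, and_comm]
  have p_injOn : Set.InjOn p R := fun q _ q' hq' hqq => by
    induction q, q' using Quotient.inductionOn₂ with | _ x y =>
    exact Quotient.sound ((merge_rel_iff_of_not_rel ((mem_R y).1 hq')).1 (Quotient.exact hqq))
  have image_R : R.image p = Finset.univ.erase (Quotient.mk _ a) := by
    ext q
    induction q using Quotient.inductionOn with | _ x =>
    rw [Finset.mem_image, Finset.mem_erase, and_iff_left (Finset.mem_univ _), ne_eq, Quotient.eq]
    refine ⟨?_, fun hx => ⟨Quotient.mk s x, (mem_R x).2 fun hxab =>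
      hx ((merge_rel_left_iff s).2 hxab), rfl⟩⟩
    rintro ⟨q, hq, hqx⟩ hxa
    induction q using Quotient.inductionOn with | _ y =>
    exact (mem_R y).1 hq
      ((merge_rel_left_iff s).1 ((merge s a b).trans' (Quotient.exact hqx) hxa))
  have size_p : ∀ q ∈ R, quotientSize (merge s a b) (p q) = quotientSize s q := fun q hq => by
    induction q using Quotient.inductionOn with | _ x =>
    exact Nat.card_congr (Equiv.subtypeEquivRight fun _ =>
      merge_rel_iff_of_not_rel ((mem_R x).1 hq))
  have mk_b_mem : Quotient.mk s b ∈ Finset.univ.erase (Quotient.mk s a) := by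
    rw [Finset.mem_erase, ne_eq, Quotient.eq]
    exact ⟨fun hba => h (s.symm' hba), Finset.mem_univ _⟩
  rw [otherClassSizes, otherClassSizes, ← image_R, Finset.image_val_of_injOn p_injOn,
    Multiset.map_map, ← Finset.insert_erase mk_b_mem,
    Finset.insert_val_of_notMem (Finset.notMem_erase _ _), Multiset.map_cons, quotientSize_mk]
  exact congrArg _ (Multiset.map_congr rfl fun q hq => (size_p q hq).symm)

theorem otherClassSizes_congr {s : Setoid D} {a b : D} (h : s a b) :
    otherClassSizes s a = otherClassSizes s b := by
  have := (classSizes_eq_cons s a).symm.trans (classSizes_eq_cons s b)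
  rwa [classSize_congr s h, Multiset.cons_inj_right] at this

theorem card_quotient_merge {s : Setoid D} {a b : D} (h : ¬ s a b) :
    Nat.card (Quotient (merge s a b)) + 1 = Nat.card (Quotient s) := by
  rw [← card_classSizes, ← card_classSizes, classSizes_eq_cons s a, otherClassSizes_eq_cons h,
    classSizes_eq_cons (merge s a b) a]
  simp only [Multiset.card_cons]

theorem card_quotient_merge_le (s : Setoid D) (a b : D) :
    Nat.card (Quotient (merge s a b)) ≤ Nat.card (Quotient s) := by
  by_cases h : s a b
  · rw [merge_eq_self h]
  · exact (card_quotient_merge h).symm ▸ Nat.le_succ _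

theorem card_quotient_le_card_quotient_merge_add_one (s : Setoid D) (a b : D) :
    Nat.card (Quotient s) ≤ Nat.card (Quotient (merge s a b)) + 1 := by
  by_cases h : s a b
  · rw [merge_eq_self h]
    exact Nat.le_succ _
  · exact (card_quotient_merge h).ge

end Merge

section Sum

/-- The disjoint union of two setoids. -/
def sum (s : Setoid D) (t : Setoid E) : Setoid (D ⊕ E) where
  r := Sum.LiftRel s t
  iseqv := by
    refine ⟨?_, ?_, ?_⟩
    · rintro (x | x)
      · exact .inl (s.refl' x)
      · exact .inr (t.refl' x)
    · rintro _ _ (h | h)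
      · exact .inl (s.symm' h)
      · exact .inr (t.symm' h)
    · rintro _ _ _ (h | h) (k | k)
      · exact .inl (s.trans' h k)
      · exact .inr (t.trans' h k)

variable (s : Setoid D) (t : Setoid E)

@[simp]
theorem sum_inl_inl (x y : D) : sum s t (.inl x) (.inl y) ↔ s x y := Sum.liftRel_inl_inl

@[simp]
theorem sum_inr_inr (x y : E) : sum s t (.inr x) (.inr y) ↔ t x y := Sum.liftRel_inr_inr

@[simp]
theorem sum_inl_inr (x : D) (y : E) : ¬ sum s t (.inl x) (.inr y) := Sum.not_liftRel_inl_inr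

@[simp]
theorem sum_inr_inl (x : E) (y : D) : ¬ sum s t (.inr x) (.inl y) := Sum.not_liftRel_inr_inl

theorem classSize_sum_inl (a : D) : classSize (sum s t) (.inl a) = classSize s a := by
  refine (Nat.card_congr (Equiv.ofBijective (fun d => ⟨.inl d.1, (sum_inl_inl s t _ _).2 d.2⟩)
    ⟨fun x y h => ?_, ?_⟩)).symm
  · simpa [Subtype.ext_iff] using h
  · rintro ⟨x | x, hx⟩
    · exact ⟨⟨x, (sum_inl_inl s t _ _).1 hx⟩, rfl⟩
    · exact absurd hx (sum_inr_inl s t _ _)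

theorem classSize_sum_inr (a : E) : classSize (sum s t) (.inr a) = classSize t a := by
  refine (Nat.card_congr (Equiv.ofBijective (fun d => ⟨.inr d.1, (sum_inr_inr s t _ _).2 d.2⟩)
    ⟨fun x y h => ?_, ?_⟩)).symm
  · simpa [Subtype.ext_iff] using h
  · rintro ⟨x | x, hx⟩
    · exact absurd hx (sum_inl_inr s t _ _)
    · exact ⟨⟨x, (sum_inr_inr s t _ _).1 hx⟩, rfl⟩

/-- The classes of a disjoint union are the classes of its two parts. -/
def quotientSumEquiv : Quotient s ⊕ Quotient t ≃ Quotient (sum s t) where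
  toFun := Sum.elim (Quotient.map Sum.inl fun _ _ => .inl) (Quotient.map Sum.inr fun _ _ => .inr)
  invFun := Quotient.lift (Sum.map (Quotient.mk s) (Quotient.mk t)) (by
    rintro _ _ (h | h)
    · exact congrArg Sum.inl (Quotient.sound h)
    · exact congrArg Sum.inr (Quotient.sound h))
  left_inv := by
    rintro (q | q) <;> induction q using Quotient.inductionOn with | _ x => rfl
  right_inv q := by
    induction q using Quotient.inductionOn with | _ x =>
    cases x <;> rfl

theorem classSizes_sum [Finite D] [Finite E] :
    classSizes (sum s t) = classSizes s + classSizes t := by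
  classical
  let _ := Fintype.ofFinite (Quotient s)
  let _ := Fintype.ofFinite (Quotient t)
  let _ := Fintype.ofFinite (Quotient (sum s t))
  rw [classSizes, ← Multiset.map_univ_val_equiv (quotientSumEquiv s t), Multiset.map_map,
    ← Finset.univ_disjSum_univ, classSizes, classSizes]
  simp only [Finset.disjSum, Multiset.disjSum, Multiset.map_add, Multiset.map_map]
  congr 1 <;> refine Multiset.map_congr rfl fun q _ => ?_ <;>
    induction q using Quotient.inductionOn with | _ x => ?_
  · exact classSize_sum_inl s t x
  · exact classSize_sum_inr s t x

theorem card_quotient_sum [Finite D] [Finite E] :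
    Nat.card (Quotient (sum s t)) = Nat.card (Quotient s) + Nat.card (Quotient t) := by
  rw [← Nat.card_congr (quotientSumEquiv s t), Nat.card_sum]

theorem merge_sum_top (a : D) (b : E) :
    merge (sum (⊤ : Setoid D) (⊤ : Setoid E)) (.inl a) (.inr b) = ⊤ := by
  have rel_ends : ∀ x, sum (⊤ : Setoid D) (⊤ : Setoid E) x (.inl a) ∨
      sum (⊤ : Setoid D) (⊤ : Setoid E) x (.inr b) := by
    rintro (x | x) <;> simp
  exact Setoid.eq_top_iff.2 fun x y => Or.inr ⟨rel_ends x, rel_ends y⟩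

end Sum

end SetoidClass

/-! ### Cycles of permutations and Euler's inequality -/

namespace PermCycles

open Equiv Equiv.Perm SetoidClass

variable {D E : Type*}

/-- The partition of a set into the cycles of a permutation, fixed points included. -/
abbrev cycles (π : Perm D) : Setoid D := SameCycle.setoid π

/-- The number of cycles of a permutation, fixed points included. -/
noncomputable abbrev numCycles (π : Perm D) : ℕ := Nat.card (Quotient (cycles π))

theorem cycles_rel (π : Perm D) (x y : D) : cycles π x y ↔ SameCycle π x y := Iff.rfl

theorem cycles_le_iff {π : Perm D} {s : Setoid D} : cycles π ≤ s ↔ ∀ x, s x (π x) := by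
  refine ⟨fun h x => h ⟨1, by simp⟩, fun h x y hxy => ?_⟩
  have rel_pow (n : ℕ) (x : D) : s x ((π ^ n) x) := by
    induction n generalizing x with
    | zero => exact s.refl' x
    | succ n ih => exact pow_succ' π n ▸ s.trans' (ih x) (h _)
  obtain ⟨k, rfl⟩ := hxy
  obtain ⟨n, rfl | rfl⟩ := k.eq_nat_or_neg
  · simpa using rel_pow n x
  · simpa using s.symm' (rel_pow n ((π ^ (-(n : ℤ))) x))

theorem cycles_rel_apply (π : Perm D) (x : D) : cycles π x (π x) := cycles_le_iff.1 le_rfl x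

theorem classSize_cycles_inv_apply (π : Perm D) (x : D) :
    classSize (cycles π) (π⁻¹ x) = classSize (cycles π) x :=
  classSize_congr _ (by simpa using cycles_rel_apply π (π⁻¹ x))

theorem otherClassSizes_cycles_inv_apply [Finite D] (π : Perm D) (x : D) :
    otherClassSizes (cycles π) (π⁻¹ x) = otherClassSizes (cycles π) x :=
  otherClassSizes_congr (by simpa using cycles_rel_apply π (π⁻¹ x))

theorem classSize_cycles_eq_minimalPeriod [Finite D] (π : Perm D) (a : D) :
    classSize (cycles π) a = Function.minimalPeriod π a := by
  classical
  let _ := Fintype.ofFinite D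
  rw [show Function.minimalPeriod π a = Function.minimalPeriod (π • ·) a from rfl,
    MulAction.minimalPeriod_eq_card, ← Nat.card_eq_fintype_card, classSize]
  refine Nat.card_congr (Equiv.subtypeEquivRight fun d => ?_)
  rw [cycles_rel, sameCycle_comm, MulAction.mem_orbit_iff]
  constructor
  · rintro ⟨k, hk⟩
    exact ⟨⟨π ^ k, k, rfl⟩, hk⟩
  · rintro ⟨⟨_, k, rfl⟩, hk⟩
    exact ⟨k, hk⟩

theorem injOn_pow_apply [Finite D] (π : Perm D) (a : D) :
    Set.InjOn (fun i : ℕ => (π ^ i) a) (Set.Iio (classSize (cycles π) a)) := by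
  rw [classSize_cycles_eq_minimalPeriod]
  simpa only [iterate_eq_pow] using Function.iterate_injOn_Iio_minimalPeriod (f := π) (x := a)

theorem exists_pow_succ_apply_eq [Finite D] {π : Perm D} {a x : D} (h : SameCycle π a x) :
    ∃ k < classSize (cycles π) a, (π ^ (k + 1)) a = x := by
  obtain ⟨n, -, hn⟩ := (sameCycle_symm_apply_right.2 h).exists_pow_eq'
  refine ⟨n % classSize (cycles π) a, Nat.mod_lt _ (classSize_pos _ a), ?_⟩
  rw [pow_succ', mul_apply, classSize_cycles_eq_minimalPeriod, ← iterate_eq_pow,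
    Function.iterate_mod_minimalPeriod_eq, iterate_eq_pow, hn, apply_symm_apply]

/-! #### Multiplication by a transposition -/

section Swap

variable [DecidableEq D]

theorem cycles_mul_swap_le_merge (π : Perm D) (a b : D) :
    cycles (π * swap a b) ≤ merge (cycles π) a b := by
  have rel_apply : ∀ x, merge (cycles π) a b x (π x) := fun x =>
    le_merge (cycles π) a b (cycles_rel_apply π x)
  have rel_ab : merge (cycles π) a b a b := merge_rel_self (cycles π) a b
  refine cycles_le_iff.2 fun x => ?_
  rw [mul_apply]
  rcases eq_or_ne x a with rfl | hxa
  · rw [swap_apply_left]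
    exact Setoid.trans' _ rel_ab (rel_apply b)
  rcases eq_or_ne x b with rfl | hxb
  · rw [swap_apply_right]
    exact Setoid.trans' _ (Setoid.symm' _ rel_ab) (rel_apply a)
  · rw [swap_apply_of_ne_of_ne hxa hxb]
    exact rel_apply x

theorem merge_cycles_mul_swap (π : Perm D) (a b : D) :
    merge (cycles (π * swap a b)) a b = merge (cycles π) a b := by
  refine le_antisymm (merge_le (cycles_mul_swap_le_merge π a b) (merge_rel_self _ a b))
    (merge_le ?_ (merge_rel_self _ a b))
  simpa [mul_assoc] using cycles_mul_swap_le_merge (π * swap a b) a b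

variable [Finite D]

theorem sameCycle_mul_swap {π : Perm D} {a b : D} (h : ¬ SameCycle π a b) :
    SameCycle (π * swap a b) a b := by
  by_contra hb
  -- `π * swap a b` maps `a` to `π b` and agrees with `π` along the cycle of `b` until it closes up
  have rel_pow : ∀ n : ℕ, SameCycle (π * swap a b) a ((π ^ (n + 1)) b) := by
    intro n
    induction n with
    | zero => exact ⟨1, by simp⟩
    | succ n ih =>
      have ne_a : (π ^ (n + 1)) b ≠ a := fun k =>
        h (SameCycle.symm ⟨(n + 1 : ℕ), by rwa [zpow_natCast]⟩)
      have ne_b : (π ^ (n + 1)) b ≠ b := fun k => hb (by rwa [k] at ih)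
      have rel_next := cycles_rel_apply (π * swap a b) ((π ^ (n + 1)) b)
      rw [mul_apply, swap_apply_of_ne_of_ne ne_a ne_b] at rel_next
      rw [pow_succ' _ (n + 1), mul_apply]
      exact ih.trans rel_next
  have := rel_pow (orderOf π - 1)
  rw [Nat.sub_add_cancel (orderOf_pos π), pow_orderOf_eq_one] at this
  exact hb this

theorem cycles_mul_swap {π : Perm D} {a b : D} (h : ¬ SameCycle π a b) :
    cycles (π * swap a b) = merge (cycles π) a b := by
  rw [← merge_cycles_mul_swap]
  exact (merge_eq_self (sameCycle_mul_swap h)).symm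

theorem numCycles_mul_swap {π : Perm D} {a b : D} (h : ¬ SameCycle π a b) :
    numCycles (π * swap a b) + 1 = numCycles π := by
  rw [numCycles, cycles_mul_swap h]
  exact card_quotient_merge h

theorem numCycles_le_numCycles_mul_swap_add_one (π : Perm D) (a b : D) :
    numCycles π ≤ numCycles (π * swap a b) + 1 :=
  calc numCycles π ≤ Nat.card (Quotient (merge (cycles π) a b)) + 1 :=
        card_quotient_le_card_quotient_merge_add_one _ a b
    _ = Nat.card (Quotient (merge (cycles (π * swap a b)) a b)) + 1 := by
        rw [merge_cycles_mul_swap]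
    _ ≤ numCycles (π * swap a b) + 1 := Nat.add_le_add_right (card_quotient_merge_le _ a b) 1

end Swap

/-! #### Involutions -/

section Involution

variable [DecidableEq D] {α : Perm D}

theorem involutive_mul_swap (hα : Function.Involutive α) {a b : D}
    (hab : swap (α a) (α b) = swap a b) : Function.Involutive (α * swap a b) := fun d => by
  have commute : α * swap a b = swap a b * α := by rw [mul_swap_eq_swap_mul, hab]
  calc (α * swap a b) ((α * swap a b) d) = (swap a b * α) ((α * swap a b) d) := by rw [commute]
    _ = d := by rw [mul_apply, mul_apply, hα, swap_apply_self]

/-- The involution obtained from `α` by turning `r` and `α r` into fixed points; if `α` pairs the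
darts of a map, this cuts the edge of `r` into two halves. -/
def cutEdge (α : Perm D) (r : D) : Perm D := α * swap r (α r)

theorem cutEdge_mul_swap (α : Perm D) (r : D) : cutEdge α r * swap r (α r) = α := by
  rw [cutEdge, mul_assoc, swap_mul_self, mul_one]

theorem involutive_cutEdge (hα : Function.Involutive α) (r : D) :
    Function.Involutive (cutEdge α r) :=
  involutive_mul_swap hα (by rw [hα r, swap_comm])

theorem cutEdge_apply_eq_self_iff (hα : Function.Involutive α) {r d : D} :
    cutEdge α r d = d ↔ α d = d ∨ d = r ∨ d = α r := by
  rw [cutEdge, mul_apply]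
  rcases eq_or_ne d r with rfl | hr
  · simp [hα d]
  rcases eq_or_ne d (α r) with rfl | hr'
  · simp
  · simp [swap_apply_of_ne_of_ne hr hr', hr, hr']

theorem mul_swap_apply_ne_self {a b : D} (hab : a ≠ b) (hfix : ∀ d, α d = d ↔ d = a ∨ d = b)
    (d : D) : (α * swap a b) d ≠ d := by
  rw [mul_apply]
  rcases eq_or_ne d a with rfl | ha
  · rw [swap_apply_left, (hfix b).2 (Or.inr rfl)]
    exact hab.symm
  rcases eq_or_ne d b with rfl | hb
  · rwa [swap_apply_right, (hfix a).2 (Or.inl rfl)]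
  · rw [swap_apply_of_ne_of_ne ha hb]
    exact fun k => ((hfix d).1 k).elim ha hb

end Involution

theorem natCard_eq_two_mul_numCycles [Finite D] {α : Perm D} (hα : Function.Involutive α)
    (hne : ∀ d, α d ≠ d) : Nat.card D = 2 * numCycles α := by
  classical
  let _ := Fintype.ofFinite (Quotient (cycles α))
  have size_eq_two : ∀ q : Quotient (cycles α), quotientSize (cycles α) q = 2 := by
    intro q
    induction q using Quotient.inductionOn with | _ a =>
    rw [quotientSize_mk, classSize_cycles_eq_minimalPeriod]
    exact Function.minimalPeriod_eq_prime (hα a) (hne a)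
  rw [← Nat.card_congr (Equiv.sigmaFiberEquiv fun d => Quotient.mk (cycles α) d), Nat.card_sigma]
  simp only [natCard_fiber_mk, size_eq_two]
  simp [numCycles, Nat.card_eq_fintype_card, mul_comm]

/-! #### The group generated by two permutations -/

/-- The partition into the orbits of the group generated by two permutations. -/
abbrev orbits (σ α : Perm D) : Setoid D := cycles σ ⊔ cycles α

theorem orbits_le_iff {σ α : Perm D} {s : Setoid D} :
    orbits σ α ≤ s ↔ (∀ x, s x (σ x)) ∧ ∀ x, s x (α x) := by
  rw [sup_le_iff, cycles_le_iff, cycles_le_iff]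

theorem orbits_rel_left (σ α : Perm D) (x : D) : orbits σ α x (σ x) :=
  (orbits_le_iff.1 le_rfl).1 x

theorem orbits_rel_right (σ α : Perm D) (x : D) : orbits σ α x (α x) :=
  (orbits_le_iff.1 le_rfl).2 x

theorem cycles_mul_le_orbits (σ α : Perm D) : cycles (σ * α) ≤ orbits σ α :=
  cycles_le_iff.2 fun x => Setoid.trans' _ (orbits_rel_right σ α x) (orbits_rel_left σ α _)

theorem orbits_mul_swap_le_merge [DecidableEq D] (σ α : Perm D) (a b : D) :
    orbits σ (α * swap a b) ≤ merge (orbits σ α) a b :=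
  sup_le (le_sup_left.trans (le_merge _ a b)) ((cycles_mul_swap_le_merge α a b).trans
    (merge_le (le_sup_right.trans (le_merge _ a b)) (merge_rel_self _ a b)))

theorem merge_orbits_mul_swap [DecidableEq D] (σ α : Perm D) (a b : D) :
    merge (orbits σ (α * swap a b)) a b = merge (orbits σ α) a b := by
  refine le_antisymm (merge_le (orbits_mul_swap_le_merge σ α a b) (merge_rel_self _ a b))
    (merge_le ?_ (merge_rel_self _ a b))
  simpa [mul_assoc] using orbits_mul_swap_le_merge σ (α * swap a b) a b

theorem orbits_rel_of_mem_closure {σ α g : Perm D} (hg : g ∈ Subgroup.closure {σ, α}) (x : D) :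
    orbits σ α x (g x) := by
  induction hg using Subgroup.closure_induction generalizing x with
  | mem g hg =>
    rcases hg with rfl | rfl
    · exact orbits_rel_left _ _ x
    · exact orbits_rel_right _ _ x
  | one => exact Setoid.refl' _ x
  | mul g g' _ _ ih ih' => exact Setoid.trans' _ (ih' x) (ih _)
  | inv g _ ih => simpa using Setoid.symm' _ (ih (g⁻¹ x))

theorem isPretransitive_closure_iff {σ α : Perm D} :
    MulAction.IsPretransitive (Subgroup.closure {σ, α}) D ↔ orbits σ α = ⊤ := by
  refine ⟨fun h => Setoid.eq_top_iff.2 fun x y => ?_, fun h => ⟨fun x y => ?_⟩⟩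
  · obtain ⟨g, rfl⟩ := h.exists_smul_eq x y
    exact orbits_rel_of_mem_closure g.2 x
  · have orbits_le : orbits σ α ≤ MulAction.orbitRel (Subgroup.closure {σ, α}) D :=
      orbits_le_iff.2
        ⟨fun x => Setoid.symm' _ ⟨⟨σ, Subgroup.subset_closure (by simp)⟩, rfl⟩,
          fun x => Setoid.symm' _ ⟨⟨α, Subgroup.subset_closure (by simp)⟩, rfl⟩⟩
    rw [h] at orbits_le
    exact orbits_le (x := y) (y := x) trivial

theorem card_quotient_top [Nonempty D] : Nat.card (Quotient (⊤ : Setoid D)) = 1 :=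
  Nat.card_eq_one_iff_unique.2
    ⟨Quotient.subsingleton_iff.2 rfl, ‹Nonempty D›.map (Quotient.mk _)⟩

/-! #### Euler's inequality -/

theorem euler_identity_one [Finite D] (σ : Perm D) :
    numCycles σ + numCycles (1 : Perm D) + numCycles (σ * 1) =
      Nat.card D + 2 * Nat.card (Quotient (orbits σ 1)) := by
  have cycles_one : cycles (1 : Perm D) = ⊥ := by
    ext x y
    rw [cycles_rel, sameCycle_one]
    rfl
  rw [orbits, numCycles, numCycles, numCycles, cycles_one, sup_bot_eq, mul_one,
    Nat.card_congr Setoid.quotientBotEquiv]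
  omega

theorem merge_orbits_cutEdge [DecidableEq D] (σ α : Perm D) (a : D) :
    merge (orbits σ (cutEdge α a)) a (α a) = orbits σ α := by
  rw [cutEdge, merge_orbits_mul_swap, merge_eq_self (orbits_rel_right σ α a)]

section CutEdge

variable [Finite D] [DecidableEq D] {σ α : Perm D} {a : D}

theorem numCycles_cutEdge (hα : Function.Involutive α) (ha : α a ≠ a) :
    numCycles (cutEdge α a) = numCycles α + 1 := by
  have apply_self : cutEdge α a a = a := (cutEdge_apply_eq_self_iff hα).2 (Or.inr (Or.inl rfl))
  have not_sameCycle : ¬ SameCycle (cutEdge α a) a (α a) := fun h =>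
    ha (h.eq_of_left apply_self).symm
  rw [← numCycles_mul_swap not_sameCycle, cutEdge_mul_swap]

theorem numCycles_mul_cutEdge (h : ¬ orbits σ (cutEdge α a) a (α a)) :
    numCycles (σ * cutEdge α a) = numCycles (σ * α) + 1 := by
  have not_sameCycle : ¬ SameCycle (σ * cutEdge α a) a (α a) := fun k =>
    h (cycles_mul_le_orbits _ _ k)
  rw [← numCycles_mul_swap not_sameCycle, mul_assoc, cutEdge_mul_swap]

theorem euler_le_of_cutEdge (hα : Function.Involutive α) (ha : α a ≠ a)
    (h : numCycles σ + numCycles (cutEdge α a) + numCycles (σ * cutEdge α a) ≤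
      Nat.card D + 2 * Nat.card (Quotient (orbits σ (cutEdge α a)))) :
    numCycles σ + numCycles α + numCycles (σ * α) ≤
      Nat.card D + 2 * Nat.card (Quotient (orbits σ α)) := by
  rw [numCycles_cutEdge hα ha] at h
  rw [← merge_orbits_cutEdge σ α a]
  by_cases hc : orbits σ (cutEdge α a) a (α a)
  · have faces_le := numCycles_le_numCycles_mul_swap_add_one (σ * α) a (α a)
    rw [mul_assoc, ← cutEdge] at faces_le
    rw [merge_eq_self hc]
    omega
  · have card_orbits := card_quotient_merge hc
    rw [numCycles_mul_cutEdge hc] at h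
    omega

end CutEdge

theorem euler_le [Finite D] (σ α : Perm D) (hα : Function.Involutive α) :
    numCycles σ + numCycles α + numCycles (σ * α) ≤
      Nat.card D + 2 * Nat.card (Quotient (orbits σ α)) := by
  classical
  induction hn : {d | α d ≠ d}.ncard using Nat.strong_induction_on generalizing α with
  | _ n ih =>
  by_cases h : ∀ a, α a = a
  · obtain rfl : α = 1 := Equiv.ext h
    exact (euler_identity_one σ).le
  · push Not at h
    obtain ⟨a, ha⟩ := h
    refine euler_le_of_cutEdge hα ha (ih _ ?_ _ (involutive_cutEdge hα a) rfl)
    have moved_ssubset : {d | cutEdge α a d ≠ d} ⊂ {d | α d ≠ d} := by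
      refine ⟨fun d hd k => hd ((cutEdge_apply_eq_self_iff hα).2 (Or.inl k)), fun k => k ha ?_⟩
      exact (cutEdge_apply_eq_self_iff hα).2 (Or.inr (Or.inl rfl))
    exact hn ▸ Set.ncard_lt_ncard moved_ssubset

/-- Two permutations that generate a transitive group and satisfy Euler's relation for the sphere;
if `α` is an involution with fixed points, this describes a planar map with some half-edges. -/
structure Planar (σ α : Perm D) : Prop where
  orbits_eq : orbits σ α = ⊤
  euler : numCycles σ + numCycles α + numCycles (σ * α) = Nat.card D + 2

theorem euler_le_of_orbits_eq_top [Finite D] [Nonempty D] (σ α : Perm D)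
    (hα : Function.Involutive α) (h : orbits σ α = ⊤) :
    numCycles σ + numCycles α + numCycles (σ * α) ≤ Nat.card D + 2 := by
  simpa only [h, card_quotient_top, mul_one] using euler_le σ α hα

section PlanarCutEdge

variable [Finite D] [DecidableEq D] {σ α : Perm D} {a : D}

theorem Planar.not_sameCycle_of_orbits_cutEdge_eq_top (h : Planar σ α)
    (hα : Function.Involutive α) (ha : α a ≠ a) (h_top : orbits σ (cutEdge α a) = ⊤) :
    ¬ SameCycle (σ * α) a (α a) := by
  intro sameCycle
  have : Nonempty D := ⟨a⟩
  have euler_cut := euler_le_of_orbits_eq_top σ _ (involutive_cutEdge hα a) h_top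
  have faces_le := card_quotient_merge_le (cycles (σ * cutEdge α a)) a (α a)
  rw [cutEdge, ← mul_assoc, merge_cycles_mul_swap, merge_eq_self sameCycle, mul_assoc,
    ← cutEdge] at faces_le
  have edges_eq := numCycles_cutEdge hα ha
  have euler_eq := h.euler
  rw [← numCycles, ← numCycles] at faces_le
  omega

theorem Planar.cutEdge (h : Planar σ α) (hα : Function.Involutive α) (ha : α a ≠ a)
    (h_top : orbits σ (cutEdge α a) = ⊤) : Planar σ (cutEdge α a) where
  orbits_eq := h_top
  euler := by
    have faces_eq := numCycles_mul_swap (h.not_sameCycle_of_orbits_cutEdge_eq_top hα ha h_top)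
    rw [mul_assoc, ← PermCycles.cutEdge] at faces_eq
    rw [numCycles_cutEdge hα ha, ← h.euler, ← faces_eq]
    omega

end PlanarCutEdge

/-! #### Relabelling -/

section Conj

variable {π σ α : Perm D} {π' σ' α' : Perm E} {e : D ≃ E}

theorem semiconj_mul_swap [DecidableEq D] [DecidableEq E] (h : Function.Semiconj e π π')
    (a b : D) : Function.Semiconj e (π * swap a b : Perm D) (π' * swap (e a) (e b) : Perm E) :=
  fun d => by rw [mul_apply, mul_apply, h, e.injective.map_swap]

theorem semiconj_cutEdge [DecidableEq D] [DecidableEq E] (h : Function.Semiconj e α α') (r : D) :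
    Function.Semiconj e (cutEdge α r) (cutEdge α' (e r)) := by
  rw [cutEdge, cutEdge, ← h r]
  exact semiconj_mul_swap h r (α r)

theorem semiconj_pow_apply (h : Function.Semiconj e π π') (n : ℕ) (a : D) :
    e ((π ^ n) a) = (π' ^ n) (e a) := by
  simpa only [iterate_eq_pow] using h.iterate_right n a

theorem cycles_le_comap (h : Function.Semiconj e π π') : cycles π ≤ (cycles π').comap e :=
  cycles_le_iff.2 fun x => by
    rw [Setoid.comap_rel, h x]
    exact cycles_rel_apply π' (e x)

theorem sameCycle_iff_of_conj (h : Function.Semiconj e π π') (x y : D) :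
    SameCycle π x y ↔ SameCycle π' (e x) (e y) := by
  have h_symm : Function.Semiconj e.symm π' π :=
    h.inverse_left e.left_inv e.right_inv
  refine ⟨fun k => cycles_le_comap h k, fun k => ?_⟩
  have rel_symm := cycles_le_comap h_symm k
  rwa [Setoid.comap_rel, symm_apply_apply, symm_apply_apply] at rel_symm

theorem classSize_eq_of_conj (h : Function.Semiconj e π π') (a : D) :
    classSize (cycles π) a = classSize (cycles π') (e a) :=
  classSize_eq_of_equiv e (sameCycle_iff_of_conj h) a

theorem orbits_le_comap (hσ : Function.Semiconj e σ σ') (hα : Function.Semiconj e α α') :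
    orbits σ α ≤ (orbits σ' α').comap e :=
  orbits_le_iff.2
    ⟨fun x => by simpa only [Setoid.comap_rel, hσ x] using orbits_rel_left σ' α' (e x),
      fun x => by simpa only [Setoid.comap_rel, hα x] using orbits_rel_right σ' α' (e x)⟩

theorem orbits_rel_iff_of_conj (hσ : Function.Semiconj e σ σ') (hα : Function.Semiconj e α α')
    (x y : D) : orbits σ α x y ↔ orbits σ' α' (e x) (e y) := by
  refine ⟨fun h => orbits_le_comap hσ hα h, fun h => ?_⟩
  have hσ_symm : Function.Semiconj e.symm σ' σ := hσ.inverse_left e.left_inv e.right_inv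
  have hα_symm : Function.Semiconj e.symm α' α := hα.inverse_left e.left_inv e.right_inv
  simpa only [Setoid.comap_rel, symm_apply_apply] using orbits_le_comap hσ_symm hα_symm h

theorem involutive_of_conj (h : Function.Semiconj e π π') (hπ' : Function.Involutive π') :
    Function.Involutive π := fun d => e.injective (by rw [h, h, hπ'])

theorem apply_eq_self_iff_of_conj (h : Function.Semiconj e π π') (d : D) :
    π d = d ↔ π' (e d) = e d := by
  rw [← h.eq, e.apply_eq_iff_eq]

variable [Finite D] [Finite E]

theorem classSizes_eq_of_conj (h : Function.Semiconj e π π') :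
    classSizes (cycles π) = classSizes (cycles π') :=
  classSizes_eq_of_equiv e (sameCycle_iff_of_conj h)

theorem otherClassSizes_eq_of_conj (h : Function.Semiconj e π π') (a : D) :
    otherClassSizes (cycles π) a = otherClassSizes (cycles π') (e a) := by
  have := classSizes_eq_of_conj h
  rwa [classSizes_eq_cons _ a, classSizes_eq_cons _ (e a), classSize_eq_of_conj h,
    Multiset.cons_inj_right] at this

theorem numCycles_eq_of_conj (h : Function.Semiconj e π π') : numCycles π = numCycles π' := by
  rw [numCycles, numCycles, ← card_classSizes, ← card_classSizes, classSizes_eq_of_conj h]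

theorem Planar.of_conj (h : Planar σ α) (hσ : Function.Semiconj e σ σ')
    (hα : Function.Semiconj e α α') : Planar σ' α' where
  orbits_eq := Setoid.eq_top_iff.2 fun x y => by
    rw [← e.apply_symm_apply x, ← e.apply_symm_apply y, ← orbits_rel_iff_of_conj hσ hα,
      h.orbits_eq]
    trivial
  euler := by
    have hφ : Function.Semiconj e (σ * α : Perm D) (σ' * α' : Perm E) := hσ.comp_right hα
    rw [← numCycles_eq_of_conj hσ, ← numCycles_eq_of_conj hα, ← numCycles_eq_of_conj hφ,
      ← Nat.card_congr e, h.euler]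

end Conj

/-! #### Disjoint unions -/

section SumCongr

theorem cycles_sumCongr (π : Perm D) (π' : Perm E) :
    cycles (Perm.sumCongr π π') = sum (cycles π) (cycles π') := by
  refine le_antisymm (cycles_le_iff.2 ?_) ?_
  · rintro (x | x)
    · simpa using cycles_rel_apply π x
    · simpa using cycles_rel_apply π' x
  · have le_inl : cycles π ≤ (cycles (Perm.sumCongr π π')).comap Sum.inl :=
      cycles_le_iff.2 fun x => cycles_rel_apply (Perm.sumCongr π π') (Sum.inl x)
    have le_inr : cycles π' ≤ (cycles (Perm.sumCongr π π')).comap Sum.inr :=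
      cycles_le_iff.2 fun x => cycles_rel_apply (Perm.sumCongr π π') (Sum.inr x)
    rintro _ _ (h | h)
    · exact le_inl h
    · exact le_inr h

theorem orbits_sumCongr (σ α : Perm D) (σ' α' : Perm E) :
    orbits (Perm.sumCongr σ σ') (Perm.sumCongr α α') = sum (orbits σ α) (orbits σ' α') := by
  refine le_antisymm (orbits_le_iff.2 ⟨?_, ?_⟩) ?_
  · rintro (x | x)
    · simpa using orbits_rel_left σ α x
    · simpa using orbits_rel_left σ' α' x
  · rintro (x | x)
    · simpa using orbits_rel_right σ α x
    · simpa using orbits_rel_right σ' α' x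
  · have rel_left := orbits_rel_left (Perm.sumCongr σ σ') (Perm.sumCongr α α')
    have rel_right := orbits_rel_right (Perm.sumCongr σ σ') (Perm.sumCongr α α')
    have le_inl : orbits σ α ≤ (orbits (Perm.sumCongr σ σ') (Perm.sumCongr α α')).comap Sum.inl :=
      orbits_le_iff.2 ⟨fun x => rel_left (Sum.inl x), fun x => rel_right (Sum.inl x)⟩
    have le_inr : orbits σ' α' ≤ (orbits (Perm.sumCongr σ σ') (Perm.sumCongr α α')).comap Sum.inr :=
      orbits_le_iff.2 ⟨fun x => rel_left (Sum.inr x), fun x => rel_right (Sum.inr x)⟩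
    rintro _ _ (h | h)
    · exact le_inl h
    · exact le_inr h

theorem planar_and_planar_of_euler_sumCongr [Finite D] [Finite E] [Nonempty D] [Nonempty E]
    {σ α : Perm D} {σ' α' : Perm E} (hα : Function.Involutive α) (hα' : Function.Involutive α')
    (h : orbits σ α = ⊤) (h' : orbits σ' α' = ⊤)
    (euler : numCycles (Perm.sumCongr σ σ') + numCycles (Perm.sumCongr α α') +
      numCycles (Perm.sumCongr σ σ' * Perm.sumCongr α α') = Nat.card (D ⊕ E) + 4) :
    Planar σ α ∧ Planar σ' α' := by
  have euler_le := euler_le_of_orbits_eq_top σ α hα h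
  have euler_le' := euler_le_of_orbits_eq_top σ' α' hα' h'
  simp only [sumCongr_mul, numCycles, cycles_sumCongr, card_quotient_sum, Nat.card_sum]
    at euler euler_le euler_le'
  exact ⟨⟨h, by simp only [numCycles]; omega⟩, ⟨h', by simp only [numCycles]; omega⟩⟩

theorem exists_sumCongr_eq {D' E' : Type*} {e : D ⊕ E ≃ D' ⊕ E'}
    (map_inl : ∀ a, ∃ a', e (.inl a) = .inl a') (map_inr : ∀ b, ∃ b', e (.inr b) = .inr b') :
    ∃ (e₁ : D ≃ D') (e₂ : E ≃ E'), e = Equiv.sumCongr e₁ e₂ := by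
  choose f hf using map_inl
  choose g hg using map_inr
  have e_eq : Sum.map f g = e := funext (Sum.rec (fun a => (hf a).symm) fun b => (hg b).symm)
  obtain ⟨f_bijective, g_bijective⟩ := Sum.map_bijective.1 (e_eq.symm ▸ e.bijective)
  exact ⟨.ofBijective f f_bijective, .ofBijective g g_bijective,
    Equiv.ext fun d => (congrFun e_eq d).symm⟩

theorem exists_semiconj_sumCongr (p : D → Prop) {e : {d // p d} ⊕ {d // ¬ p d} ≃ D}
    (e_inl : ∀ a, e (.inl a) = a) (e_inr : ∀ a, e (.inr a) = a) {σ : Perm D}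
    (hσ : ∀ d, p (σ d) ↔ p d) :
    ∃ (σ₁ : Perm {d // p d}) (σ₂ : Perm {d // ¬ p d}),
      Function.Semiconj e (Perm.sumCongr σ₁ σ₂) σ := by
  refine ⟨σ.subtypePerm hσ, σ.subtypePerm fun d => not_congr (hσ d), ?_⟩
  rintro (d | d) <;> simp [e_inl, e_inr]

end SumCongr

/-! #### Inserting a point into a cycle -/

section OptionCongr

theorem optionCongr_mul (σ α : Perm D) :
    optionCongr (σ * α) = optionCongr σ * optionCongr α := by
  ext (_ | d) <;> simp

theorem not_sameCycle_optionCongr (π : Perm D) (x : D) :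
    ¬ SameCycle (optionCongr π) none (some x) := fun h => by
  simpa using h.eq_of_left (by simp [Function.IsFixedPt])

theorem semiconj_optionEquivSumPUnit (π : Perm D) :
    Function.Semiconj (optionEquivSumPUnit.{0} D) (optionCongr π)
      (Perm.sumCongr π (1 : Perm PUnit.{1})) := by
  rintro (_ | d) <;> simp

theorem sameCycle_optionCongr_some (π : Perm D) (a b : D) :
    SameCycle (optionCongr π) (some a) (some b) ↔ SameCycle π a b := by
  rw [sameCycle_iff_of_conj (semiconj_optionEquivSumPUnit π), ← cycles_rel, cycles_sumCongr]
  exact sum_inl_inl _ _ _ _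

theorem classSize_optionCongr_some (π : Perm D) (x : D) :
    classSize (cycles (optionCongr π)) (some x) = classSize (cycles π) x := by
  rw [classSize_eq_of_conj (semiconj_optionEquivSumPUnit π), cycles_sumCongr]
  exact classSize_sum_inl _ _ _

theorem classSize_optionCongr_none (π : Perm D) :
    classSize (cycles (optionCongr π)) none = 1 := by
  have eq_none : ∀ d, cycles (optionCongr π) d none → d = none := fun d hd =>
    (SameCycle.eq_of_right hd (by simp [Function.IsFixedPt]))
  refine Nat.card_eq_one_iff_unique.2 ⟨⟨?_⟩, ⟨⟨none, Setoid.refl' _ _⟩⟩⟩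
  rintro ⟨x, hx⟩ ⟨y, hy⟩
  simp only [eq_none x hx, eq_none y hy]

variable [Finite D]

theorem classSizes_optionCongr (π : Perm D) :
    classSizes (cycles (optionCongr π)) = 1 ::ₘ classSizes (cycles π) := by
  rw [classSizes_eq_of_conj (semiconj_optionEquivSumPUnit π), cycles_sumCongr, classSizes_sum,
    classSizes_of_unique (cycles (1 : Perm PUnit.{1})), add_comm, Multiset.singleton_add]

theorem otherClassSizes_optionCongr_none (π : Perm D) :
    otherClassSizes (cycles (optionCongr π)) none = classSizes (cycles π) := by
  have := classSizes_optionCongr π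
  rwa [classSizes_eq_cons _ none, classSize_optionCongr_none, Multiset.cons_inj_right] at this

theorem numCycles_optionCongr (π : Perm D) : numCycles (optionCongr π) = numCycles π + 1 := by
  rw [numCycles, numCycles, ← card_classSizes, ← card_classSizes, classSizes_optionCongr,
    Multiset.card_cons]

end OptionCongr

section InsertBefore

open Classical in
/-- The permutation in which the new point `none` is inserted just before `x` in its cycle. -/
noncomputable def insertBefore (π : Perm D) (x : D) : Perm (Option D) :=
  swap none (some x) * optionCongr π

theorem insertBefore_none (π : Perm D) (x : D) : insertBefore π x none = some x := by
  simp [insertBefore]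

theorem insertBefore_some_of_eq {π : Perm D} {x d : D} (h : π d = x) :
    insertBefore π x (some d) = none := by
  simp [insertBefore, h]

theorem insertBefore_some_of_ne {π : Perm D} {x d : D} (h : π d ≠ x) :
    insertBefore π x (some d) = some (π d) := by
  simp [insertBefore, swap_apply_of_ne_of_ne, h]

theorem insertBefore_mul_optionCongr (σ α : Perm D) (x : D) :
    insertBefore σ x * optionCongr α = insertBefore (σ * α) x := by
  rw [insertBefore, insertBefore, mul_assoc, optionCongr_mul]

theorem insertBefore_eq_mul_swap [DecidableEq D] (π : Perm D) (x : D) :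
    insertBefore π x = optionCongr π * swap none (some (π⁻¹ x)) := by
  rw [mul_swap_eq_swap_mul, insertBefore]
  congr!
  simp

theorem cycles_insertBefore [Finite D] (π : Perm D) (x : D) :
    cycles (insertBefore π x) = merge (cycles (optionCongr π)) none (some (π⁻¹ x)) := by
  classical
  rw [insertBefore_eq_mul_swap, cycles_mul_swap (not_sameCycle_optionCongr _ _)]

theorem sameCycle_insertBefore_none (π : Perm D) (x : D) :
    SameCycle (insertBefore π x) none (some x) :=
  ⟨1, by rw [zpow_one, insertBefore_none]⟩

theorem sameCycle_insertBefore_some [Finite D] (π : Perm D) (x a b : D) :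
    SameCycle (insertBefore π x) (some a) (some b) ↔ SameCycle π a b := by
  have not_none : ∀ d, ¬ SameCycle (optionCongr π) (some d) none :=
    fun d h => not_sameCycle_optionCongr π d h.symm
  rw [← cycles_rel, cycles_insertBefore, merge_rel]
  simp only [cycles_rel, not_none, sameCycle_optionCongr_some, false_or]
  exact or_iff_left_of_imp fun h => h.1.trans h.2.symm

variable [Finite D]

theorem classSize_insertBefore_none (π : Perm D) (x : D) :
    classSize (cycles (insertBefore π x)) none = classSize (cycles π) x + 1 := by
  rw [cycles_insertBefore, classSize_merge (not_sameCycle_optionCongr _ _),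
    classSize_optionCongr_none, classSize_optionCongr_some, classSize_cycles_inv_apply, add_comm]

theorem otherClassSizes_insertBefore_none (π : Perm D) (x : D) :
    otherClassSizes (cycles (insertBefore π x)) none = otherClassSizes (cycles π) x := by
  have := otherClassSizes_eq_cons (s := cycles (optionCongr π))
    (not_sameCycle_optionCongr π (π⁻¹ x))
  rw [← cycles_insertBefore, otherClassSizes_optionCongr_none, classSize_optionCongr_some,
    classSizes_eq_cons _ (π⁻¹ x), Multiset.cons_inj_right] at this
  rw [← this, otherClassSizes_cycles_inv_apply]

theorem numCycles_insertBefore (π : Perm D) (x : D) :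
    numCycles (insertBefore π x) = numCycles π := by
  rw [numCycles, numCycles, ← card_classSizes, ← card_classSizes, classSizes_eq_cons _ none,
    classSizes_eq_cons _ x, otherClassSizes_insertBefore_none, Multiset.card_cons,
    Multiset.card_cons]

end InsertBefore

section SemiconjOption

variable {e : D ≃ E} {π : Perm D} {π' : Perm E}

theorem exists_optionCongr_eq {e : Option D ≃ Option E} (h : e none = none) :
    ∃ e' : D ≃ E, e = optionCongr e' := by
  refine ⟨removeNone e, Equiv.ext ?_⟩
  rintro (_ | d)
  · exact h
  · have ne_none : e (some d) ≠ none := fun hd => by simpa using e.injective (hd.trans h.symm)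
    exact (removeNone_some e (Option.ne_none_iff_exists'.1 ne_none)).symm

theorem semiconj_optionCongr_iff :
    Function.Semiconj (optionCongr e) (optionCongr π) (optionCongr π') ↔
      Function.Semiconj e π π' := by
  refine ⟨fun h d => by simpa using h (some d), fun h => ?_⟩
  rintro (_ | d)
  · rfl
  · exact congrArg some (h d)

theorem semiconj_insertBefore_iff {x : D} {x' : E} :
    Function.Semiconj (optionCongr e) (insertBefore π x) (insertBefore π' x') ↔
      Function.Semiconj e π π' ∧ e x = x' := by
  classical
  have semiconj_optionCongr :
      Function.Semiconj (optionCongr e) (insertBefore π x) (insertBefore π' (e x)) ↔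
        Function.Semiconj e π π' := by
    rw [← semiconj_optionCongr_iff (π := π)]
    refine forall_congr' fun o => ?_
    rw [insertBefore, insertBefore, mul_apply, mul_apply, (optionCongr e).injective.map_swap]
    exact (swap _ _).apply_eq_iff_eq
  constructor
  · intro h
    have x'_eq : e x = x' := by simpa [insertBefore_none] using h none
    exact ⟨semiconj_optionCongr.1 (x'_eq ▸ h), x'_eq⟩
  · rintro ⟨h, rfl⟩
    exact semiconj_optionCongr.2 h

end SemiconjOption

section PlanarInsertBefore

variable {σ α : Perm D} {x : D}

theorem orbits_insertBefore_le_comap :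
    orbits (insertBefore σ x) (optionCongr α) ≤ (orbits σ α).comap fun d => d.getD x := by
  refine orbits_le_iff.2 ⟨?_, ?_⟩
  · rintro (_ | d)
    · rw [insertBefore_none]
      exact (orbits σ α).refl' x
    · by_cases hd : σ d = x
      · rw [insertBefore_some_of_eq hd]
        exact hd ▸ orbits_rel_left σ α d
      · rw [insertBefore_some_of_ne hd]
        exact orbits_rel_left σ α d
  · rintro (_ | d)
    · exact (orbits σ α).refl' x
    · exact orbits_rel_right σ α d

variable [Finite D]

theorem orbits_le_comap_insertBefore :
    orbits σ α ≤ (orbits (insertBefore σ x) (optionCongr α)).comap some :=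
  sup_le (fun a b hab => (le_sup_left : cycles (insertBefore σ x) ≤ _)
      ((sameCycle_insertBefore_some σ x a b).2 hab))
    (cycles_le_iff.2 fun a => orbits_rel_right (insertBefore σ x) (optionCongr α) (some a))

theorem orbits_insertBefore_eq_top_iff :
    orbits (insertBefore σ x) (optionCongr α) = ⊤ ↔ orbits σ α = ⊤ := by
  refine ⟨fun h => Setoid.eq_top_iff.2 fun a b => ?_, fun h => ?_⟩
  · have rel_some : orbits (insertBefore σ x) (optionCongr α) (some a) (some b) := h ▸ trivial
    exact orbits_insertBefore_le_comap rel_some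
  · have rel_x : ∀ d, orbits (insertBefore σ x) (optionCongr α) d (some x) := by
      rintro (_ | a)
      · exact (le_sup_left : cycles (insertBefore σ x) ≤ _) (sameCycle_insertBefore_none σ x)
      · have rel_ax : orbits σ α a x := h ▸ trivial
        exact orbits_le_comap_insertBefore rel_ax
    exact Setoid.eq_top_iff.2 fun a b => Setoid.trans' _ (rel_x a) (Setoid.symm' _ (rel_x b))

theorem planar_insertBefore_iff :
    Planar (insertBefore σ x) (optionCongr α) ↔ Planar σ α := by
  have euler_iff :
      numCycles (insertBefore σ x) + numCycles (optionCongr α) +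
          numCycles (insertBefore σ x * optionCongr α) = Nat.card (Option D) + 2 ↔
        numCycles σ + numCycles α + numCycles (σ * α) = Nat.card D + 2 := by
    rw [insertBefore_mul_optionCongr, numCycles_insertBefore, numCycles_insertBefore,
      numCycles_optionCongr, Finite.card_option]
    omega
  exact ⟨fun h => ⟨orbits_insertBefore_eq_top_iff.1 h.1, euler_iff.1 h.2⟩,
    fun h => ⟨orbits_insertBefore_eq_top_iff.2 h.1, euler_iff.2 h.2⟩⟩

end PlanarInsertBefore

theorem exists_semiconj_insertBefore (σ α : Perm D) (c : D) (hα : α c = c) (hσ : σ c ≠ c) :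
    ∃ (e : Option {d // d ≠ c} ≃ D) (σ' α' : Perm {d // d ≠ c}) (x : {d // d ≠ c}),
      e none = c ∧ Function.Semiconj e (insertBefore σ' x) σ ∧
        Function.Semiconj e (optionCongr α') α := by
  classical
  let e := optionSubtypeNe c
  have e_none : e none = c := optionSubtypeNe_none c
  let σ₁ : Perm (Option {d // d ≠ c}) := e.symm.permCongr σ
  let α₁ : Perm (Option {d // d ≠ c}) := e.symm.permCongr α
  have e_σ₁ : Function.Semiconj e σ₁ σ := fun d => by simp [σ₁, permCongr_apply]
  have e_α₁ : Function.Semiconj e α₁ α := fun d => by simp [α₁, permCongr_apply]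
  have α₁_none : α₁ none = none := e.injective (by rw [e_α₁ none, e_none, hα])
  obtain ⟨x, hx⟩ : ∃ x, σ₁ none = some x := Option.ne_none_iff_exists'.1 fun h =>
    hσ (by rw [← e_none, ← e_σ₁ none, h])
  have insertBefore_eq : insertBefore (removeNone σ₁) x = σ₁ := by
    rw [insertBefore, map_equiv_removeNone, hx, ← mul_assoc]
    convert one_mul σ₁
    convert swap_mul_self none (some x)
  have optionCongr_eq : optionCongr (removeNone α₁) = α₁ := by
    rw [map_equiv_removeNone, α₁_none, swap_self]
    rfl
  exact ⟨e, removeNone σ₁, removeNone α₁, x, e_none, insertBefore_eq.symm ▸ e_σ₁,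
    optionCongr_eq.symm ▸ e_α₁⟩

/-! #### Inserting a point and cutting the cycle -/

section InsertCut

variable (π : Perm D) (a : D) (k : ℕ)

open Classical in
/-- Insert a point at distance `k + 1` from `a` in the cycle of `a`, and cut the cycle at these
two points. -/
noncomputable def insertCut : Perm (Option D) :=
  insertBefore π ((π ^ (k + 1)) a) * swap (some a) none

variable {π a k}

theorem insertCut_none :
    insertCut π a k none = insertBefore π ((π ^ (k + 1)) a) (some a) := by
  classical
  rw [insertCut, mul_apply, swap_apply_right]

theorem insertCut_some {d : D} (hd : d ≠ a) :
    insertCut π a k (some d) = insertBefore π ((π ^ (k + 1)) a) (some d) := by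
  classical
  rw [insertCut, mul_apply, swap_apply_of_ne_of_ne (by simpa using hd) (by simp)]

theorem insertBefore_pow_apply_self :
    insertBefore π ((π ^ (k + 1)) a) (some ((π ^ k) a)) = none :=
  insertBefore_some_of_eq (by rw [pow_succ', mul_apply])

variable [Finite D]

theorem pow_succ_apply_ne_self (hk : k < classSize (cycles π) a) {i : ℕ} (hi : i < k) :
    (π ^ (i + 1)) a ≠ a := fun h =>
  i.succ_ne_zero (injOn_pow_apply π a (hk.trans_le' hi) (Nat.zero_lt_of_lt hk) h)

theorem insertBefore_pow_apply (hk : k < classSize (cycles π) a) {i : ℕ} (hi : i < k) :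
    insertBefore π ((π ^ (k + 1)) a) (some ((π ^ i) a)) = some ((π ^ (i + 1)) a) := by
  have pow_ne : (π ^ i) a ≠ (π ^ k) a := fun h =>
    hi.ne (injOn_pow_apply π a (hi.trans hk) hk h)
  rw [insertBefore_some_of_ne, pow_succ', mul_apply]
  rw [pow_succ', mul_apply]
  exact π.injective.ne pow_ne

theorem pow_insertCut_none (hk : k < classSize (cycles π) a) {i : ℕ} (hi : i < k) :
    (insertCut π a k ^ (i + 1)) none = some ((π ^ (i + 1)) a) := by
  induction i with
  | zero => simpa [insertCut_none] using insertBefore_pow_apply hk hi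
  | succ i ih =>
    have hi' : i < k := i.lt_succ_self.trans hi
    rw [pow_succ', mul_apply, ih hi', insertCut_some (pow_succ_apply_ne_self hk hi'),
      insertBefore_pow_apply hk hi]

theorem pow_insertCut_none_self (hk : k < classSize (cycles π) a) :
    (insertCut π a k ^ (k + 1)) none = none := by
  rcases k with _ | k
  · simpa [insertCut_none] using insertBefore_pow_apply_self (π := π) (a := a) (k := 0)
  · rw [pow_succ', mul_apply, pow_insertCut_none hk k.lt_succ_self,
      insertCut_some (pow_succ_apply_ne_self hk k.lt_succ_self), insertBefore_pow_apply_self]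

theorem isPeriodicPt_insertCut_none (hk : k < classSize (cycles π) a) :
    Function.IsPeriodicPt (insertCut π a k) (k + 1) none := by
  rw [Function.IsPeriodicPt, Function.IsFixedPt, iterate_eq_pow]
  exact pow_insertCut_none_self hk

theorem classSize_insertCut_none (hk : k < classSize (cycles π) a) :
    classSize (cycles (insertCut π a k)) none = k + 1 := by
  have periodic := isPeriodicPt_insertCut_none hk
  rw [classSize_cycles_eq_minimalPeriod]
  refine le_antisymm (periodic.minimalPeriod_le k.succ_pos) (not_lt.1 fun h => ?_)
  obtain ⟨i, hi⟩ := Nat.exists_eq_add_one.2 (periodic.minimalPeriod_pos k.succ_pos)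
  have iterate_eq := Function.iterate_minimalPeriod (f := insertCut π a k) (x := none)
  rw [hi, iterate_eq_pow, pow_insertCut_none hk (by omega)] at iterate_eq
  exact Option.some_ne_none _ iterate_eq

theorem not_sameCycle_insertCut (hk : k < classSize (cycles π) a) :
    ¬ SameCycle (insertCut π a k) (some a) none := by
  intro h
  obtain ⟨n, -, hn⟩ := h.symm.exists_pow_eq'
  rw [← iterate_eq_pow, ← (isPeriodicPt_insertCut_none hk).iterate_mod_apply,
    iterate_eq_pow] at hn
  have lt_succ : n % (k + 1) < k + 1 := n.mod_lt k.succ_pos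
  rcases hi : n % (k + 1) with _ | i
  · simp [hi] at hn
  · rw [hi] at hn lt_succ
    rw [pow_insertCut_none hk (by omega)] at hn
    exact pow_succ_apply_ne_self hk (by omega) (Option.some.inj hn)

theorem merge_cycles_insertCut (hk : k < classSize (cycles π) a) :
    merge (cycles (insertCut π a k)) (some a) none =
      cycles (insertBefore π ((π ^ (k + 1)) a)) := by
  classical
  rw [← cycles_mul_swap (not_sameCycle_insertCut hk), insertCut, mul_assoc, swap_mul_self, mul_one]

theorem numCycles_insertCut (hk : k < classSize (cycles π) a) :
    numCycles (insertCut π a k) = numCycles π + 1 := by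
  have card_merge := card_quotient_merge (s := cycles (insertCut π a k))
    (not_sameCycle_insertCut hk)
  rw [merge_cycles_insertCut hk] at card_merge
  rw [numCycles, ← card_merge, ← numCycles, numCycles_insertBefore]

theorem sameCycle_insertBefore_pow_apply (n : ℕ) :
    SameCycle (insertBefore π ((π ^ n) a)) (some a) none :=
  ((sameCycle_insertBefore_none _ _).trans
    ((sameCycle_insertBefore_some _ _ _ _).2 (sameCycle_pow_left.2 (SameCycle.refl π a)))).symm

theorem classSize_insertCut_some (hk : k < classSize (cycles π) a) :
    classSize (cycles (insertCut π a k)) (some a) + k = classSize (cycles π) a := by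
  have size_merge := classSize_merge (s := cycles (insertCut π a k)) (not_sameCycle_insertCut hk)
  rw [merge_cycles_insertCut hk, classSize_insertCut_none hk,
    classSize_congr _ (sameCycle_insertBefore_pow_apply (k + 1)), classSize_insertBefore_none,
    classSize_congr (cycles π) (sameCycle_pow_left.2 (SameCycle.refl π a))] at size_merge
  omega

theorem otherClassSizes_insertCut_some (hk : k < classSize (cycles π) a) :
    otherClassSizes (cycles (insertCut π a k)) (some a) =
      (k + 1) ::ₘ otherClassSizes (cycles π) a := by
  rw [otherClassSizes_eq_cons (s := cycles (insertCut π a k)) (not_sameCycle_insertCut hk),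
    merge_cycles_insertCut hk, classSize_insertCut_none hk,
    otherClassSizes_congr (s := cycles (insertBefore π ((π ^ (k + 1)) a)))
      (sameCycle_insertBefore_pow_apply (k + 1)), otherClassSizes_insertBefore_none,
    otherClassSizes_congr (s := cycles π) (sameCycle_pow_left.2 (SameCycle.refl π a))]

end InsertCut

end PermCycles

namespace DartMap

open Equiv Equiv.Perm PermCycles

variable {D E : Type*}

/-- The permutation whose cycles are the faces. -/
abbrev φ (M : DartMap D) : Perm D := M.σ * M.α

theorem natCard_eq [Finite D] (M : DartMap D) : Nat.card D = 2 * numCycles M.α :=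
  natCard_eq_two_mul_numCycles M.α_invol M.α_ne

theorem planar [Finite D] (M : DartMap D) : Planar M.σ M.α where
  orbits_eq := isPretransitive_closure_iff.1 M.connected
  euler := by
    have euler : numCycles M.σ + numCycles (M.σ * M.α) = numCycles M.α + 2 := M.euler
    have := M.natCard_eq
    omega

/-- The rooted map given by two permutations that generate a transitive group of genus zero. -/
@[simps]
def ofPlanar [Finite D] (σ α : Perm D) (root : D) (hα : Function.Involutive α)
    (hne : ∀ d, α d ≠ d) (h : Planar σ α) : DartMap D where
  σ := σ
  α := α
  root := root
  α_invol := hα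
  α_ne := hne
  connected := isPretransitive_closure_iff.2 h.orbits_eq
  euler := by
    change numCycles σ + numCycles (σ * α) = numCycles α + 2
    have := natCard_eq_two_mul_numCycles hα hne
    have := h.euler
    omega

theorem semiconj_φ {M : DartMap D} {N : DartMap E} {e : D ≃ E}
    (hσ : Function.Semiconj e M.σ N.σ) (hα : Function.Semiconj e M.α N.α) :
    Function.Semiconj e M.φ N.φ := hσ.comp_right hα

end DartMap

/-! ### Stubs -/

/-- A planar map in which exactly one dart, the tip, is not paired with another one: it marks the
root corner. Unlike a `DartMap`, a stub may have no edge at all. -/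
structure Stub (D : Type*) where
  σ : Equiv.Perm D
  α : Equiv.Perm D
  tip : D
  α_invol : Function.Involutive α
  α_eq_self_iff : ∀ d, α d = d ↔ d = tip
  planar : PermCycles.Planar σ α

namespace Stub

open Equiv Equiv.Perm PermCycles SetoidClass

variable {D E D' E' : Type*}

/-- The permutation whose cycles are the faces. -/
abbrev φ (X : Stub D) : Perm D := X.σ * X.α

/-- Isomorphism of stubs, as for rooted maps. -/
def Iso (X : Stub D) (Y : Stub E) : Prop :=
  ∃ e : D ≃ E, Function.Semiconj e X.σ Y.σ ∧ Function.Semiconj e X.α Y.α ∧ e X.tip = Y.tip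

theorem Iso.symm {X : Stub D} {Y : Stub E} : X.Iso Y → Y.Iso X := by
  rintro ⟨e, hσ, hα, h_tip⟩
  exact ⟨e.symm, hσ.inverse_left e.left_inv e.right_inv, hα.inverse_left e.left_inv e.right_inv,
    by rw [Equiv.symm_apply_eq, h_tip]⟩

theorem Iso.trans {F : Type*} {X : Stub D} {Y : Stub E} {Z : Stub F} :
    X.Iso Y → Y.Iso Z → X.Iso Z := by
  rintro ⟨e, eσ, eα, e_tip⟩ ⟨f, fσ, fα, f_tip⟩
  exact ⟨e.trans f, eσ.trans fσ, eα.trans fα, by rw [Equiv.trans_apply, e_tip, f_tip]⟩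

theorem semiconj_φ {X : Stub D} {Y : Stub E} {e : D ≃ E} (hσ : Function.Semiconj e X.σ Y.σ)
    (hα : Function.Semiconj e X.α Y.α) : Function.Semiconj e X.φ Y.φ := hσ.comp_right hα

theorem α_tip (X : Stub D) : X.α X.tip = X.tip := (X.α_eq_self_iff _).2 rfl

/-- The degree of the root face, the tip included. -/
noncomputable def tipSize (X : Stub D) : ℕ := classSize (cycles X.φ) X.tip

/-- The degrees of the other faces. -/
noncomputable def innerSizes [Finite D] (X : Stub D) : Multiset ℕ :=
  otherClassSizes (cycles X.φ) X.tip

theorem Iso.natCard_eq {X : Stub D} {Y : Stub E} : X.Iso Y → Nat.card D = Nat.card E :=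
  fun ⟨e, _⟩ => Nat.card_congr e

theorem Iso.tipSize_eq {X : Stub D} {Y : Stub E} : X.Iso Y → X.tipSize = Y.tipSize := by
  rintro ⟨e, hσ, hα, h_tip⟩
  rw [tipSize, classSize_eq_of_conj (semiconj_φ hσ hα), h_tip, tipSize]

theorem Iso.innerSizes_eq [Finite D] [Finite E] {X : Stub D} {Y : Stub E} :
    X.Iso Y → X.innerSizes = Y.innerSizes := by
  rintro ⟨e, hσ, hα, h_tip⟩
  rw [innerSizes, otherClassSizes_eq_of_conj (semiconj_φ hσ hα), h_tip, innerSizes]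

/-! #### Marking the root corner of a map -/

section OfDartMap

/-- The stub of the map reduced to a vertex. -/
def unit : Stub Unit where
  σ := 1
  α := 1
  tip := ()
  α_invol _ := rfl
  α_eq_self_iff _ := by simp
  planar := by
    have card_quotient : ∀ s : Setoid Unit, Nat.card (Quotient s) = 1 := fun s =>
      Nat.card_eq_one_iff_unique.2 ⟨inferInstance, ⟨Quotient.mk _ ()⟩⟩
    refine ⟨Setoid.eq_top_iff.2 fun x _ => Setoid.refl' _ x, ?_⟩
    rw [numCycles, numCycles, card_quotient, card_quotient, Nat.card_unique]

/-- The stub obtained by inserting a tip just before the root of a rooted map. -/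
noncomputable def ofDartMap [Finite D] (M : DartMap D) : Stub (Option D) where
  σ := insertBefore M.σ M.root
  α := optionCongr M.α
  tip := none
  α_invol := by rintro (_ | d) <;> simp [M.α_invol]
  α_eq_self_iff := by rintro (_ | d) <;> simp [M.α_ne]
  planar := planar_insertBefore_iff.2 M.planar

theorem iso_unit_of_σ_tip {X : Stub D} (hσ : X.σ X.tip = X.tip) : unit.Iso X := by
  have orbits_le : orbits X.σ X.α ≤ Setoid.ker fun d => d = X.tip := by
    refine orbits_le_iff.2 ⟨fun d => ?_, fun d => ?_⟩ <;> rw [Setoid.ker_def, eq_iff_iff]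
    · rw [← X.σ.apply_eq_iff_eq, hσ]
    · rw [← X.α.apply_eq_iff_eq, X.α_tip]
  have eq_tip : ∀ d, d = X.tip := fun d => by
    have rel_tip : orbits X.σ X.α d X.tip := X.planar.orbits_eq ▸ trivial
    exact of_eq_true ((orbits_le rel_tip).trans (eq_self X.tip))
  exact ⟨⟨fun _ => X.tip, fun _ => (), fun _ => rfl, fun d => (eq_tip d).symm⟩,
    fun _ => hσ.symm, fun _ => X.α_tip.symm, rfl⟩

variable [Finite D]

theorem iso_ofDartMap_iff [Finite E] {M : DartMap D} {N : DartMap E} :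
    (ofDartMap M).Iso (ofDartMap N) ↔ M.Iso N := by
  constructor
  · rintro ⟨e, hσ, hα, h_tip⟩
    obtain ⟨e, rfl⟩ := exists_optionCongr_eq h_tip
    obtain ⟨hσ, h_root⟩ := semiconj_insertBefore_iff.1 hσ
    exact ⟨e, hσ, semiconj_optionCongr_iff.1 hα, h_root⟩
  · rintro ⟨e, hσ, hα, h_root⟩
    exact ⟨optionCongr e, semiconj_insertBefore_iff.2 ⟨hσ, h_root⟩,
      semiconj_optionCongr_iff.2 hα, rfl⟩

theorem not_iso_unit_ofDartMap (M : DartMap D) : ¬ unit.Iso (ofDartMap M) := by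
  rintro ⟨e, -⟩
  exact Option.some_ne_none M.root (e.symm.injective (Subsingleton.elim _ _))

theorem exists_iso_ofDartMap {X : Stub D} (hσ : X.σ X.tip ≠ X.tip) :
    ∃ M : DartMap {d // d ≠ X.tip}, (ofDartMap M).Iso X := by
  obtain ⟨e, σ, α, x, e_none, eσ, eα⟩ := exists_semiconj_insertBefore X.σ X.α X.tip X.α_tip hσ
  have α_invol : Function.Involutive α := fun d => by
    have : optionCongr α (optionCongr α (some d)) = some d :=
      e.injective (by rw [eα, eα, X.α_invol])
    simpa using this
  have α_ne : ∀ d, α d ≠ d := fun d hd => by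
    have fixed : X.α (e (some d)) = e (some d) := by
      rw [← eα, optionCongr_apply, Option.map_some, hd]
    simpa using e.injective (((X.α_eq_self_iff _).1 fixed).trans e_none.symm)
  have planar : Planar σ α := (planar_insertBefore_iff (x := x)).1
    (X.planar.of_conj (e := e.symm) (eσ.inverse_left e.left_inv e.right_inv)
      (eα.inverse_left e.left_inv e.right_inv))
  exact ⟨DartMap.ofPlanar σ α x α_invol α_ne planar, e, eσ, eα, e_none⟩

end OfDartMap

/-! #### Joining two stubs by an edge -/

section Bridge

variable (X : Stub D) (Y : Stub E)

open Classical in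
/-- The involution of the disjoint union of two stubs in which the two tips are paired. -/
noncomputable def bridgeα : Perm (D ⊕ E) :=
  Perm.sumCongr X.α Y.α * swap (.inl X.tip) (.inr Y.tip)

theorem bridgeα_inl_tip : X.bridgeα Y (.inl X.tip) = .inr Y.tip := by
  simp [bridgeα, Y.α_tip]

open Classical in
theorem cutEdge_bridgeα : cutEdge (X.bridgeα Y) (.inl X.tip) = Perm.sumCongr X.α Y.α := by
  rw [cutEdge, bridgeα_inl_tip, bridgeα, mul_assoc, swap_mul_self, mul_one]

theorem involutive_bridgeα : Function.Involutive (X.bridgeα Y) := by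
  classical
  refine involutive_mul_swap ?_ (by simp [X.α_tip, Y.α_tip])
  rintro (d | d) <;> simp [X.α_invol _, Y.α_invol _]

theorem bridgeα_ne (d : D ⊕ E) : X.bridgeα Y d ≠ d := by
  classical
  refine mul_swap_apply_ne_self (by simp) ?_ d
  rintro (d | d) <;> simp [X.α_eq_self_iff, Y.α_eq_self_iff]

theorem orbits_bridgeα : orbits (Perm.sumCongr X.σ Y.σ) (X.bridgeα Y) = ⊤ := by
  have rel_tips : orbits (Perm.sumCongr X.σ Y.σ) (X.bridgeα Y) (.inl X.tip) (.inr Y.tip) :=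
    bridgeα_inl_tip X Y ▸ orbits_rel_right _ _ _
  classical
  rw [← merge_eq_self rel_tips, bridgeα, merge_orbits_mul_swap, orbits_sumCongr,
    X.planar.orbits_eq, Y.planar.orbits_eq, merge_sum_top]

variable [Finite D] [Finite E]

theorem cycles_bridgeα : cycles (X.bridgeα Y) =
    merge (sum (cycles X.α) (cycles Y.α)) (.inl X.tip) (.inr Y.tip) := by
  classical
  rw [bridgeα, cycles_mul_swap, cycles_sumCongr]
  rw [← cycles_rel, cycles_sumCongr]
  exact sum_inl_inr _ _ _ _

theorem cycles_sumCongr_mul_bridgeα : cycles (Perm.sumCongr X.σ Y.σ * X.bridgeα Y) =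
    merge (sum (cycles X.φ) (cycles Y.φ)) (.inl X.tip) (.inr Y.tip) := by
  classical
  rw [bridgeα, ← mul_assoc, sumCongr_mul, cycles_mul_swap, cycles_sumCongr]
  rw [← cycles_rel, cycles_sumCongr]
  exact sum_inl_inr _ _ _ _

theorem planar_bridgeα : Planar (Perm.sumCongr X.σ Y.σ) (X.bridgeα Y) where
  orbits_eq := X.orbits_bridgeα Y
  euler := by
    have numCycles_α := card_quotient_merge (sum_inl_inr (cycles X.α) (cycles Y.α) X.tip Y.tip)
    have numCycles_φ := card_quotient_merge (sum_inl_inr (cycles X.φ) (cycles Y.φ) X.tip Y.tip)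
    rw [← cycles_bridgeα, card_quotient_sum] at numCycles_α
    rw [← cycles_sumCongr_mul_bridgeα, card_quotient_sum] at numCycles_φ
    have euler_X : numCycles X.σ + numCycles X.α + numCycles X.φ = _ := X.planar.euler
    have euler_Y : numCycles Y.σ + numCycles Y.α + numCycles Y.φ = _ := Y.planar.euler
    rw [numCycles, cycles_sumCongr, card_quotient_sum, Nat.card_sum]
    unfold numCycles at *
    omega

/-- Join the tips of two stubs to an edge. -/
noncomputable def bridge : DartMap (D ⊕ E) :=
  DartMap.ofPlanar (Perm.sumCongr X.σ Y.σ) (X.bridgeα Y) (.inl X.tip)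
    (X.involutive_bridgeα Y) (X.bridgeα_ne Y) (X.planar_bridgeα Y)

theorem cycles_bridge_φ : cycles (X.bridge Y).φ =
    merge (sum (cycles X.φ) (cycles Y.φ)) (.inl X.tip) (.inr Y.tip) :=
  X.cycles_sumCongr_mul_bridgeα Y

theorem classSize_bridge_root :
    classSize (cycles (X.bridge Y).φ) (X.bridge Y).root = X.tipSize + Y.tipSize := by
  rw [cycles_bridge_φ, tipSize, tipSize, ← classSize_sum_inl (cycles X.φ) (cycles Y.φ),
    ← classSize_sum_inr (cycles X.φ) (cycles Y.φ)]
  exact classSize_merge (sum_inl_inr _ _ _ _)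

theorem otherClassSizes_bridge_root :
    otherClassSizes (cycles (X.bridge Y).φ) (X.bridge Y).root = X.innerSizes + Y.innerSizes := by
  have sizes_eq := classSizes_sum (cycles X.φ) (cycles Y.φ)
  rw [classSizes_eq_cons _ (.inl X.tip), otherClassSizes_eq_cons
      (sum_inl_inr (cycles X.φ) (cycles Y.φ) X.tip Y.tip),
    classSizes_eq_cons (cycles X.φ) X.tip, classSizes_eq_cons (cycles Y.φ) Y.tip,
    classSize_sum_inl, classSize_sum_inr, Multiset.cons_add, Multiset.add_cons,
    Multiset.cons_inj_right, Multiset.cons_inj_right, ← cycles_bridge_φ] at sizes_eq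
  exact sizes_eq

theorem sameCycle_bridge_root :
    SameCycle (X.bridge Y).φ (X.bridge Y).root ((X.bridge Y).α (X.bridge Y).root) := by
  rw [← cycles_rel, cycles_bridge_φ]
  exact X.bridgeα_inl_tip Y ▸ merge_rel_self _ _ _

end Bridge

section IsoBridge

variable {X : Stub D} {Y : Stub E} {X' : Stub D'} {Y' : Stub E'}

theorem iso_of_semiconj_sumCongr {e : D ⊕ E ≃ D' ⊕ E'}
    (hσ : Function.Semiconj e (Perm.sumCongr X.σ Y.σ) (Perm.sumCongr X'.σ Y'.σ))
    (hα : Function.Semiconj e (Perm.sumCongr X.α Y.α) (Perm.sumCongr X'.α Y'.α))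
    (hX : e (.inl X.tip) = .inl X'.tip) (hY : e (.inr Y.tip) = .inr Y'.tip) :
    X.Iso X' ∧ Y.Iso Y' := by
  have sum_top_le : sum (⊤ : Setoid D) (⊤ : Setoid E) ≤
      (sum (⊤ : Setoid D') (⊤ : Setoid E')).comap e := by
    have := orbits_le_comap hσ hα
    rwa [orbits_sumCongr, orbits_sumCongr, X.planar.orbits_eq, Y.planar.orbits_eq,
      X'.planar.orbits_eq, Y'.planar.orbits_eq] at this
  have map_inl : ∀ a, ∃ a', e (.inl a) = .inl a' := fun a => by
    have rel_tip := sum_top_le ((sum_inl_inl _ _ a X.tip).2 trivial)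
    rw [Setoid.comap_rel, hX] at rel_tip
    rcases h : e (.inl a) with a' | b'
    · exact ⟨a', rfl⟩
    · exact absurd (h ▸ rel_tip) (sum_inr_inl _ _ _ _)
  have map_inr : ∀ b, ∃ b', e (.inr b) = .inr b' := fun b => by
    have rel_tip := sum_top_le ((sum_inr_inr _ _ b Y.tip).2 trivial)
    rw [Setoid.comap_rel, hY] at rel_tip
    rcases h : e (.inr b) with a' | b'
    · exact absurd (h ▸ rel_tip) (sum_inl_inr _ _ _ _)
    · exact ⟨b', rfl⟩
  obtain ⟨e₁, e₂, rfl⟩ := exists_sumCongr_eq map_inl map_inr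
  exact ⟨⟨e₁, fun d => Sum.inl_injective (hσ (.inl d)), fun d => Sum.inl_injective (hα (.inl d)),
      Sum.inl_injective hX⟩,
    ⟨e₂, fun d => Sum.inr_injective (hσ (.inr d)), fun d => Sum.inr_injective (hα (.inr d)),
      Sum.inr_injective hY⟩⟩

theorem iso_bridge_iff [Finite D] [Finite E] [Finite D'] [Finite E'] :
    (X.bridge Y).Iso (X'.bridge Y') ↔ X.Iso X' ∧ Y.Iso Y' := by
  classical
  constructor
  · rintro ⟨e, hσ, hα, hX⟩
    have hα : Function.Semiconj e (X.bridgeα Y) (X'.bridgeα Y') := hα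
    have hX : e (.inl X.tip) = .inl X'.tip := hX
    have hY : e (.inr Y.tip) = .inr Y'.tip := by
      rw [← bridgeα_inl_tip X, hα, hX, bridgeα_inl_tip]
    have h_cut := semiconj_cutEdge hα (.inl X.tip)
    rw [hX, cutEdge_bridgeα, cutEdge_bridgeα] at h_cut
    exact iso_of_semiconj_sumCongr hσ h_cut hX hY
  · rintro ⟨⟨e, eσ, eα, e_tip⟩, ⟨f, fσ, fα, f_tip⟩⟩
    have hσ : Function.Semiconj (Equiv.sumCongr e f) (Perm.sumCongr X.σ Y.σ)
        (Perm.sumCongr X'.σ Y'.σ) :=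
      Sum.rec (fun d => congrArg Sum.inl (eσ d)) fun d => congrArg Sum.inr (fσ d)
    have hα : Function.Semiconj (Equiv.sumCongr e f) (Perm.sumCongr X.α Y.α)
        (Perm.sumCongr X'.α Y'.α) :=
      Sum.rec (fun d => congrArg Sum.inl (eα d)) fun d => congrArg Sum.inr (fα d)
    have h_bridge := semiconj_mul_swap hα (.inl X.tip) (.inr Y.tip)
    simp only [Equiv.sumCongr_apply, Sum.map_inl, Sum.map_inr, e_tip, f_tip] at h_bridge
    exact ⟨Equiv.sumCongr e f, hσ, h_bridge, congrArg Sum.inl e_tip⟩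

end IsoBridge

/-! #### Adding an edge in the root face -/

section AddEdge

variable (X : Stub D)

open Classical in
/-- The involution of a stub with a new dart, with which the tip is paired. -/
noncomputable def addEdgeα : Perm (Option D) := optionCongr X.α * swap (some X.tip) none

theorem addEdgeα_some_tip : X.addEdgeα (some X.tip) = none := by
  simp [addEdgeα]

open Classical in
theorem cutEdge_addEdgeα : cutEdge X.addEdgeα (some X.tip) = optionCongr X.α := by
  rw [cutEdge, addEdgeα_some_tip, addEdgeα, mul_assoc, swap_mul_self, mul_one]

theorem involutive_addEdgeα : Function.Involutive X.addEdgeα := by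
  classical
  refine involutive_mul_swap ?_ (by simp [X.α_tip])
  rintro (_ | d) <;> simp [X.α_invol _]

theorem addEdgeα_ne (d : Option D) : X.addEdgeα d ≠ d := by
  classical
  refine mul_swap_apply_ne_self (by simp) ?_ d
  rintro (_ | d) <;> simp [X.α_eq_self_iff]

theorem insertBefore_mul_addEdgeα (k : ℕ) :
    insertBefore X.σ ((X.φ ^ (k + 1)) X.tip) * X.addEdgeα = insertCut X.φ X.tip k := by
  rw [addEdgeα, ← mul_assoc, insertBefore_mul_optionCongr, insertCut]

variable [Finite D]

theorem orbits_addEdgeα (x : D) : orbits (insertBefore X.σ x) X.addEdgeα = ⊤ := by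
  have rel_tip : orbits (insertBefore X.σ x) X.addEdgeα (some X.tip) none :=
    X.addEdgeα_some_tip ▸ orbits_rel_right _ _ _
  classical
  rw [← merge_eq_self rel_tip, addEdgeα, merge_orbits_mul_swap,
    orbits_insertBefore_eq_top_iff.2 X.planar.orbits_eq]
  exact top_le_iff.1 (le_merge _ _ _)

theorem numCycles_addEdgeα : numCycles X.addEdgeα = numCycles X.α := by
  have not_sameCycle : ¬ SameCycle (optionCongr X.α) (some X.tip) none := fun h =>
    not_sameCycle_optionCongr X.α X.tip h.symm
  classical
  have := numCycles_mul_swap not_sameCycle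
  rw [numCycles_optionCongr] at this
  exact Nat.succ_injective this

variable {k : ℕ}

theorem planar_addEdgeα (hk : k < X.tipSize) :
    Planar (insertBefore X.σ ((X.φ ^ (k + 1)) X.tip)) X.addEdgeα where
  orbits_eq := X.orbits_addEdgeα _
  euler := by
    rw [insertBefore_mul_addEdgeα, numCycles_insertCut hk, numCycles_insertBefore,
      numCycles_addEdgeα, Finite.card_option, ← add_assoc, X.planar.euler, add_right_comm]

variable (hk : k < X.tipSize)

/-- Join the tip of a stub by an edge to the corner at distance `k + 1` in the root face. -/
noncomputable def addEdge : DartMap (Option D) :=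
  DartMap.ofPlanar (insertBefore X.σ ((X.φ ^ (k + 1)) X.tip)) X.addEdgeα (some X.tip)
    X.involutive_addEdgeα X.addEdgeα_ne (X.planar_addEdgeα hk)

theorem addEdge_φ : (X.addEdge hk).φ = insertCut X.φ X.tip k := X.insertBefore_mul_addEdgeα k

theorem classSize_addEdge_root :
    classSize (cycles (X.addEdge hk).φ) (X.addEdge hk).root + k = X.tipSize := by
  rw [addEdge_φ]
  exact classSize_insertCut_some hk

theorem otherClassSizes_addEdge_root :
    otherClassSizes (cycles (X.addEdge hk).φ) (X.addEdge hk).root = (k + 1) ::ₘ X.innerSizes := by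
  rw [addEdge_φ]
  exact otherClassSizes_insertCut_some hk

theorem classSize_addEdge_none : classSize (cycles (X.addEdge hk).φ) none = k + 1 := by
  rw [addEdge_φ]
  exact classSize_insertCut_none hk

theorem not_sameCycle_addEdge_root :
    ¬ SameCycle (X.addEdge hk).φ (X.addEdge hk).root ((X.addEdge hk).α (X.addEdge hk).root) := by
  rw [addEdge_φ, addEdge, DartMap.ofPlanar_α, DartMap.ofPlanar_root, addEdgeα_some_tip]
  exact not_sameCycle_insertCut hk

end AddEdge

section IsoAddEdge

variable [Finite D] [Finite E] {X : Stub D} {Y : Stub E} {k l : ℕ} {hk : k < X.tipSize}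
  {hl : l < Y.tipSize}

theorem iso_addEdge_iff : (X.addEdge hk).Iso (Y.addEdge hl) ↔ X.Iso Y ∧ k = l := by
  classical
  constructor
  · rintro ⟨e, hσ, hα, h_tip⟩
    have eα : Function.Semiconj e X.addEdgeα Y.addEdgeα := hα
    have e_tip : e (some X.tip) = some Y.tip := h_tip
    have e_none : e none = none := by
      rw [← addEdgeα_some_tip X, eα, e_tip, addEdgeα_some_tip]
    have size_eq := classSize_eq_of_conj (DartMap.semiconj_φ hσ hα) none
    rw [e_none, classSize_addEdge_none, classSize_addEdge_none] at size_eq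
    have h_cut := semiconj_cutEdge eα (some X.tip)
    rw [e_tip, cutEdge_addEdgeα, cutEdge_addEdgeα] at h_cut
    obtain ⟨e, rfl⟩ := exists_optionCongr_eq e_none
    exact ⟨⟨e, (semiconj_insertBefore_iff.1 hσ).1, semiconj_optionCongr_iff.1 h_cut,
      Option.some_injective _ e_tip⟩, Nat.succ_injective size_eq⟩
  · rintro ⟨⟨e, hσ, hα, h_tip⟩, rfl⟩
    have e_pow : e ((X.φ ^ (k + 1)) X.tip) = (Y.φ ^ (k + 1)) Y.tip := by
      rw [semiconj_pow_apply (semiconj_φ hσ hα), h_tip]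
    have h_addEdge := semiconj_mul_swap (semiconj_optionCongr_iff.2 hα) (some X.tip) none
    simp only [optionCongr_apply, Option.map_some, Option.map_none, h_tip] at h_addEdge
    exact ⟨optionCongr e, semiconj_insertBefore_iff.2 ⟨hσ, e_pow⟩, h_addEdge,
      congrArg some h_tip⟩

theorem not_iso_bridge_addEdge [Finite D'] (Z : Stub D') :
    ¬ (Z.bridge Y).Iso (X.addEdge hk) := by
  rintro ⟨e, hσ, hα, h_root⟩
  have sameCycle := sameCycle_bridge_root Z Y
  rw [sameCycle_iff_of_conj (DartMap.semiconj_φ hσ hα), hα, h_root] at sameCycle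
  exact not_sameCycle_addEdge_root X hk sameCycle

end IsoAddEdge

end Stub

/-! ### Deleting the root edge -/

namespace DartMap

open Equiv Equiv.Perm PermCycles SetoidClass Stub

variable {D : Type*}

section Connected

variable {E : Type*} [Finite D] [DecidableEq D]

theorem sameCycle_mul_cutEdge (M : DartMap D) (h : orbits M.σ (cutEdge M.α M.root) = ⊤) :
    SameCycle (M.σ * cutEdge M.α M.root) M.root (M.α M.root) := by
  rw [cutEdge, ← mul_assoc]
  exact sameCycle_mul_swap
    (M.planar.not_sameCycle_of_orbits_cutEdge_eq_top M.α_invol (M.α_ne M.root) h)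

theorem exists_addEdge_iso_of_semiconj [Finite E] (M : DartMap D)
    (h : orbits M.σ (cutEdge M.α M.root) = ⊤) {e : Option E ≃ D} {σ α : Perm E} {x y : E}
    (hσ : Function.Semiconj e (insertBefore σ x) M.σ)
    (hα : Function.Semiconj e (optionCongr α) (cutEdge M.α M.root))
    (h_root : e (some y) = M.root) (h_other : e none = M.α M.root) :
    ∃ (X : Stub E) (k : ℕ) (hk : k < X.tipSize), (X.addEdge hk).Iso M := by
  classical
  have involutive : Function.Involutive (optionCongr α) :=
    involutive_of_conj hα (involutive_cutEdge M.α_invol M.root)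
  have apply_eq_self_iff : ∀ d, optionCongr α d = d ↔ d = some y ∨ d = none := by
    intro d
    rw [apply_eq_self_iff_of_conj hα, cutEdge_apply_eq_self_iff M.α_invol,
      or_iff_right (M.α_ne _), ← h_other, ← h_root, e.apply_eq_iff_eq, e.apply_eq_iff_eq]
  have planar : Planar σ α := planar_insertBefore_iff.1
    ((M.planar.cutEdge M.α_invol (M.α_ne _) h).of_conj
      (hσ.inverse_left e.left_inv e.right_inv : Function.Semiconj e.symm _ _)
      (hα.inverse_left e.left_inv e.right_inv : Function.Semiconj e.symm _ _))
  have sameCycle : SameCycle (σ * α) y x := by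
    have hφ : Function.Semiconj e (insertBefore (σ * α) x)
        (M.σ * cutEdge M.α M.root : Perm D) := by
      rw [← insertBefore_mul_optionCongr]
      exact hσ.comp_right hα
    rw [← sameCycle_insertBefore_some (σ * α) x]
    refine SameCycle.trans ?_ (sameCycle_insertBefore_none (σ * α) x)
    rw [sameCycle_iff_of_conj hφ, h_root, h_other]
    exact M.sameCycle_mul_cutEdge h
  obtain ⟨k, hk, rfl⟩ := exists_pow_succ_apply_eq sameCycle
  have h_addEdge := semiconj_mul_swap hα (some y) none
  rw [h_root, h_other, cutEdge_mul_swap] at h_addEdge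
  exact ⟨⟨σ, α, y, fun d => by simpa using involutive (some d),
    fun d => by simpa using apply_eq_self_iff (some d), planar⟩, k, hk, e, hσ, h_addEdge, h_root⟩

theorem exists_addEdge_iso (M : DartMap D) (h : orbits M.σ (cutEdge M.α M.root) = ⊤) :
    ∃ (X : Stub {d // d ≠ M.α M.root}) (k : ℕ) (hk : k < X.tipSize), (X.addEdge hk).Iso M := by
  have cutEdge_other : cutEdge M.α M.root (M.α M.root) = M.α M.root :=
    (cutEdge_apply_eq_self_iff M.α_invol).2 (Or.inr (Or.inr rfl))
  have σ_other_ne : M.σ (M.α M.root) ≠ M.α M.root := by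
    intro hσ
    refine M.α_ne M.root ((M.sameCycle_mul_cutEdge h).symm.eq_of_left ?_)
    rw [Function.IsFixedPt, mul_apply, cutEdge_other, hσ]
  obtain ⟨e, σ, α, x, e_none, hσ, hα⟩ :=
    exists_semiconj_insertBefore M.σ _ (M.α M.root) cutEdge_other σ_other_ne
  obtain ⟨y, hy⟩ : ∃ y, e.symm M.root = some y := by
    rw [← Option.ne_none_iff_exists', Ne, Equiv.symm_apply_eq, e_none]
    exact (M.α_ne M.root).symm
  exact M.exists_addEdge_iso_of_semiconj h hσ hα ((Equiv.symm_apply_eq e).1 hy).symm e_none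

end Connected

section Disconnected

variable {E F : Type*} [DecidableEq D]

theorem planar_and_planar_of_semiconj_cutEdge [Finite D] [Finite E] [Finite F] (M : DartMap D)
    {e : E ⊕ F ≃ D} {σ₁ α₁ : Perm E} {σ₂ α₂ : Perm F} {x : E} {y : F}
    (hσ : Function.Semiconj e (Perm.sumCongr σ₁ σ₂) M.σ)
    (hα : Function.Semiconj e (Perm.sumCongr α₁ α₂) (cutEdge M.α M.root))
    (h_not : ¬ orbits M.σ (cutEdge M.α M.root) M.root (M.α M.root))
    (rel_inl : ∀ a, orbits M.σ (cutEdge M.α M.root) (e (.inl a)) (e (.inl x)))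
    (rel_inr : ∀ b, orbits M.σ (cutEdge M.α M.root) (e (.inr b)) (e (.inr y))) :
    Planar σ₁ α₁ ∧ Planar σ₂ α₂ := by
  have : Nonempty E := ⟨x⟩
  have : Nonempty F := ⟨y⟩
  have involutive : Function.Involutive (Perm.sumCongr α₁ α₂) :=
    involutive_of_conj hα (involutive_cutEdge M.α_invol M.root)
  have rel_iff : ∀ a b, sum (orbits σ₁ α₁) (orbits σ₂ α₂) a b ↔
      orbits M.σ (cutEdge M.α M.root) (e a) (e b) := fun a b => by
    rw [← orbits_sumCongr, orbits_rel_iff_of_conj hσ hα]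
  refine planar_and_planar_of_euler_sumCongr
    (fun d => Sum.inl_injective (involutive (.inl d)))
    (fun d => Sum.inr_injective (involutive (.inr d)))
    (Setoid.eq_top_iff.2 fun a b => ?_) (Setoid.eq_top_iff.2 fun a b => ?_) ?_
  · exact (sum_inl_inl _ (orbits σ₂ α₂) a b).1 ((rel_iff _ _).2
      (Setoid.trans' _ (rel_inl a) (Setoid.symm' _ (rel_inl b))))
  · exact (sum_inr_inr (orbits σ₁ α₁) _ a b).1 ((rel_iff _ _).2
      (Setoid.trans' _ (rel_inr a) (Setoid.symm' _ (rel_inr b))))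
  · have hφ : Function.Semiconj e (Perm.sumCongr σ₁ σ₂ * Perm.sumCongr α₁ α₂ : Perm (E ⊕ F))
      (M.σ * cutEdge M.α M.root : Perm D) := hσ.comp_right hα
    rw [numCycles_eq_of_conj hσ, numCycles_eq_of_conj hα, numCycles_eq_of_conj hφ,
      Nat.card_congr e, numCycles_cutEdge M.α_invol (M.α_ne _), numCycles_mul_cutEdge h_not]
    have := M.planar.euler
    omega

theorem exists_bridge_iso_of_semiconj [Finite E] [Finite F] (M : DartMap D)
    {e : E ⊕ F ≃ D} {σ₁ α₁ : Perm E} {σ₂ α₂ : Perm F} {x : E} {y : F}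
    (hσ : Function.Semiconj e (Perm.sumCongr σ₁ σ₂) M.σ)
    (hα : Function.Semiconj e (Perm.sumCongr α₁ α₂) (cutEdge M.α M.root))
    (h_root : e (.inl x) = M.root) (h_other : e (.inr y) = M.α M.root)
    (planar₁ : Planar σ₁ α₁) (planar₂ : Planar σ₂ α₂) :
    ∃ (X : Stub E) (Y : Stub F), (X.bridge Y).Iso M := by
  classical
  have involutive : Function.Involutive (Perm.sumCongr α₁ α₂) :=
    involutive_of_conj hα (involutive_cutEdge M.α_invol M.root)
  have apply_eq_self_iff : ∀ d, Perm.sumCongr α₁ α₂ d = d ↔ d = .inl x ∨ d = .inr y := by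
    intro d
    rw [apply_eq_self_iff_of_conj hα, cutEdge_apply_eq_self_iff M.α_invol,
      or_iff_right (M.α_ne _), ← h_other, ← h_root, e.apply_eq_iff_eq, e.apply_eq_iff_eq]
  have h_bridge := semiconj_mul_swap hα (.inl x) (.inr y)
  rw [h_root, h_other, cutEdge_mul_swap] at h_bridge
  exact ⟨⟨σ₁, α₁, x, fun d => Sum.inl_injective (involutive (.inl d)),
      fun d => by simpa using apply_eq_self_iff (.inl d), planar₁⟩,
    ⟨σ₂, α₂, y, fun d => Sum.inr_injective (involutive (.inr d)),
      fun d => by simpa using apply_eq_self_iff (.inr d), planar₂⟩, e, hσ, h_bridge, h_root⟩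

theorem exists_bridge_iso [Finite D] (M : DartMap D) (h : orbits M.σ (cutEdge M.α M.root) ≠ ⊤) :
    ∃ (p : D → Prop) (X : Stub {d // p d}) (Y : Stub {d // ¬ p d}), (X.bridge Y).Iso M := by
  classical
  set s := orbits M.σ (cutEdge M.α M.root) with s_eq
  have merge_eq_top : merge s M.root (M.α M.root) = ⊤ := by
    rw [s_eq, merge_orbits_cutEdge, M.planar.orbits_eq]
  have not_rel : ¬ s M.root (M.α M.root) := fun k => h (by rw [← merge_eq_top, merge_eq_self k])
  have apply_iff : ∀ {π : Perm D}, (∀ d, s d (π d)) → ∀ d, s (π d) M.root ↔ s d M.root :=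
    fun hπ d => ⟨fun k => s.trans' (hπ d) k, fun k => s.trans' (s.symm' (hπ d)) k⟩
  refine ⟨fun d => s d M.root, ?_⟩
  obtain ⟨σ₁, σ₂, hσ⟩ := exists_semiconj_sumCongr (e := Equiv.sumCompl fun d => s d M.root) _
    (fun _ => rfl) (fun _ => rfl) (apply_iff (orbits_rel_left _ _))
  obtain ⟨α₁, α₂, hα⟩ := exists_semiconj_sumCongr (e := Equiv.sumCompl fun d => s d M.root) _
    (fun _ => rfl) (fun _ => rfl) (apply_iff (orbits_rel_right _ _))
  let x : {d // s d M.root} := ⟨M.root, s.refl' _⟩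
  let y : {d // ¬ s d M.root} := ⟨M.α M.root, fun k => not_rel (s.symm' k)⟩
  obtain ⟨planar₁, planar₂⟩ := M.planar_and_planar_of_semiconj_cutEdge (x := x) (y := y) hσ hα
    not_rel (fun a => a.2) fun b => rel_right_of_merge_eq_top merge_eq_top b.2
  exact M.exists_bridge_iso_of_semiconj (x := x) (y := y) hσ hα rfl rfl planar₁ planar₂

end Disconnected

end DartMap

/-! ### Decomposition of rooted maps at the root edge -/

namespace DartMap

open Equiv Equiv.Perm PermCycles SetoidClass

variable {D E : Type*}

theorem outerDegree_eq_classSize (M : DartMap D) :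
    M.outerDegree = classSize (cycles M.φ) M.root :=
  natCard_fiber_mk _ _

variable [Finite D]

instance (M : DartMap D) : Finite M.Face := inferInstanceAs (Finite (Quotient _))

theorem faceCount_eq_count (M : DartMap D) (i : ℕ) :
    M.faceCount i = (classSizes (cycles M.φ)).count i := by
  have faceDegree_eq : ∀ f : M.Face, M.faceDegree f = quotientSize (cycles M.φ) f :=
    natCard_fiber_mk _
  simp only [faceCount, faceDegree_eq, count_classSizes]
  rfl

theorem faceCount_eq_add (M : DartMap D) (i : ℕ) :
    M.faceCount i = M.finiteFaceCount i + if i = M.outerDegree then 1 else 0 := by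
  classical
  let _ := Fintype.ofFinite M.Face
  have finite_eq_erase : (Finset.univ.filter fun f => f ≠ M.rootFace ∧ M.faceDegree f = i) =
      (Finset.univ.filter fun f => M.faceDegree f = i).erase M.rootFace := by
    ext f
    simp
  rw [faceCount, finiteFaceCount, Nat.card_eq_fintype_card, Nat.card_eq_fintype_card,
    Fintype.card_subtype, Fintype.card_subtype, finite_eq_erase]
  split_ifs with h
  · rw [Finset.card_erase_add_one]
    simp [h, outerDegree]
  · rw [Finset.erase_eq_of_notMem, add_zero]
    simpa [outerDegree] using fun k => h k.symm

theorem finiteFaceCount_eq_count (M : DartMap D) (i : ℕ) :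
    M.finiteFaceCount i = (otherClassSizes (cycles M.φ) M.root).count i := by
  have := M.faceCount_eq_add i
  rw [faceCount_eq_count, classSizes_eq_cons _ M.root, Multiset.count_cons,
    ← outerDegree_eq_classSize] at this
  exact (Nat.add_right_cancel this).symm

theorem exists_iso_of_equiv [Finite E] (M : DartMap D) (e : D ≃ E) : ∃ N : DartMap E, M.Iso N := by
  have semiconj : ∀ π : Perm D, Function.Semiconj e π (e.permCongr π) := fun π d => by
    simp [permCongr_apply]
  refine ⟨ofPlanar (e.permCongr M.σ) (e.permCongr M.α) (e M.root) (fun d => ?_) (fun d => ?_)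
    (M.planar.of_conj (semiconj _) (semiconj _)), e, semiconj _, semiconj _, rfl⟩
  · simp [permCongr_apply, M.α_invol]
  · simp [permCongr_apply, ← Equiv.eq_symm_apply, M.α_ne]

end DartMap

namespace Stub

open PermCycles SetoidClass

variable {D : Type*} [Finite D] (M : DartMap D)

theorem ofDartMap_φ : (ofDartMap M).φ = insertBefore M.φ M.root :=
  insertBefore_mul_optionCongr _ _ _

theorem tipSize_ofDartMap : (ofDartMap M).tipSize = classSize (cycles M.φ) M.root + 1 := by
  rw [tipSize, ofDartMap_φ]
  exact classSize_insertBefore_none _ _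

theorem innerSizes_ofDartMap :
    (ofDartMap M).innerSizes = otherClassSizes (cycles M.φ) M.root := by
  rw [innerSizes, ofDartMap_φ]
  exact otherClassSizes_insertBefore_none _ _

theorem tipSize_unit : unit.tipSize = 1 := by
  rw [tipSize, classSize_cycles_eq_minimalPeriod]
  exact Function.minimalPeriod_eq_one_iff_isFixedPt.2 rfl

theorem innerSizes_unit : unit.innerSizes = 0 := by
  have card_eq : (classSizes (cycles unit.φ)).card = 1 := by
    rw [card_classSizes]
    exact Nat.card_eq_one_iff_unique.2 ⟨inferInstance, ⟨Quotient.mk _ ()⟩⟩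
  rw [classSizes_eq_cons _ unit.tip, Multiset.card_cons] at card_eq
  exact Multiset.card_eq_zero.1 (Nat.succ_injective card_eq)

end Stub

namespace RootedPlanarMap

open PermCycles SetoidClass

/-- The darts of a representative of a rooted map, the tip included. -/
def Darts : RootedPlanarMap → Type
  | vertex => Unit
  | ofEdges n _ => Option (Fin (2 * n))

instance : ∀ M : RootedPlanarMap, Finite M.Darts
  | vertex => inferInstanceAs (Finite Unit)
  | ofEdges n _ => inferInstanceAs (Finite (Option (Fin (2 * n))))

/-- A representative of a rooted map, with its root corner marked by a tip. -/
noncomputable def stub : (M : RootedPlanarMap) → Stub M.Darts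
  | vertex => Stub.unit
  | ofEdges _ M => Stub.ofDartMap M.out

theorem natCard_darts : ∀ M : RootedPlanarMap, Nat.card M.Darts = 2 * M.edges + 1
  | vertex => by simp [Darts, edges]
  | ofEdges n M => by simp [Darts, edges]

theorem eq_of_iso_stub : ∀ {M N : RootedPlanarMap}, M.stub.Iso N.stub → M = N
  | vertex, vertex, _ => rfl
  | vertex, ofEdges _ _, h => absurd h (Stub.not_iso_unit_ofDartMap _)
  | ofEdges _ _, vertex, h => absurd h.symm (Stub.not_iso_unit_ofDartMap _)
  | ofEdges n M, ofEdges n' M', h => by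
    obtain rfl : n = n' := by
      have card_eq := h.natCard_eq
      simp only [natCard_darts, edges] at card_eq
      omega
    have iso_out : M.out.Iso M'.out := Stub.iso_ofDartMap_iff.1 h
    rw [← Quotient.out_eq M, ← Quotient.out_eq M']
    exact congrArg _ (Quotient.sound iso_out)

section OfStub

variable {D E : Type*} [Finite D] [Finite E]

theorem exists_stub_iso_ofDartMap (M : DartMap D) :
    ∃ N : RootedPlanarMap, N.stub.Iso (Stub.ofDartMap M) := by
  obtain ⟨N, h⟩ := M.exists_iso_of_equiv (Finite.equivFinOfCardEq M.natCard_eq)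
  refine ⟨ofEdges _ (Quotient.mk _ N), Stub.iso_ofDartMap_iff.2 (DartMap.Iso.trans ?_ h.symm)⟩
  exact Quotient.mk_out (s := DartMap.isoSetoid _) N

theorem exists_stub_iso (X : Stub D) : ∃ M : RootedPlanarMap, M.stub.Iso X := by
  by_cases hσ : X.σ X.tip = X.tip
  · exact ⟨vertex, Stub.iso_unit_of_σ_tip hσ⟩
  · obtain ⟨M, hM⟩ := Stub.exists_iso_ofDartMap hσ
    obtain ⟨N, hN⟩ := exists_stub_iso_ofDartMap M
    exact ⟨N, hN.trans hM⟩

/-- The rooted map of a stub. -/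
noncomputable def ofStub (X : Stub D) : RootedPlanarMap := (exists_stub_iso X).choose

theorem stub_ofStub (X : Stub D) : (ofStub X).stub.Iso X := (exists_stub_iso X).choose_spec

theorem ofStub_eq_iff {X : Stub D} {Y : Stub E} : ofStub X = ofStub Y ↔ X.Iso Y := by
  refine ⟨fun h => (stub_ofStub X).symm.trans ?_, fun h =>
    eq_of_iso_stub ((stub_ofStub X).trans (h.trans (stub_ofStub Y).symm))⟩
  rw [h]
  exact stub_ofStub Y

theorem edges_ofStub (X : Stub D) : 2 * (ofStub X).edges + 1 = Nat.card D := by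
  rw [← natCard_darts, (stub_ofStub X).natCard_eq]

end OfStub

/-- The degrees of the finite faces. -/
noncomputable def innerDegrees (M : RootedPlanarMap) : Multiset ℕ := M.stub.innerSizes

theorem tipSize_stub : ∀ M : RootedPlanarMap, M.stub.tipSize = M.outerDegree + 1
  | vertex => Stub.tipSize_unit
  | ofEdges n M => by
    refine (Stub.tipSize_ofDartMap _).trans ?_
    rw [← DartMap.outerDegree_eq_classSize]
    conv_rhs => rw [← Quotient.out_eq M]
    rfl

theorem count_innerDegrees (i : ℕ) :
    ∀ M : RootedPlanarMap, M.innerDegrees.count i = M.finiteFaceCount i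
  | vertex => by
    change Stub.unit.innerSizes.count i = 0
    rw [Stub.innerSizes_unit, Multiset.count_zero]
  | ofEdges n M => by
    refine (congrArg _ (Stub.innerSizes_ofDartMap _)).trans ?_
    rw [← DartMap.finiteFaceCount_eq_count]
    conv_rhs => rw [← Quotient.out_eq M]
    rfl

theorem faceCount_eq_add (i : ℕ) : ∀ M : RootedPlanarMap,
    M.faceCount i = M.finiteFaceCount i + if i = M.outerDegree then 1 else 0
  | vertex => by
    simp only [faceCount, finiteFaceCount, outerDegree, zero_add]
    congr
  | ofEdges n M => by
    rw [← Quotient.out_eq M]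
    exact DartMap.faceCount_eq_add _ _

theorem pos_of_mem_innerDegrees (M : RootedPlanarMap) {i : ℕ} (h : i ∈ M.innerDegrees) : 0 < i :=
  pos_of_mem_classSizes (cycles M.stub.φ)
    (classSizes_eq_cons _ M.stub.tip ▸ Multiset.mem_cons_of_mem h)

theorem outerDegree_eq_zero_iff : ∀ M : RootedPlanarMap, M.outerDegree = 0 ↔ M = vertex
  | vertex => by simp [outerDegree]
  | ofEdges n M => by
    simp only [reduceCtorEq, iff_false]
    rw [← Quotient.out_eq M]
    change DartMap.outerDegree _ ≠ 0
    rw [DartMap.outerDegree_eq_classSize]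
    exact (classSize_pos _ _).ne'

theorem outerDegree_ofStub_ofDartMap {D : Type*} [Finite D] (M : DartMap D) :
    (ofStub (Stub.ofDartMap M)).outerDegree = classSize (cycles M.φ) M.root := by
  rw [← Nat.succ_inj, ← Nat.add_one, ← tipSize_stub, (stub_ofStub _).tipSize_eq,
    Stub.tipSize_ofDartMap]

theorem innerDegrees_ofStub_ofDartMap {D : Type*} [Finite D] (M : DartMap D) :
    (ofStub (Stub.ofDartMap M)).innerDegrees = otherClassSizes (cycles M.φ) M.root := by
  rw [innerDegrees, (stub_ofStub _).innerSizes_eq, Stub.innerSizes_ofDartMap]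

theorem ofStub_ofDartMap_ne_vertex {D : Type*} [Finite D] (M : DartMap D) :
    ofStub (Stub.ofDartMap M) ≠ vertex := fun h =>
  Stub.not_iso_unit_ofDartMap M (h ▸ stub_ofStub (Stub.ofDartMap M) :)

section Bridge

/-- Join two maps by a root edge that is a bridge. -/
noncomputable def bridge (M N : RootedPlanarMap) : RootedPlanarMap :=
  ofStub (Stub.ofDartMap (M.stub.bridge N.stub))

variable (M N : RootedPlanarMap)

theorem edges_bridge : (M.bridge N).edges = M.edges + N.edges + 1 := by
  have := edges_ofStub (Stub.ofDartMap (M.stub.bridge N.stub))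
  rw [Finite.card_option, Nat.card_sum, natCard_darts, natCard_darts, ← bridge] at this
  omega

theorem outerDegree_bridge : (M.bridge N).outerDegree = M.outerDegree + N.outerDegree + 2 := by
  rw [bridge, outerDegree_ofStub_ofDartMap, Stub.classSize_bridge_root, tipSize_stub, tipSize_stub]
  omega

theorem innerDegrees_bridge :
    (M.bridge N).innerDegrees = M.innerDegrees + N.innerDegrees := by
  rw [bridge, innerDegrees_ofStub_ofDartMap, Stub.otherClassSizes_bridge_root]
  rfl

end Bridge

section AddEdge

theorem lt_tipSize_stub (M : RootedPlanarMap) (k : Fin (M.outerDegree + 1)) :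
    (k : ℕ) < M.stub.tipSize := by
  rw [tipSize_stub]
  exact k.2

/-- Add a root edge that cuts a finite face of degree `k + 1` off the infinite face. -/
noncomputable def addEdge (M : RootedPlanarMap) (k : Fin (M.outerDegree + 1)) : RootedPlanarMap :=
  ofStub (Stub.ofDartMap (M.stub.addEdge (M.lt_tipSize_stub k)))

variable (M : RootedPlanarMap) (k : Fin (M.outerDegree + 1))

theorem edges_addEdge : (M.addEdge k).edges = M.edges + 1 := by
  have := edges_ofStub (Stub.ofDartMap (M.stub.addEdge (M.lt_tipSize_stub k)))
  rw [Finite.card_option, Finite.card_option, natCard_darts, ← addEdge] at this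
  omega

theorem outerDegree_addEdge : (M.addEdge k).outerDegree + k = M.outerDegree + 1 := by
  rw [addEdge, outerDegree_ofStub_ofDartMap, Stub.classSize_addEdge_root, tipSize_stub]

theorem innerDegrees_addEdge : (M.addEdge k).innerDegrees = (k + 1 : ℕ) ::ₘ M.innerDegrees := by
  rw [addEdge, innerDegrees_ofStub_ofDartMap, Stub.otherClassSizes_addEdge_root]
  rfl

end AddEdge

/-- A rooted map is a vertex, or its root edge is a bridge between two maps, or its root edge
separates a finite face from the infinite face. -/
noncomputable def compose : Option ((RootedPlanarMap × RootedPlanarMap) ⊕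
    (Σ M : RootedPlanarMap, Fin (M.outerDegree + 1))) → RootedPlanarMap
  | none => vertex
  | some (.inl p) => p.1.bridge p.2
  | some (.inr p) => p.1.addEdge p.2

theorem compose_injective : Function.Injective compose := by
  rintro (_ | ⟨M, N⟩ | ⟨M, k⟩) (_ | ⟨M', N'⟩ | ⟨M', k'⟩) h
  · rfl
  · exact absurd h.symm (ofStub_ofDartMap_ne_vertex _)
  · exact absurd h.symm (ofStub_ofDartMap_ne_vertex _)
  · exact absurd h (ofStub_ofDartMap_ne_vertex _)
  · obtain ⟨hM, hN⟩ := Stub.iso_bridge_iff.1 (Stub.iso_ofDartMap_iff.1 (ofStub_eq_iff.1 h))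
    obtain rfl : M = M' := eq_of_iso_stub hM
    obtain rfl : N = N' := eq_of_iso_stub hN
    rfl
  · exact absurd (Stub.iso_ofDartMap_iff.1 (ofStub_eq_iff.1 h)) (Stub.not_iso_bridge_addEdge _)
  · exact absurd h (ofStub_ofDartMap_ne_vertex _)
  · exact absurd (Stub.iso_ofDartMap_iff.1 (ofStub_eq_iff.1 h)).symm
      (Stub.not_iso_bridge_addEdge _)
  · obtain ⟨hM, hk⟩ := Stub.iso_addEdge_iff.1 (Stub.iso_ofDartMap_iff.1 (ofStub_eq_iff.1 h))
    obtain rfl : M = M' := eq_of_iso_stub hM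
    obtain rfl : k = k' := Fin.ext hk
    rfl

theorem compose_surjective : Function.Surjective compose := by
  rintro (_ | ⟨n, M⟩)
  · exact ⟨none, rfl⟩
  have ofStub_eq : ∀ {D : Type} [Finite D] {P : DartMap D}, P.Iso M.out →
      ofStub (Stub.ofDartMap P) = ofEdges n M := fun hP =>
    eq_of_iso_stub ((stub_ofStub _).trans (Stub.iso_ofDartMap_iff.2 hP))
  by_cases h : orbits M.out.σ (cutEdge M.out.α M.out.root) = ⊤
  · obtain ⟨X, k, hk, hX⟩ := M.out.exists_addEdge_iso h
    have outerDegree_eq : (ofStub X).outerDegree + 1 = X.tipSize := by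
      rw [← tipSize_stub, (stub_ofStub X).tipSize_eq]
    exact ⟨some (.inr ⟨ofStub X, k, outerDegree_eq ▸ hk⟩), ofStub_eq
      (DartMap.Iso.trans (Stub.iso_addEdge_iff.2 ⟨stub_ofStub X, rfl⟩) hX)⟩
  · obtain ⟨p, X, Y, hXY⟩ := M.out.exists_bridge_iso h
    exact ⟨some (.inl (ofStub X, ofStub Y)), ofStub_eq
      (DartMap.Iso.trans (Stub.iso_bridge_iff.2 ⟨stub_ofStub X, stub_ofStub Y⟩) hXY)⟩

theorem compose_bijective : Function.Bijective compose :=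
  ⟨compose_injective, compose_surjective⟩

end RootedPlanarMap

/-! ### Generating functions -/

section Series

open MvPowerSeries

/-- The inclusion of the variables `t, z₁, …, z_m` into `t, u, z₁, …, z_m`. -/
def GVar.emb (m : ℕ) : GVar m ↪ FVar m where
  toFun
    | .t => .t
    | .z i => .z i
  inj' := by rintro (_ | i) (_ | j) h <;> simp_all

theorem FVar.mem_range_emb_iff {m : ℕ} (v : FVar m) : v ∈ Set.range (GVar.emb m) ↔ v ≠ .u := by
  constructor
  · rintro ⟨_ | i, rfl⟩ <;> simp [GVar.emb]
  · rcases v with _ | _ | i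
    · exact fun _ => ⟨.t, rfl⟩
    · exact fun h => absurd rfl h
    · exact fun _ => ⟨.z i, rfl⟩

namespace MapSeries

section Adic

variable {σ R : Type*} [CommRing R] {s : σ}

theorem X_ne_zero [Nontrivial R] (s : σ) : (X s : MvPowerSeries σ R) ≠ 0 := fun h => by
  simpa [h] using coeff_index_single_self_X (R := R) s

theorem eq_of_forall_X_pow_dvd_sub {f g : MvPowerSeries σ R} (h : ∀ n, X s ^ n ∣ f - g) :
    f = g := by
  ext e
  have coeff_sub := X_pow_dvd_iff.1 (h (e s + 1)) e (Nat.lt_succ_self _)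
  rwa [map_sub, sub_eq_zero] at coeff_sub

theorem dvd_sub_trans {A : Type*} [CommRing A] {d a b c : A} (hab : d ∣ a - b) (hbc : d ∣ b - c) :
    d ∣ a - c :=
  sub_add_sub_cancel a b c ▸ dvd_add hab hbc

theorem exists_fixedPoint_of_contracting {κ : Type*}
    (Φ : (κ → MvPowerSeries σ R) → κ → MvPowerSeries σ R)
    (hΦ : ∀ n f g, (∀ i, X s ^ n ∣ f i - g i) → ∀ i, X s ^ (n + 1) ∣ Φ f i - Φ g i) :
    ∃ f, Φ f = f := by
  have iterate_succ : ∀ n, Φ^[n + 1] 0 = Φ (Φ^[n] 0) := fun n => Function.iterate_succ_apply' _ _ _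
  have cauchy : ∀ k n i, X s ^ n ∣ (Φ^[n + k] 0) i - (Φ^[n] 0) i := by
    intro k n
    induction n with
    | zero => simp
    | succ n ih =>
      rw [Nat.add_right_comm, iterate_succ, iterate_succ]
      exact hΦ n _ _ ih
  let f : κ → MvPowerSeries σ R := fun i e => coeff e ((Φ^[e s + 1] 0) i)
  have dvd_limit_sub : ∀ n i, X s ^ n ∣ f i - (Φ^[n] 0) i := fun n i => by
    refine X_pow_dvd_iff.2 fun e he => ?_
    obtain ⟨k, rfl⟩ := Nat.exists_eq_add_of_le (Nat.succ_le_of_lt he)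
    have coeff_eq := X_pow_dvd_iff.1 (cauchy k (e s + 1) i) e (Nat.lt_succ_self _)
    rw [map_sub, sub_eq_zero] at coeff_eq
    rw [map_sub, coeff_eq]
    exact sub_self _
  refine ⟨f, funext fun i => eq_of_forall_X_pow_dvd_sub (s := s) fun n => ?_⟩
  have dvd_map_sub : X s ^ (n + 1) ∣ Φ f i - (Φ^[n + 1] 0) i :=
    iterate_succ n ▸ hΦ n _ _ (dvd_limit_sub n) i
  have dvd_sub_limit := (dvd_sub_comm).1 (dvd_limit_sub (n + 1) i)
  exact (pow_dvd_pow _ n.le_succ).trans (dvd_sub_trans dvd_map_sub dvd_sub_limit)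

end Adic

variable {m : ℕ}

/-- Series in `t, u, z₁, …, z_m`. -/
abbrev FSeries (m : ℕ) : Type := MvPowerSeries (FVar m) ℚ

/-- Series in `t, z₁, …, z_m`. -/
abbrev GSeries (m : ℕ) : Type := MvPowerSeries (GVar m) ℚ

instance (m : ℕ) : Filter.TendstoCofinite (GVar.emb m) :=
  ⟨(GVar.emb m).injective.tendsto_cofinite⟩

/-- Regard a series without `u` as a series in all variables. -/
noncomputable def ι : GSeries m →ₐ[ℚ] FSeries m := rename (GVar.emb m)

/-- Set `u = 0`. -/
noncomputable def ε : FSeries m →ₐ[ℚ] GSeries m := killCompl (GVar.emb m)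

/-- The divided difference `(f(u) - f(0)) / u`. -/
noncomputable def Δ : FSeries m →ₗ[ℚ] FSeries m where
  toFun f := fun e => coeff (e + Finsupp.single .u 1) f
  map_add' _ _ := rfl
  map_smul' _ _ := rfl

theorem coeff_Δ (f : FSeries m) (e : FVar m →₀ ℕ) :
    coeff e (Δ f) = coeff (e + Finsupp.single .u 1) f := rfl

@[simp]
theorem ε_ι (c : GSeries m) : ε (ι c) = c := killCompl_rename_app c

theorem ε_X_u : ε (X .u : FSeries m) = 0 :=
  killCompl_X_eq_zero fun h => (FVar.mem_range_emb_iff _).1 h rfl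

theorem ι_X_t : ι (X .t : GSeries m) = X .t := rename_X (GVar.emb m) _

theorem ι_X_z (i : Fin m) : ι (X (.z i) : GSeries m) = X (.z i) := rename_X (GVar.emb m) _

theorem ε_X_t : ε (X .t : FSeries m) = X .t := by rw [← ι_X_t, ε_ι]

theorem mem_range_embDomain_emb_iff (e : FVar m →₀ ℕ) :
    e ∈ Set.range (Finsupp.embDomain (GVar.emb m)) ↔ e .u = 0 := by
  rw [Finsupp.mem_range_embDomain_iff]
  refine ⟨fun h => ?_, fun h v hv => (FVar.mem_range_emb_iff v).2 ?_⟩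
  · by_contra hu
    exact (FVar.mem_range_emb_iff _).1 (h (Finsupp.mem_support_iff.2 hu)) rfl
  · rintro rfl
    exact Finsupp.mem_support_iff.1 hv h

theorem ι_ε_add_X_u_mul_Δ (f : FSeries m) : ι (ε f) + X .u * Δ f = f := by
  ext e
  rw [map_add]
  by_cases h : e .u = 0
  · have coeff_X_u_mul : coeff e (X .u * Δ f) = 0 := X_dvd_iff.1 (dvd_mul_right _ _) e h
    obtain ⟨e, rfl⟩ := (mem_range_embDomain_emb_iff e).2 h
    rw [coeff_X_u_mul, ι, ε, coeff_embDomain_rename, coeff_killCompl, add_zero]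
  · have coeff_ι : coeff e (ι (ε f)) = 0 := by
      refine coeff_rename_eq_zero _ _ ?_
      rintro ⟨x, hx⟩
      rw [← Finsupp.embDomain_eq_mapDomain] at hx
      exact h ((mem_range_embDomain_emb_iff e).1 ⟨x, hx⟩)
    obtain ⟨e, rfl⟩ : ∃ e', e = Finsupp.single .u 1 + e' :=
      ⟨_, (add_tsub_cancel_of_le (Finsupp.single_le_iff.2 (Nat.one_le_iff_ne_zero.2 h))).symm⟩
    rw [coeff_ι, X_def, coeff_add_monomial_mul, one_mul, zero_add, coeff_Δ, add_comm]

theorem Δ_X_u_mul (f : FSeries m) : Δ (X .u * f) = f := by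
  have decomposition := ι_ε_add_X_u_mul_Δ (X .u * f)
  rw [map_mul, ε_X_u, zero_mul, map_zero, zero_add] at decomposition
  exact mul_left_cancel₀ (X_ne_zero FVar.u) decomposition

theorem Δ_ι_mul (c : GSeries m) (f : FSeries m) : Δ (ι c * f) = ι c * Δ f := by
  have decomposition := ι_ε_add_X_u_mul_Δ (ι c * f)
  conv_rhs at decomposition => rw [← ι_ε_add_X_u_mul_Δ f]
  rw [map_mul, ε_ι, map_mul, mul_add, add_right_inj, mul_left_comm] at decomposition
  exact mul_left_cancel₀ (X_ne_zero FVar.u) decomposition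

theorem Δ_ι (c : GSeries m) : Δ (ι c) = 0 := by
  have decomposition := ι_ε_add_X_u_mul_Δ (ι c)
  rw [ε_ι, add_eq_left] at decomposition
  exact (mul_eq_zero.1 decomposition).resolve_left (X_ne_zero FVar.u)

theorem Δ_pow_ι_mul (k : ℕ) (c : GSeries m) (f : FSeries m) :
    (Δ ^ k) (ι c * f) = ι c * (Δ ^ k) f := by
  induction k with
  | zero => rfl
  | succ k ih => rw [pow_succ', Module.End.mul_apply, ih, Δ_ι_mul, Module.End.mul_apply]

theorem Δ_pow_X_u_pow_mul (k : ℕ) (f : FSeries m) : (Δ ^ k) (X .u ^ k * f) = f := by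
  induction k with
  | zero => simp
  | succ k ih => rw [pow_succ, pow_succ', mul_assoc, Module.End.mul_apply, Δ_X_u_mul, ih]

theorem Δ_pow_X_u_pow_mul_of_le {k n : ℕ} (h : k ≤ n) (f : FSeries m) :
    (Δ ^ k) (X .u ^ n * f) = X .u ^ (n - k) * f := by
  obtain ⟨l, rfl⟩ := Nat.exists_eq_add_of_le h
  rw [pow_add, mul_assoc, Δ_pow_X_u_pow_mul, Nat.add_sub_cancel_left]

theorem Δ_pow_X_u_pow_mul_of_ge {k n : ℕ} (h : n ≤ k) (f : FSeries m) :
    (Δ ^ k) (X .u ^ n * f) = (Δ ^ (k - n)) f := by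
  obtain ⟨l, rfl⟩ := Nat.exists_eq_add_of_le h
  rw [add_comm n l, pow_add, Module.End.mul_apply, Δ_pow_X_u_pow_mul, Nat.add_sub_cancel]

theorem Δ_pow_X_u_pow_mul_ι_of_lt {k n : ℕ} (h : n < k) (c : GSeries m) :
    (Δ ^ k) (X .u ^ n * ι c) = 0 := by
  obtain ⟨l, rfl⟩ := Nat.exists_eq_add_of_lt h
  rw [Δ_pow_X_u_pow_mul_of_ge h.le, add_assoc, Nat.add_sub_cancel_left, pow_succ,
    Module.End.mul_apply, Δ_ι, map_zero]

theorem X_t_pow_dvd_Δ_pow {n : ℕ} {f : FSeries m} (h : X .t ^ n ∣ f) (k : ℕ) :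
    X .t ^ n ∣ (Δ ^ k) f := by
  obtain ⟨g, rfl⟩ := h
  rw [← ι_X_t, ← map_pow, Δ_pow_ι_mul]
  exact dvd_mul_right _ _

end MapSeries

open RootedPlanarMap

namespace RootedPlanarMap

theorem outerDegree_pos_iff {M : RootedPlanarMap} : 0 < M.outerDegree ↔ M ≠ vertex := by
  rw [Nat.pos_iff_ne_zero, Ne, outerDegree_eq_zero_iff]

theorem innerDegrees_vertex : vertex.innerDegrees = 0 := Stub.innerSizes_unit

theorem fWeight_t {m : ℕ} (M : RootedPlanarMap) : M.fWeight m .t = M.edges := by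
  simp [fWeight]

theorem gWeight_t {m : ℕ} (M : RootedPlanarMap) : M.gWeight m .t = M.edges := by
  simp [gWeight]

/-- The maps with fewer than `N` edges. -/
noncomputable def mapsBelow (N : ℕ) : Finset RootedPlanarMap :=
  open Classical in (Finset.range N).biUnion fun n => (finite_edges_eq n).toFinset

@[simp]
theorem mem_mapsBelow {N : ℕ} {M : RootedPlanarMap} : M ∈ mapsBelow N ↔ M.edges < N := by
  simp [mapsBelow]

theorem sum_mapsBelow_succ {A : Type*} [AddCommMonoid A] (w : RootedPlanarMap → A) (N : ℕ) :
    ∑ M ∈ mapsBelow (N + 1), w M = w vertex +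
      (∑ p ∈ mapsBelow N ×ˢ mapsBelow N with p.1.edges + p.2.edges < N, w (p.1.bridge p.2) +
        ∑ M ∈ mapsBelow N, ∑ k : Fin (M.outerDegree + 1), w (M.addEdge k)) := by
  let e := Equiv.ofBijective compose compose_bijective
  let P := (mapsBelow N ×ˢ mapsBelow N).filter fun p => p.1.edges + p.2.edges < N
  let Q := (mapsBelow N).sigma fun M => (Finset.univ : Finset (Fin (M.outerDegree + 1)))
  have mem_iff : ∀ x, x ∈ Finset.insertNone (P.disjSum Q) ↔ e x ∈ mapsBelow (N + 1) := by
    rintro (_ | ⟨M, M'⟩ | ⟨M, k⟩)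
    · simp [e, compose, edges]
    · simp only [Finset.some_mem_insertNone, Finset.inl_mem_disjSum, P, Finset.mem_filter,
        Finset.mem_product, mem_mapsBelow, e, Equiv.ofBijective_apply, compose, edges_bridge]
      omega
    · simp [Q, e, compose, edges_addEdge]
  rw [← Finset.sum_equiv e mem_iff fun _ _ => rfl, Finset.sum_insertNone, Finset.sum_disjSum,
    Finset.sum_sigma]
  rfl

end RootedPlanarMap

namespace MapSeries

variable {m : ℕ}

section FaceWeight

variable {R : Type*}

/-- The weight `z_{k+1}` of a face of degree `k + 1`; it is zero if the degree exceeds `m`. -/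
def faceWeight [Zero R] (z : Fin m → R) (k : ℕ) : R :=
  if h : k < m then z ⟨k, h⟩ else 0

theorem faceWeight_val [Zero R] (z : Fin m → R) (i : Fin m) : faceWeight z i = z i :=
  dif_pos i.2

theorem faceWeight_of_le [Zero R] (z : Fin m → R) {k : ℕ} (h : m ≤ k) : faceWeight z k = 0 :=
  dif_neg h.not_gt

theorem prod_faceWeight_of_forall_le [CommSemiring R] (z : Fin m → R) {s : Multiset ℕ}
    (pos : ∀ d ∈ s, 0 < d) (le : ∀ d ∈ s, d ≤ m) :
    (s.map fun d => faceWeight z (d - 1)).prod = ∏ i : Fin m, z i ^ s.count (i + 1 : ℕ) := by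
  have toFinset_subset : s.toFinset ⊆ (Finset.range m).image Nat.succ := fun d hd => by
    rw [Multiset.mem_toFinset] at hd
    have d_sub_one_lt : d - 1 < m := Nat.sub_one_lt_of_le (pos d hd) (le d hd)
    exact Finset.mem_image.2
      ⟨d - 1, Finset.mem_range.2 d_sub_one_lt, Nat.succ_pred_eq_of_pos (pos d hd)⟩
  calc (s.map fun d => faceWeight z (d - 1)).prod
      = ∏ d ∈ s.toFinset, faceWeight z (d - 1) ^ s.count d := Finset.prod_multiset_map_count _ _
    _ = ∏ d ∈ (Finset.range m).image Nat.succ, faceWeight z (d - 1) ^ s.count d :=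
        Finset.prod_subset toFinset_subset fun d _ hd => by
          rw [Multiset.count_eq_zero_of_notMem (mt Multiset.mem_toFinset.2 hd), pow_zero]
    _ = ∏ i ∈ Finset.range m, faceWeight z i ^ s.count (i + 1) :=
        Finset.prod_image Nat.succ_injective.injOn
    _ = ∏ i : Fin m, faceWeight z i ^ s.count (i + 1 : ℕ) :=
        (Fin.prod_univ_eq_prod_range (fun i => faceWeight z i ^ s.count (i + 1)) m).symm
    _ = ∏ i : Fin m, z i ^ s.count (i + 1 : ℕ) := by simp only [faceWeight_val]

theorem prod_faceWeight_eq_zero [CommSemiring R] (z : Fin m → R) {s : Multiset ℕ} {d : ℕ}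
    (hd : d ∈ s) (lt : m < d) : (s.map fun d => faceWeight z (d - 1)).prod = 0 :=
  Multiset.prod_eq_zero (Multiset.mem_map.2 ⟨d, hd, faceWeight_of_le z (Nat.le_pred_of_lt lt)⟩)

theorem prod_faceWeight_X {σ : Type*} (v : Fin m → σ) {s : Multiset ℕ} (pos : ∀ d ∈ s, 0 < d)
    {c : ℕ → ℕ} (count_eq : ∀ i, s.count i = c i) [Decidable (∀ i, m < i → c i = 0)] :
    (s.map fun d => faceWeight (fun i => (X (v i) : MvPowerSeries σ ℚ)) (d - 1)).prod =
      if ∀ i, m < i → c i = 0 then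
        monomial (∑ i : Fin m, Finsupp.single (v i) (c (i + 1 : ℕ))) 1 else 0 := by
  split_ifs with h
  · have le : ∀ d ∈ s, d ≤ m := fun d hd => le_of_not_gt fun hlt =>
      Multiset.count_eq_zero.1 ((count_eq d).trans (h d hlt)) hd
    rw [prod_faceWeight_of_forall_le _ pos le]
    simp only [X_pow_eq, count_eq]
    rw [prod_monomial, Finset.prod_const_one]
  · push Not at h
    obtain ⟨d, hlt, hd⟩ := h
    exact prod_faceWeight_eq_zero _ (Multiset.count_ne_zero.1 (count_eq d ▸ hd)) hlt

end FaceWeight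

/-- The face weights as series in all variables. -/
noncomputable def zF (m k : ℕ) : FSeries m := faceWeight (fun i => X (.z i)) k

/-- The face weights as series without `u`. -/
noncomputable def zG (m k : ℕ) : GSeries m := faceWeight (fun i => X (.z i)) k

theorem ι_zG (k : ℕ) : ι (zG m k) = zF m k := by
  unfold zG zF faceWeight
  split_ifs
  · exact ι_X_z _
  · exact map_zero _

/-- The product of the weights of the finite faces of a map. -/
noncomputable def innerWeight (m : ℕ) (M : RootedPlanarMap) : GSeries m :=
  (M.innerDegrees.map fun d => zG m (d - 1)).prod

/-- The contribution of a map to `F`. -/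
noncomputable def weightF (m : ℕ) (M : RootedPlanarMap) : FSeries m :=
  X .u ^ M.outerDegree * ι (X .t ^ M.edges * innerWeight m M)

/-- The contribution of a map to `G`. -/
noncomputable def weightG (m : ℕ) (M : RootedPlanarMap) : GSeries m :=
  open Classical in if ∀ i, m < i → M.faceCount i = 0 then monomial (M.gWeight m) 1 else 0

theorem ι_innerWeight (M : RootedPlanarMap)
    [Decidable (∀ i, m < i → M.finiteFaceCount i = 0)] : ι (innerWeight m M) =
      if ∀ i, m < i → M.finiteFaceCount i = 0 then
        monomial (∑ i : Fin m, Finsupp.single (.z i) (M.finiteFaceCount (i + 1))) 1 else 0 := by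
  rw [← prod_faceWeight_X _ (fun _ => M.pos_of_mem_innerDegrees) fun i => M.count_innerDegrees i,
    innerWeight, map_multiset_prod, Multiset.map_map]
  exact congrArg _ (Multiset.map_congr rfl fun d _ => ι_zG _)

theorem weightF_eq_ite (M : RootedPlanarMap)
    [Decidable (∀ i, m < i → M.finiteFaceCount i = 0)] : weightF m M =
      if ∀ i, m < i → M.finiteFaceCount i = 0 then monomial (M.fWeight m) 1 else 0 := by
  rw [weightF, map_mul, map_pow, ι_X_t, ι_innerWeight, mul_ite, mul_ite]
  simp only [X_pow_eq, monomial_mul_monomial, mul_zero, fWeight, mul_one]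
  congr 3
  abel

theorem weightF_vertex : weightF m vertex = 1 := by
  simp [weightF, innerWeight, innerDegrees_vertex, RootedPlanarMap.outerDegree, edges]

theorem weightG_vertex : weightG m vertex = 1 := by
  have faceCount_eq_zero : ∀ i, m < i → vertex.faceCount i = 0 := fun i hi =>
    if_neg (Nat.ne_zero_of_lt hi)
  rw [weightG, if_pos faceCount_eq_zero, gWeight]
  simp [RootedPlanarMap.faceCount, edges]

theorem weightG_of_ne_vertex {M : RootedPlanarMap} (hM : M ≠ vertex) :
    weightG m M = zG m (M.outerDegree - 1) * (X .t ^ M.edges * innerWeight m M) := by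
  classical
  have pos : ∀ d ∈ M.outerDegree ::ₘ M.innerDegrees, 0 < d := fun d hd => by
    rcases Multiset.mem_cons.1 hd with rfl | hd
    · exact outerDegree_pos_iff.2 hM
    · exact M.pos_of_mem_innerDegrees hd
  have count_eq : ∀ i, (M.outerDegree ::ₘ M.innerDegrees).count i = M.faceCount i := fun i => by
    rw [Multiset.count_cons, M.count_innerDegrees, M.faceCount_eq_add]
  have prod_eq := prod_faceWeight_X (GVar.z (m := m)) pos count_eq
  rw [Multiset.map_cons, Multiset.prod_cons] at prod_eq
  change zG m (M.outerDegree - 1) * innerWeight m M = _ at prod_eq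
  rw [mul_left_comm, prod_eq, weightG, mul_ite, mul_zero, X_pow_eq, monomial_mul_monomial, one_mul]
  congr

theorem X_pow_dvd_card_sub_sum {σ : Type*} (t : σ) (p : RootedPlanarMap → Prop) [DecidablePred p]
    {w : RootedPlanarMap → σ →₀ ℕ} (hw : ∀ M, w M t = M.edges) (N : ℕ) :
    X t ^ N ∣ (show MvPowerSeries σ ℚ from fun e => (Nat.card {M // p M ∧ w M = e} : ℚ)) -
      ∑ M ∈ mapsBelow N, if p M then monomial (w M) 1 else 0 := by
  classical
  refine X_pow_dvd_iff.2 fun e he => ?_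
  have coeff_eq : ∀ M, coeff e (if p M then monomial (w M) (1 : ℚ) else 0) =
      if p M ∧ w M = e then 1 else 0 := fun M => by
    by_cases h : p M <;> simp [h, coeff_monomial, eq_comm]
  rw [map_sub, map_sum, sub_eq_zero]
  simp only [coeff_eq, Finset.sum_boole]
  change (Nat.card {M // p M ∧ w M = e} : ℚ) = _
  rw [← Nat.card_eq_finsetCard]
  refine congrArg _ (Nat.card_congr (Equiv.subtypeEquivRight fun M => ?_))
  rw [Finset.mem_filter, mem_mapsBelow]
  exact ⟨fun h => ⟨hw M ▸ h.2 ▸ he, h⟩, And.right⟩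

/-- The contribution to `F` of the maps with fewer than `N` edges. -/
noncomputable def partialF (m N : ℕ) : FSeries m := ∑ M ∈ mapsBelow N, weightF m M

theorem X_pow_dvd_finiteFaceGF_sub (m N : ℕ) : X .t ^ N ∣ finiteFaceGF m - partialF m N := by
  classical
  simp only [partialF, weightF_eq_ite]
  exact X_pow_dvd_card_sub_sum FVar.t _ fWeight_t N

theorem X_pow_dvd_allFaceGF_sub (m N : ℕ) :
    X .t ^ N ∣ allFaceGF m - ∑ M ∈ mapsBelow N, weightG m M := by
  classical
  exact X_pow_dvd_card_sub_sum GVar.t _ gWeight_t N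

section Tutte

/-- The effect on a series of cutting a finite face off the infinite one by a root edge: the face
may take any degree `k + 1` that leaves the outer degree positive. -/
noncomputable def cutFace (m : ℕ) : FSeries m →ₗ[ℚ] FSeries m :=
  ∑ k ∈ Finset.range m, LinearMap.mulLeft ℚ (zF m k) ∘ₗ Δ ^ k

theorem cutFace_apply (f : FSeries m) :
    cutFace m f = ∑ k ∈ Finset.range m, zF m k * (Δ ^ k) f := by
  simp [cutFace]

theorem cutFace_ι_mul (c : GSeries m) (f : FSeries m) :
    cutFace m (ι c * f) = ι c * cutFace m f := by
  simp only [cutFace_apply, Δ_pow_ι_mul, Finset.mul_sum, mul_left_comm]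

/-- The right-hand side of Tutte's equation. -/
noncomputable def tutte (f : FSeries m) : FSeries m :=
  1 + X .t * (X .u ^ 2 * f ^ 2 + X .u * cutFace m f)

theorem weightF_bridge (M N : RootedPlanarMap) :
    weightF m (M.bridge N) = X .t * (X .u ^ 2 * (weightF m M * weightF m N)) := by
  simp only [weightF, innerWeight, edges_bridge, outerDegree_bridge, innerDegrees_bridge,
    Multiset.map_add, Multiset.prod_add, map_mul, map_pow, ι_X_t]
  ring

theorem weightF_addEdge (M : RootedPlanarMap) (k : Fin (M.outerDegree + 1)) :
    weightF m (M.addEdge k) = X .t * (X .u * (zF m k * (Δ ^ (k : ℕ)) (weightF m M))) := by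
  have hk : (k : ℕ) ≤ M.outerDegree := Nat.lt_succ_iff.1 k.2
  have outerDegree_eq : (M.addEdge k).outerDegree = M.outerDegree - k + 1 := by
    have := M.outerDegree_addEdge k
    omega
  simp only [weightF, innerWeight, edges_addEdge, outerDegree_eq, innerDegrees_addEdge,
    Multiset.map_cons, Multiset.prod_cons, map_mul, map_pow, ι_X_t, Nat.add_sub_cancel, ι_zG,
    Δ_pow_X_u_pow_mul_of_le hk]
  ring

theorem cutFace_weightF (M : RootedPlanarMap) : cutFace m (weightF m M) =
    ∑ k : Fin (M.outerDegree + 1), zF m k * (Δ ^ (k : ℕ)) (weightF m M) := by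
  have zero_of_le : ∀ k, m ≤ k → zF m k * (Δ ^ k) (weightF m M) = 0 := fun k hk => by
    rw [zF, faceWeight_of_le _ hk, zero_mul]
  have zero_of_lt : ∀ k, M.outerDegree + 1 ≤ k → zF m k * (Δ ^ k) (weightF m M) = 0 :=
    fun k hk => by rw [weightF, Δ_pow_X_u_pow_mul_ι_of_lt hk, mul_zero]
  rw [cutFace_apply, Fin.sum_univ_eq_sum_range fun k => zF m k * (Δ ^ k) (weightF m M)]
  rcases le_total m (M.outerDegree + 1) with h | h
  · exact Finset.sum_subset (Finset.range_mono h) fun k _ hk =>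
      zero_of_le k (by simpa using hk)
  · exact (Finset.sum_subset (Finset.range_mono h) fun k _ hk =>
      zero_of_lt k (by simpa using hk)).symm

theorem partialF_succ (N : ℕ) : partialF m (N + 1) =
    1 + X .t * (X .u ^ 2 * (∑ p ∈ mapsBelow N ×ˢ mapsBelow N with p.1.edges + p.2.edges < N,
      weightF m p.1 * weightF m p.2) + X .u * cutFace m (partialF m N)) := by
  rw [partialF, sum_mapsBelow_succ, weightF_vertex, partialF, map_sum, mul_add]
  simp only [weightF_bridge, weightF_addEdge, cutFace_weightF, Finset.mul_sum]

theorem X_pow_edges_dvd_weightF (M : RootedPlanarMap) : X .t ^ M.edges ∣ weightF m M := by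
  rw [weightF, map_mul, map_pow, ι_X_t]
  exact (dvd_mul_right _ _).mul_left _

theorem X_pow_dvd_partialF_sq_sub (N : ℕ) : X .t ^ N ∣ partialF m N ^ 2 -
    ∑ p ∈ mapsBelow N ×ˢ mapsBelow N with p.1.edges + p.2.edges < N,
      weightF m p.1 * weightF m p.2 := by
  rw [sq, partialF, Finset.sum_mul_sum, ← Finset.sum_product',
    ← Finset.sum_filter_add_sum_filter_not _ fun p => p.1.edges + p.2.edges < N,
    add_sub_cancel_left]
  refine Finset.dvd_sum fun p hp => (pow_dvd_pow _ (not_lt.1 (Finset.mem_filter.1 hp).2)).trans ?_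
  rw [pow_add]
  exact mul_dvd_mul (X_pow_edges_dvd_weightF _) (X_pow_edges_dvd_weightF _)

theorem X_pow_dvd_tutte_partialF_sub (N : ℕ) :
    X .t ^ (N + 1) ∣ tutte (partialF m N) - partialF m (N + 1) := by
  rw [tutte, partialF_succ, add_sub_add_left_eq_sub, ← mul_sub, add_sub_add_right_eq_sub, ← mul_sub,
    pow_succ']
  exact mul_dvd_mul_left _ ((X_pow_dvd_partialF_sq_sub N).mul_left _)

theorem X_pow_dvd_tutte_sub {n : ℕ} {f g : FSeries m} (h : X .t ^ n ∣ f - g) :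
    X .t ^ (n + 1) ∣ tutte f - tutte g := by
  have dvd_cutFace : X .t ^ n ∣ cutFace m f - cutFace m g := by
    rw [← map_sub, cutFace_apply]
    exact Finset.dvd_sum fun k _ => (X_t_pow_dvd_Δ_pow h k).mul_left _
  rw [tutte, tutte, add_sub_add_left_eq_sub, ← mul_sub, add_sub_add_comm, ← mul_sub, ← mul_sub,
    pow_succ']
  exact mul_dvd_mul_left _ (dvd_add ((h.trans (sub_dvd_pow_sub_pow f g 2)).mul_left _)
    (dvd_cutFace.mul_left _))

theorem tutte_finiteFaceGF (m : ℕ) : tutte (finiteFaceGF m) = finiteFaceGF m := by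
  refine eq_of_forall_X_pow_dvd_sub (s := FVar.t) fun N => (pow_dvd_pow _ N.le_succ).trans ?_
  exact dvd_sub_trans (X_pow_dvd_tutte_sub (X_pow_dvd_finiteFaceGF_sub m N))
    (dvd_sub_trans (X_pow_dvd_tutte_partialF_sub N)
      (dvd_sub_comm.1 (X_pow_dvd_finiteFaceGF_sub m (N + 1))))

theorem eq_of_tutte_eq {f g : FSeries m} (hf : tutte f = f) (hg : tutte g = g) : f = g := by
  refine eq_of_forall_X_pow_dvd_sub (s := FVar.t) fun n => ?_
  induction n with
  | zero => simp
  | succ n ih =>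
    have dvd_sub := X_pow_dvd_tutte_sub ih
    rwa [hf, hg] at dvd_sub

end Tutte

section OuterFace

/-- Replace `u ^ (k + 1)` by `z_{k+1}`, and constants by `0`. -/
noncomputable def closeOuterFace (m : ℕ) : FSeries m →ₗ[ℚ] GSeries m :=
  ∑ k ∈ Finset.range m, LinearMap.mulLeft ℚ (zG m k) ∘ₗ ε.toLinearMap ∘ₗ Δ ^ (k + 1)

theorem closeOuterFace_apply (f : FSeries m) :
    closeOuterFace m f = ∑ k ∈ Finset.range m, zG m k * ε ((Δ ^ (k + 1)) f) := by
  simp [closeOuterFace]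

theorem closeOuterFace_ι (c : GSeries m) : closeOuterFace m (ι c) = 0 := by
  rw [closeOuterFace_apply]
  refine Finset.sum_eq_zero fun k _ => ?_
  rw [pow_succ, Module.End.mul_apply, Δ_ι, map_zero, map_zero, mul_zero]

theorem ε_Δ_pow_X_u_pow_mul_ι (k n : ℕ) (c : GSeries m) :
    ε ((Δ ^ k) (X .u ^ n * ι c)) = if k = n then c else 0 := by
  rcases lt_trichotomy k n with h | rfl | h
  · rw [if_neg h.ne, Δ_pow_X_u_pow_mul_of_le h.le, map_mul, map_pow, ε_X_u,
      zero_pow (Nat.sub_ne_zero_of_lt h), zero_mul]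
  · rw [if_pos rfl, Δ_pow_X_u_pow_mul, ε_ι]
  · rw [if_neg h.ne', Δ_pow_X_u_pow_mul_ι_of_lt h, map_zero]

theorem closeOuterFace_X_u_pow_succ_mul_ι (n : ℕ) (c : GSeries m) :
    closeOuterFace m (X .u ^ (n + 1) * ι c) = zG m n * c := by
  simp only [closeOuterFace_apply, ε_Δ_pow_X_u_pow_mul_ι, Nat.add_right_cancel_iff, mul_ite,
    mul_zero, Finset.sum_ite_eq', Finset.mem_range]
  refine ite_eq_left_iff.2 fun h => ?_
  rw [zG, faceWeight_of_le _ (not_lt.1 h), zero_mul]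

theorem weightG_eq_add (M : RootedPlanarMap) [Decidable (M = vertex)] :
    weightG m M = (if M = vertex then 1 else 0) + closeOuterFace m (weightF m M) := by
  split_ifs with hM
  · rw [hM, weightG_vertex, weightF_vertex, ← map_one ι, closeOuterFace_ι, add_zero]
  · obtain ⟨n, hn⟩ := Nat.exists_eq_add_one_of_ne_zero (outerDegree_pos_iff.2 hM).ne'
    rw [weightG_of_ne_vertex hM, weightF, hn, closeOuterFace_X_u_pow_succ_mul_ι, zero_add,
      Nat.add_sub_cancel]

theorem sum_weightG_mapsBelow_succ (N : ℕ) : ∑ M ∈ mapsBelow (N + 1), weightG m M =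
    1 + closeOuterFace m (partialF m (N + 1)) := by
  classical
  simp only [weightG_eq_add, Finset.sum_add_distrib, partialF, map_sum, Finset.sum_ite_eq',
    mem_mapsBelow]
  simp [edges]

theorem X_pow_dvd_closeOuterFace {N : ℕ} {f : FSeries m} (h : X .t ^ N ∣ f) :
    X .t ^ N ∣ closeOuterFace m f := by
  rw [closeOuterFace_apply]
  refine Finset.dvd_sum fun k _ => Dvd.dvd.mul_left ?_ _
  rw [← ε_X_t, ← map_pow]
  exact map_dvd ε (X_t_pow_dvd_Δ_pow h _)

theorem allFaceGF_eq_one_add (m : ℕ) : allFaceGF m = 1 + closeOuterFace m (finiteFaceGF m) := by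
  refine eq_of_forall_X_pow_dvd_sub (s := GVar.t) fun N => (pow_dvd_pow _ N.le_succ).trans ?_
  refine dvd_sub_trans (X_pow_dvd_allFaceGF_sub m (N + 1)) ?_
  rw [sum_weightG_mapsBelow_succ, add_sub_add_left_eq_sub, ← map_sub]
  exact X_pow_dvd_closeOuterFace (dvd_sub_comm.1 (X_pow_dvd_finiteFaceGF_sub m (N + 1)))

end OuterFace

end MapSeries

end Series

/-! ### The rational parametrization -/

section Parametrization

open Polynomial

namespace MapSeries

variable {A B : Type*} [CommRing A] [CommRing B] {m : ℕ}

/-- The pair `(a, p)` with `(x + s + y) ^ n = a + x p(x) + y p(y)` whenever `x y = r`: the constant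
part and, divided by `x`, the positive part of the Laurent polynomial `(x + s + r / x) ^ n`. -/
noncomputable def laurentPow (r s : A) : ℕ → A × A[X]
  | 0 => (1, 0)
  | n + 1 => (s * (laurentPow r s n).1 + 2 * r * (laurentPow r s n).2.coeff 0,
      C (laurentPow r s n).1 + X * (laurentPow r s n).2 + C s * (laurentPow r s n).2 +
        C r * divX (laurentPow r s n).2)

theorem laurentPow_map (f : A →+* B) (r s : A) (n : ℕ) :
    laurentPow (f r) (f s) n = (f (laurentPow r s n).1, (laurentPow r s n).2.map f) := by
  have divX_map : ∀ p : A[X], divX (p.map f) = (divX p).map f := fun p => by ext; simp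
  induction n with
  | zero => simp [laurentPow]
  | succ n ih => simp [laurentPow, ih, divX_map, map_ofNat]

theorem eval_eq_eval_divX_mul_add (p : A[X]) (x : A) :
    p.eval x = (divX p).eval x * x + p.coeff 0 := by
  conv_lhs => rw [← divX_mul_X_add p]
  simp

theorem add_add_pow_eq_laurentPow {r s x y : A} (h : x * y = r) (n : ℕ) :
    (x + s + y) ^ n = (laurentPow r s n).1 + x * (laurentPow r s n).2.eval x +
      y * (laurentPow r s n).2.eval y := by
  induction n with
  | zero => simp [laurentPow]
  | succ n ih =>
    have eval_x := eval_eq_eval_divX_mul_add (laurentPow r s n).2 x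
    have eval_y := eval_eq_eval_divX_mul_add (laurentPow r s n).2 y
    rw [pow_succ, ih]
    simp only [laurentPow, eval_add, eval_mul, eval_C, eval_X]
    rw [← h] at *
    linear_combination x * y * eval_x + x * y * eval_y

theorem laurentPow_mem {S : Type*} [SetLike S A] [SubringClass S A] (C' : S) {r s : A}
    (hr : r ∈ C') (hs : s ∈ C') (n : ℕ) :
    (laurentPow r s n).1 ∈ C' ∧ ∀ k, (laurentPow r s n).2.coeff k ∈ C' := by
  have map_subtype := laurentPow_map (SubringClass.subtype C') ⟨r, hr⟩ ⟨s, hs⟩ n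
  simp only [SubringClass.subtype_apply] at map_subtype
  rw [map_subtype]
  exact ⟨Subtype.prop _, fun k => by simp⟩

theorem exists_eval₂_eq_mul_add (φ : B →+* A) {r s : B} {x y : A} (h : x * y = φ r) (p : B[X]) :
    ∃ a b : B[X], p.eval₂ φ x = a.eval₂ φ (x + φ s + y) * x + b.eval₂ φ (x + φ s + y) ∧
      p.eval₂ φ y = a.eval₂ φ (x + φ s + y) * y + b.eval₂ φ (x + φ s + y) := by
  induction p using Polynomial.induction_on' with
  | add p q hp hq =>
    obtain ⟨a, b, hpx, hpy⟩ := hp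
    obtain ⟨a', b', hqx, hqy⟩ := hq
    refine ⟨a + a', b + b', ?_, ?_⟩ <;> simp only [eval₂_add, hpx, hpy, hqx, hqy] <;> ring
  | monomial n c =>
    induction n with
    | zero => exact ⟨0, C c, by simp, by simp⟩
    | succ n ih =>
      -- `x` and `y` are the roots of `X ^ 2 = (w - s) X - r`, where `w = x + s + y`
      obtain ⟨a, b, hx, hy⟩ := ih
      refine ⟨a * (X - C s) + b, - (a * C r), ?_, ?_⟩ <;>
        rw [← monomial_mul_X, eval₂_mul_X] <;>
        simp only [hx, hy, eval₂_add, eval₂_mul, eval₂_sub, eval₂_neg, eval₂_X, eval₂_C, ← h] <;>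
        ring

theorem exists_eval₂_mul_eval₂_eq (φ : B →+* A) {r : B} (s : B) {x y : A} (h : x * y = φ r)
    (p : B[X]) : ∃ q : B[X], p.eval₂ φ x * p.eval₂ φ y = q.eval₂ φ (x + φ s + y) := by
  obtain ⟨a, b, hx, hy⟩ := exists_eval₂_eq_mul_add φ (s := s) h p
  refine ⟨a ^ 2 * C r + a * b * (X - C s) + b ^ 2, ?_⟩
  simp only [hx, hy, eval₂_add, eval₂_mul, eval₂_sub, eval₂_pow, eval₂_X, eval₂_C, ← h]
  ring

/-- The constant part of the Laurent polynomial `∑ z_{k+1} (x + s + r / x) ^ k`. -/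
noncomputable def laurentConst (m : ℕ) (z : ℕ → A) (r s : A) : A :=
  ∑ k ∈ Finset.range m, z k * (laurentPow r s k).1

/-- The positive part of the Laurent polynomial `∑ z_{k+1} (x + s + r / x) ^ k`, divided by `x`. -/
noncomputable def laurentPos (m : ℕ) (z : ℕ → A) (r s : A) : A[X] :=
  ∑ k ∈ Finset.range m, C (z k) * (laurentPow r s k).2

theorem laurentConst_map (f : A →+* B) (z : ℕ → A) (r s : A) :
    laurentConst m (f ∘ z) (f r) (f s) = f (laurentConst m z r s) := by
  simp [laurentConst, laurentPow_map]

theorem laurentPos_map (f : A →+* B) (z : ℕ → A) (r s : A) :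
    laurentPos m (f ∘ z) (f r) (f s) = (laurentPos m z r s).map f := by
  simp [laurentPos, laurentPow_map, Polynomial.map_sum]

theorem laurentConst_mem {S : Type*} [SetLike S A] [SubringClass S A] (C' : S) {z : ℕ → A}
    {r s : A} (hz : ∀ k, z k ∈ C') (hr : r ∈ C') (hs : s ∈ C') : laurentConst m z r s ∈ C' :=
  sum_mem fun k _ => mul_mem (hz k) (laurentPow_mem C' hr hs k).1

theorem coeff_laurentPos_mem {S : Type*} [SetLike S A] [SubringClass S A] (C' : S) {z : ℕ → A}
    {r s : A} (hz : ∀ k, z k ∈ C') (hr : r ∈ C') (hs : s ∈ C') (n : ℕ) :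
    (laurentPos m z r s).coeff n ∈ C' := by
  simp only [laurentPos, finsetSum_coeff, coeff_C_mul]
  exact sum_mem fun k _ => mul_mem (hz k) ((laurentPow_mem C' hr hs k).2 n)

theorem dvd_laurentConst_sub (z : ℕ → A) {d r s r' s' : A} (hr : d ∣ r - r') (hs : d ∣ s - s') :
    d ∣ laurentConst m z r s - laurentConst m z r' s' := by
  simp only [← Ideal.mem_span_singleton, ← Ideal.Quotient.eq] at hr hs ⊢
  rw [← laurentConst_map, ← laurentConst_map, hr, hs]

theorem dvd_coeff_laurentPos_sub (z : ℕ → A) {d r s r' s' : A} (hr : d ∣ r - r')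
    (hs : d ∣ s - s') (n : ℕ) :
    d ∣ (laurentPos m z r s).coeff n - (laurentPos m z r' s').coeff n := by
  simp only [← Ideal.mem_span_singleton, ← Ideal.Quotient.eq] at hr hs ⊢
  rw [← coeff_map, ← coeff_map, ← laurentPos_map, ← laurentPos_map, hr, hs]

/-- The polynomial `1 - t P`, where `x P` is the positive part of `∑ z_{k+1} (x + s + r / x) ^ k`.
If `s` is `t` times the constant part, then `w - t ∑ z_{k+1} w ^ k` at `w = x + s + r / x` is the
sum of the values at `x` and at `r / x` of `X (1 - t P)`. -/
noncomputable def laurentFactor (m : ℕ) (t : A) (z : ℕ → A) (r s : A) : A[X] :=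
  1 - C t * laurentPos m z r s

theorem eval₂_laurentFactor (φ : B →+* A) (t r s : B) (z : ℕ → B) (x : A) :
    (laurentFactor m t z r s).eval₂ φ x =
      1 - φ t * ∑ k ∈ Finset.range m, φ (z k) * (laurentPow r s k).2.eval₂ φ x := by
  simp [laurentFactor, laurentPos, eval₂_finsetSum]

theorem coeff_zero_laurentFactor (t r s : A) (z : ℕ → A) :
    (laurentFactor m t z r s).coeff 0 = 1 - t * (laurentPos m z r s).coeff 0 := by
  simp [laurentFactor]

theorem coeff_laurentFactor_mem {S : Type*} [SetLike S A] [SubringClass S A] (C' : S) {z : ℕ → A}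
    {t r s : A} (hz : ∀ k, z k ∈ C') (ht : t ∈ C') (hr : r ∈ C') (hs : s ∈ C') (n : ℕ) :
    (laurentFactor m t z r s).coeff n ∈ C' := by
  rw [laurentFactor, coeff_sub, coeff_C_mul, coeff_one]
  refine sub_mem ?_ (mul_mem ht (coeff_laurentPos_mem C' hz hr hs n))
  split_ifs
  · exact one_mem C'
  · exact zero_mem C'

theorem sub_sum_eq_laurentFactor (φ : B →+* A) {t r s : B} {z : ℕ → B}
    (hs : s = t * laurentConst m z r s) {x y : A} (h : x * y = φ r) :
    x + φ s + y - φ t * ∑ k ∈ Finset.range m, φ (z k) * (x + φ s + y) ^ k =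
      x * (laurentFactor m t z r s).eval₂ φ x + y * (laurentFactor m t z r s).eval₂ φ y := by
  have φ_s_eq : φ s = φ t * ∑ k ∈ Finset.range m, φ (z k) * φ (laurentPow r s k).1 := by
    conv_lhs => rw [hs]
    simp [laurentConst]
  have sum_eq : ∑ k ∈ Finset.range m, φ (z k) * (x + φ s + y) ^ k =
      ∑ k ∈ Finset.range m, φ (z k) * φ (laurentPow r s k).1 +
      x * ∑ k ∈ Finset.range m, φ (z k) * (laurentPow r s k).2.eval₂ φ x +
      y * ∑ k ∈ Finset.range m, φ (z k) * (laurentPow r s k).2.eval₂ φ y := by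
    rw [Finset.mul_sum, Finset.mul_sum, ← Finset.sum_add_distrib, ← Finset.sum_add_distrib]
    refine Finset.sum_congr rfl fun k _ => ?_
    rw [add_add_pow_eq_laurentPow h, laurentPow_map, eval_map, eval_map]
    ring
  rw [eval₂_laurentFactor, eval₂_laurentFactor, sum_eq]
  linear_combination φ_s_eq

/-- The parametrized solution of Tutte's equation, multiplied by `t`. The parameter is the small
root `y` of `y = u (1 + s y + r y ^ 2)`, and `u` times the value is `r y (1 - t P(r y))`. -/
noncomputable def parametrized (φ : B →+* A) (m : ℕ) (t : B) (z : ℕ → B) (r s : B) (y : A) : A :=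
  φ r * (1 + φ s * y + φ r * y ^ 2) * (laurentFactor m t z r s).eval₂ φ (φ r * y)

theorem mul_parametrized (φ : B →+* A) (t r s : B) (z : ℕ → B) {u y : A}
    (hy : y = u * (1 + φ s * y + φ r * y ^ 2)) : u * parametrized φ m t z r s y =
      φ r * y * (laurentFactor m t z r s).eval₂ φ (φ r * y) := by
  rw [parametrized]
  linear_combination -(φ r * (laurentFactor m t z r s).eval₂ φ (φ r * y)) * hy

/-- Writing `w = 1 / u` as `1 / y + s + r y`, the difference of `w - t ∑ z_{k+1} w ^ k` and its part
supported on `r y` is its part supported on `1 / y`, and the product of the two parts is symmetric,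
hence a polynomial in `w`. -/
theorem exists_parametrized_eq {K : Type*} [Field K] (φ : B →+* K) {t r s : B} {z : ℕ → B}
    (hs : s = t * laurentConst m z r s) {u y : K} (hu : u ≠ 0)
    (hy : y = u * (1 + φ s * y + φ r * y ^ 2)) : ∃ q : B[X],
      parametrized φ m t z r s y * (1 - φ t * u * ∑ k ∈ Finset.range m, φ (z k) * u⁻¹ ^ k -
        u ^ 2 * parametrized φ m t z r s y) = q.eval₂ φ u⁻¹ := by
  have hy0 : y ≠ 0 := by
    rintro rfl
    exact hu (by simpa using hy.symm)
  have inv_mul : y⁻¹ * (φ r * y) = φ r := by field_simp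
  have inv_add_add : y⁻¹ + φ s + φ r * y = u⁻¹ := by
    field_simp
    linear_combination -hy
  obtain ⟨q, product_eq⟩ := exists_eval₂_mul_eval₂_eq φ s inv_mul (laurentFactor m t z r s)
  have sum_eq := sub_sum_eq_laurentFactor φ hs inv_mul
  rw [inv_add_add] at product_eq sum_eq
  refine ⟨C r * q, ?_⟩
  rw [eval₂_mul, eval₂_C, ← product_eq]
  have mul_p := mul_parametrized (m := m) φ t r s z hy
  generalize parametrized φ m t z r s y = p at *
  generalize (laurentFactor m t z r s).eval₂ φ (φ r * y) = a at *
  generalize (laurentFactor m t z r s).eval₂ φ y⁻¹ = b at *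
  generalize ∑ k ∈ Finset.range m, φ (z k) * u⁻¹ ^ k = c at *
  calc p * (1 - φ t * u * c - u ^ 2 * p)
      = u * p * (u⁻¹ - φ t * c - u * p) := by linear_combination -p * inv_mul_cancel₀ hu
    _ = φ r * (b * a) := by
      rw [mul_p, sum_eq]
      linear_combination a * b * inv_mul

theorem eval₂_reflect_eq_pow_mul {K : Type*} [Field K] (φ : B →+* K) {u : K} (hu : u ≠ 0) {q : B[X]}
    {N : ℕ} (hN : q.natDegree ≤ N) : (reflect N q).eval₂ φ u = u ^ N * q.eval₂ φ u⁻¹ := by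
  let _ := invertibleOfNonzero (inv_ne_zero hu)
  rw [← eval₂_reflect_mul_pow _ u⁻¹ N q hN, invOf_eq_inv, inv_inv, mul_left_comm, ← mul_pow,
    mul_inv_cancel₀ hu, one_pow, mul_one]

theorem exists_parametrized_eq_of_isDomain [IsDomain A] (φ : B →+* A) {t r s : B} {z : ℕ → B}
    (hs : s = t * laurentConst m z r s) {u y : A} (hu : u ≠ 0)
    (hy : y = u * (1 + φ s * y + φ r * y ^ 2)) : ∃ N, ∃ q : B[X], m ≤ N ∧ q.natDegree ≤ N ∧
      u ^ N * parametrized φ m t z r s y =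
        φ t * ∑ k ∈ Finset.range m, φ (z k) * (u ^ (N + 1 - k) * parametrized φ m t z r s y) +
        u ^ (N + 2) * parametrized φ m t z r s y ^ 2 + q.eval₂ φ u := by
  let j := algebraMap A (FractionRing A)
  have j_injective : Function.Injective j := IsFractionRing.injective A _
  have j_u_ne_zero : j u ≠ 0 := (map_ne_zero_iff j j_injective).2 hu
  have j_hy : j y = j u * (1 + j.comp φ s * j y + j.comp φ r * j y ^ 2) := by
    conv_lhs => rw [hy]
    simp
  have j_parametrized :
      parametrized (j.comp φ) m t z r s (j y) = j (parametrized φ m t z r s y) := by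
    simp [parametrized, hom_eval₂]
  obtain ⟨q, hq⟩ := exists_parametrized_eq (m := m) (j.comp φ) hs j_u_ne_zero j_hy
  obtain ⟨N, le_N, natDegree_le⟩ : ∃ N, m ≤ N ∧ q.natDegree ≤ N :=
    ⟨_, le_max_left _ _, le_max_right _ _⟩
  have eval_reflect : j ((reflect N q).eval₂ φ u) = j u ^ N * q.eval₂ (j.comp φ) (j u)⁻¹ := by
    rw [hom_eval₂, eval₂_reflect_eq_pow_mul _ j_u_ne_zero natDegree_le]
  have pow_eq : ∀ k ∈ Finset.range m, j u ^ (N + 1 - k) = j u ^ (N + 1) * (j u)⁻¹ ^ k :=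
    fun k hk => by
      rw [inv_pow, pow_sub₀ _ j_u_ne_zero (((Finset.mem_range.1 hk).le.trans le_N).trans N.le_succ)]
  generalize parametrized φ m t z r s y = p at *
  have sum_eq : ∑ k ∈ Finset.range m, j (φ (z k)) * (j u ^ (N + 1 - k) * j p) =
      j u ^ (N + 1) * j p * ∑ k ∈ Finset.range m, j (φ (z k)) * (j u)⁻¹ ^ k := by
    rw [Finset.mul_sum]
    refine Finset.sum_congr rfl fun k hk => ?_
    rw [pow_eq k hk]
    ring
  refine ⟨N, reflect N q, le_N, natDegree_reflect_le.trans (max_le le_rfl natDegree_le),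
    j_injective ?_⟩
  simp only [map_add, map_mul, map_sum, map_pow, sum_eq, eval_reflect, ← hq, j_parametrized,
    RingHom.comp_apply]
  ring

end MapSeries

end Parametrization

section Series

open MvPowerSeries

namespace MapSeries

variable {m : ℕ}

theorem exists_R_S (m : ℕ) : ∃ R S : GSeries m,
    R = X .t + X .t * R * (laurentPos m (zG m) R S).coeff 0 ∧
      S = X .t * laurentConst m (zG m) R S := by
  let Φ (f : Bool → GSeries m) (b : Bool) : GSeries m :=
    bif b then X .t + X .t * f true * (laurentPos m (zG m) (f true) (f false)).coeff 0
    else X .t * laurentConst m (zG m) (f true) (f false)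
  obtain ⟨f, hf⟩ : ∃ f, Φ f = f :=
    exists_fixedPoint_of_contracting (s := GVar.t) Φ fun n f g h b => by
      rw [pow_succ']
      cases b
      · simp only [Φ, cond_false, ← mul_sub]
        exact mul_dvd_mul_left _ (dvd_laurentConst_sub _ (h true) (h false))
      · simp only [Φ, cond_true, add_sub_add_left_eq_sub, mul_assoc, ← mul_sub]
        exact mul_dvd_mul_left _
          (dvd_mul_sub_mul (h true) (dvd_coeff_laurentPos_sub _ (h true) (h false) 0))
  exact ⟨f true, f false, (congrFun hf true).symm, (congrFun hf false).symm⟩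

theorem exists_y (R S : GSeries m) : ∃ y : FSeries m, y = X .u * (1 + ι S * y + ι R * y ^ 2) := by
  obtain ⟨f, hf⟩ := exists_fixedPoint_of_contracting (s := FVar.u) (κ := Unit) (R := ℚ)
    (fun f b => X .u * (1 + ι S * f b + ι R * f b ^ 2)) fun n f g h b => by
      rw [pow_succ', ← mul_sub, add_sub_add_comm, add_sub_add_left_eq_sub, ← mul_sub, ← mul_sub]
      exact mul_dvd_mul_left _ (dvd_add ((h b).mul_left _)
        (((h b).trans (sub_dvd_pow_sub_pow _ _ 2)).mul_left _))
  exact ⟨f (), (congrFun hf ()).symm⟩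

theorem ε_eval₂_ι (p : Polynomial (GSeries m)) {f : FSeries m} (hf : ε f = 0) :
    ε (p.eval₂ ι.toRingHom f) = p.coeff 0 := by
  have comp_eq_id : (ε : FSeries m →ₐ[ℚ] GSeries m).toRingHom.comp ι.toRingHom = RingHom.id _ :=
    RingHom.ext ε_ι
  change ε.toRingHom (p.eval₂ ι.toRingHom f) = _
  rw [Polynomial.hom_eval₂, comp_eq_id, Polynomial.eval₂_id,
    show (ε : FSeries m →ₐ[ℚ] GSeries m).toRingHom f = 0 from hf,
    Polynomial.coeff_zero_eq_eval_zero]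

theorem Δ_pow_eval₂_X_u {N : ℕ} {q : Polynomial (GSeries m)} (hN : q.natDegree < N) :
    (Δ ^ N) (q.eval₂ ι.toRingHom (X .u)) = 0 := by
  rw [Polynomial.eval₂_eq_sum_range, map_sum]
  refine Finset.sum_eq_zero fun k hk => ?_
  rw [mul_comm]
  exact Δ_pow_X_u_pow_mul_ι_of_lt ((Nat.lt_succ_iff.1 (Finset.mem_range.1 hk)).trans_lt hN) _

theorem Δ_pow_sum_eq_cutFace {N : ℕ} (hN : m ≤ N) (p : FSeries m) :
    (Δ ^ N) (∑ k ∈ Finset.range m, ι (zG m k) * (X .u ^ (N - k) * p)) = cutFace m p := by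
  rw [map_sum, cutFace_apply]
  refine Finset.sum_congr rfl fun k hk => ?_
  have hkN : k ≤ N := (Finset.mem_range.1 hk).le.trans hN
  rw [Δ_pow_ι_mul, Δ_pow_X_u_pow_mul_of_ge (Nat.sub_le N k), ι_zG, Nat.sub_sub_self hkN]

section Parametrized

variable {R S : GSeries m} {y : FSeries m}

theorem ε_parametrized (hR : R = X .t + X .t * R * (laurentPos m (zG m) R S).coeff 0)
    (hy : ε y = 0) : ε (parametrized ι.toRingHom m (X .t) (zG m) R S y) = X .t := by
  have ε_factor := ε_eval₂_ι (laurentFactor m (X .t) (zG m) R S) (f := ι R * y)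
    (by rw [map_mul, hy, mul_zero])
  rw [coeff_zero_laurentFactor] at ε_factor
  have ε_quadratic : ε (1 + ι S * y + ι R * y ^ 2) = 1 := by simp [hy]
  change ε (ι R * (1 + ι S * y + ι R * y ^ 2) *
    (laurentFactor m (X .t) (zG m) R S).eval₂ ι.toRingHom (ι R * y)) = _
  rw [map_mul, map_mul, ε_ι, ε_quadratic, ε_factor]
  linear_combination hR

theorem X_t_dvd_parametrized (hR : R = X .t + X .t * R * (laurentPos m (zG m) R S).coeff 0)
    (y : FSeries m) : X .t ∣ parametrized ι.toRingHom m (X .t) (zG m) R S y := by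
  have X_t_dvd_R : X .t ∣ R := by
    refine ⟨1 + R * (laurentPos m (zG m) R S).coeff 0, ?_⟩
    linear_combination hR
  have X_t_dvd_ι_R : X .t ∣ ι R := ι_X_t (m := m) ▸ map_dvd ι X_t_dvd_R
  exact (X_t_dvd_ι_R.mul_right _).mul_right _

theorem Δ_parametrized (hS : S = X .t * laurentConst m (zG m) R S)
    (hy : y = X .u * (1 + ι S * y + ι R * y ^ 2)) :
    Δ (parametrized ι.toRingHom m (X .t) (zG m) R S y) =
      X .t * cutFace m (parametrized ι.toRingHom m (X .t) (zG m) R S y) +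
        X .u * parametrized ι.toRingHom m (X .t) (zG m) R S y ^ 2 := by
  have : IsDomain (FSeries m) := NoZeroDivisors.to_isDomain _
  obtain ⟨N, q, le_N, natDegree_le, h⟩ := exists_parametrized_eq_of_isDomain (m := m)
    (ι (m := m)).toRingHom hS (X_ne_zero FVar.u) hy
  generalize parametrized ι.toRingHom m (X .t) (zG m) R S y = p at *
  have Δ_pow_eq := congrArg (Δ ^ (N + 1)) h
  change _ = (Δ ^ (N + 1)) (ι (X .t) * ∑ k ∈ Finset.range m, ι (zG m k) * _ + _ + _) at Δ_pow_eq
  rw [map_add, map_add, Δ_pow_ι_mul, Δ_pow_sum_eq_cutFace (le_N.trans N.le_succ),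
    Δ_pow_eval₂_X_u (Nat.lt_succ_of_le natDegree_le), Δ_pow_X_u_pow_mul_of_ge N.le_succ,
    Δ_pow_X_u_pow_mul_of_le (N + 1).le_succ, ι_X_t, add_zero] at Δ_pow_eq
  simpa using Δ_pow_eq

theorem parametrized_eq_X_t_mul_finiteFaceGF
    (hR : R = X .t + X .t * R * (laurentPos m (zG m) R S).coeff 0)
    (hS : S = X .t * laurentConst m (zG m) R S)
    (hy : y = X .u * (1 + ι S * y + ι R * y ^ 2)) :
    parametrized ι.toRingHom m (X .t) (zG m) R S y = X .t * finiteFaceGF m := by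
  have ε_y : ε y = 0 := by rw [hy, map_mul, ε_X_u, zero_mul]
  have decomposition := ι_ε_add_X_u_mul_Δ (parametrized ι.toRingHom m (X .t) (zG m) R S y)
  rw [ε_parametrized hR ε_y, Δ_parametrized hS hy, ι_X_t] at decomposition
  obtain ⟨g, hg⟩ := X_t_dvd_parametrized hR y
  have cutFace_X_t_mul : cutFace m (X .t * g) = X .t * cutFace m g := by
    rw [← ι_X_t, cutFace_ι_mul]
  rw [hg, cutFace_X_t_mul] at decomposition
  have tutte_g : tutte g = g := mul_left_cancel₀ (X_ne_zero FVar.t) <| by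
    rw [tutte]
    linear_combination decomposition
  rw [hg, eq_of_tutte_eq (tutte_finiteFaceGF m) tutte_g]

end Parametrized

end MapSeries

end Series

/-! ### Algebraicity -/

section Algebraicity

open KaehlerDifferential

namespace MapSeries

/-- Each derivative of a generator lies in `t Ω`, so `Ω = t Ω` and Nakayama applies. -/
theorem exists_sub_one_mem_span_smul_kaehlerDifferential_eq_zero {A C : Type*} [CommRing A]
    [CommRing C] [Algebra A C] [Algebra.FiniteType A C] {t : A} {s : Set C}
    (hgen : Algebra.adjoin A s = ⊤) (hdvd : ∀ x ∈ s, algebraMap A C t ∣ x) :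
    ∃ r : C, r - 1 ∈ Ideal.span {algebraMap A C t} ∧ ∀ ω : Ω[C⁄A], r • ω = 0 := by
  let N : Submodule C (Ω[C⁄A]) := Ideal.span {algebraMap A C t} • ⊤
  have mkQ_D_eq_zero : N.mkQ.compDer (D A C) = 0 := by
    refine Derivation.ext_of_adjoin_eq_top s hgen fun x hx => ?_
    obtain ⟨c, rfl⟩ := hdvd x hx
    change N.mkQ (D A C (algebraMap A C t * c)) = 0
    rw [Derivation.leibniz, Derivation.map_algebraMap, smul_zero, add_zero,
      Submodule.mkQ_apply, Submodule.Quotient.mk_eq_zero]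
    exact Submodule.smul_mem_smul (Ideal.mem_span_singleton_self _) trivial
  have top_le : (⊤ : Submodule C (Ω[C⁄A])) ≤ N := by
    rw [← span_range_derivation, Submodule.span_le]
    rintro _ ⟨x, rfl⟩
    exact (Submodule.Quotient.mk_eq_zero N).1 (DFunLike.congr_fun mkQ_D_eq_zero x)
  obtain ⟨r, hr, smul_eq_zero⟩ := Submodule.exists_sub_one_mem_and_smul_eq_zero_of_fg_of_le_smul
    _ ⊤ Module.Finite.fg_top top_le
  exact ⟨r, hr, fun ω => smul_eq_zero ω trivial⟩

theorem formallyUnramified_fractionRing_of_smul_eq_zero {A C : Type*} [CommRing A] [CommRing C]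
    [IsDomain C] [Algebra A C] {r : C} (hr : r ≠ 0) (h : ∀ ω : Ω[C⁄A], r • ω = 0) :
    Algebra.FormallyUnramified A (FractionRing C) := by
  let L := FractionRing C
  have D_algebraMap : ∀ x : C, D A L (algebraMap C L x) = 0 := fun x => by
    have smul_D : algebraMap C L r • D A L (algebraMap C L x) = 0 := by
      change _ • ((D A L).compAlgebraMap C) x = 0
      rw [algebraMap_smul, ← Derivation.liftKaehlerDifferential_comp_D, ← map_smul, h, map_zero]
    exact (smul_eq_zero.1 smul_D).resolve_left
      ((map_ne_zero_iff _ (IsFractionRing.injective C L)).2 hr)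
  have D_eq_zero : ∀ x : L, D A L x = 0 := fun x => by
    obtain ⟨a, b, _, rfl⟩ := IsFractionRing.div_surjective (A := C) x
    rw [Derivation.leibniz_div, D_algebraMap, D_algebraMap, smul_zero, smul_zero, sub_zero,
      smul_zero]
  have top_eq_bot : (⊤ : Submodule L (Ω[L⁄A])) = ⊥ := by
    rw [← span_range_derivation, Submodule.span_eq_bot]
    rintro _ ⟨x, rfl⟩
    exact D_eq_zero x
  exact ⟨Submodule.subsingleton_iff L |>.1 (subsingleton_of_bot_eq_top top_eq_bot.symm)⟩

theorem isAlgebraic_of_formallyUnramified_fractionRing {A C : Type*} [CommRing A] [IsDomain A]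
    [CommRing C] [IsDomain C] [Algebra A C] [FaithfulSMul A C] [Algebra.FiniteType A C]
    [Algebra.FormallyUnramified A (FractionRing C)] : Algebra.IsAlgebraic A C := by
  let K := FractionRing A
  let L := FractionRing C
  let _ : Algebra K L := FractionRing.liftAlgebra A L
  have := Algebra.EssFiniteType.comp A C L
  have := Algebra.EssFiniteType.of_comp A K L
  have := Algebra.FormallyUnramified.of_restrictScalars A K L
  have := Algebra.FormallyUnramified.isSeparable K L
  have : Algebra.IsAlgebraic A L :=
    IsFractionRing.comap_isAlgebraic_iff.2 (inferInstance : Algebra.IsAlgebraic K L)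
  exact .of_injective (IsScalarTower.toAlgHom A C L) (IsFractionRing.injective C L)

theorem isAlgebraic_of_adjoin_eq_top_of_dvd {A C : Type*} [CommRing A] [IsDomain A] [CommRing C]
    [IsDomain C] [Algebra A C] [FaithfulSMul A C] {t : A} (ht : ¬ IsUnit (algebraMap A C t))
    {s : Set C} (hs : s.Finite) (hgen : Algebra.adjoin A s = ⊤)
    (hdvd : ∀ x ∈ s, algebraMap A C t ∣ x) : Algebra.IsAlgebraic A C := by
  have : Algebra.FiniteType A C := ⟨⟨hs.toFinset, by simpa using hgen⟩⟩
  obtain ⟨r, r_sub_one_mem, smul_eq_zero⟩ :=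
    exists_sub_one_mem_span_smul_kaehlerDifferential_eq_zero hgen hdvd
  have r_ne_zero : r ≠ 0 := by
    rintro rfl
    rw [zero_sub, neg_mem_iff, Ideal.mem_span_singleton] at r_sub_one_mem
    exact ht (isUnit_of_dvd_one r_sub_one_mem)
  have := formallyUnramified_fractionRing_of_smul_eq_zero r_ne_zero smul_eq_zero
  exact isAlgebraic_of_formallyUnramified_fractionRing

end MapSeries

end Algebraicity

section Series

open MvPowerSeries

namespace MapSeries

section Scalars

variable {σ R : Type*} [CommRing R]

theorem algebraMap_eq_coe (c : MvPolynomial σ R) :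
    algebraMap (MvPolynomial σ R) (MvPowerSeries σ R) c = c := by
  rw [algebraMap_apply']
  ext
  simp

theorem algebraMap_X (s : σ) :
    algebraMap (MvPolynomial σ R) (MvPowerSeries σ R) (MvPolynomial.X s) = X s := by
  rw [algebraMap_eq_coe, MvPolynomial.coe_X]

theorem algebraMap_injective :
    Function.Injective (algebraMap (MvPolynomial σ R) (MvPowerSeries σ R)) := fun a b h => by
  rw [algebraMap_eq_coe, algebraMap_eq_coe] at h
  exact MvPolynomial.coe_injective σ R h

theorem X_mem (C : Subalgebra (MvPolynomial σ R) (MvPowerSeries σ R)) (s : σ) : X s ∈ C := by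
  rw [← algebraMap_X]
  exact C.algebraMap_mem _

theorem not_isUnit_X [Nontrivial R] (s : σ) : ¬ IsUnit (X s : MvPowerSeries σ R) := fun h => by
  simpa using h.map (constantCoeff (σ := σ) (R := R))

theorem isAlgebraic_of_forall_mem_X_mul_adjoin [IsDomain R] (t : σ) {s : Set (MvPowerSeries σ R)}
    (hs : s.Finite) (h : ∀ f ∈ s, ∃ g ∈ Algebra.adjoin (MvPolynomial σ R) s, f = X t * g)
    {f : MvPowerSeries σ R} (hf : f ∈ s) : IsAlgebraic (MvPolynomial σ R) f := by
  have : IsDomain (MvPowerSeries σ R) := NoZeroDivisors.to_isDomain _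
  let C := Algebra.adjoin (MvPolynomial σ R) s
  have : FaithfulSMul (MvPolynomial σ R) C :=
    (faithfulSMul_iff_algebraMap_injective _ _).2 fun a b hab =>
      algebraMap_injective (congrArg C.val hab)
  have not_isUnit : ¬ IsUnit (algebraMap (MvPolynomial σ R) C (MvPolynomial.X t)) := fun hunit =>
    not_isUnit_X t (algebraMap_X (R := R) t ▸ hunit.map C.val)
  have dvd_of_mem : ∀ x ∈ C.val ⁻¹' s, algebraMap (MvPolynomial σ R) C (MvPolynomial.X t) ∣ x := by
    intro x hx
    obtain ⟨g, hg, x_eq⟩ := h x hx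
    refine ⟨⟨g, hg⟩, Subtype.ext (x_eq.trans ?_)⟩
    rw [← algebraMap_X]
    rfl
  have := isAlgebraic_of_adjoin_eq_top_of_dvd not_isUnit
    (hs.preimage Subtype.val_injective.injOn) Algebra.adjoin_adjoin_coe_preimage dvd_of_mem
  exact (Algebra.IsAlgebraic.isAlgebraic
    (⟨f, Algebra.subset_adjoin hf⟩ : C)).algHom C.val

end Scalars

variable {m : ℕ}

theorem zG_mem (C : Subalgebra (MvPolynomial (GVar m) ℚ) (GSeries m)) (k : ℕ) : zG m k ∈ C := by
  unfold zG faceWeight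
  split_ifs
  · exact X_mem C _
  · exact C.zero_mem

theorem isAlgebraic_R_S {R S : GSeries m}
    (hR : R = X .t + X .t * R * (laurentPos m (zG m) R S).coeff 0)
    (hS : S = X .t * laurentConst m (zG m) R S) :
    IsAlgebraic (MvPolynomial (GVar m) ℚ) R ∧ IsAlgebraic (MvPolynomial (GVar m) ℚ) S := by
  let C := Algebra.adjoin (MvPolynomial (GVar m) ℚ) {R, S}
  have R_mem : R ∈ C := Algebra.subset_adjoin (Set.mem_insert _ _)
  have S_mem : S ∈ C := Algebra.subset_adjoin (Set.mem_insert_of_mem _ rfl)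
  have mem_X_t_mul : ∀ f ∈ ({R, S} : Set (GSeries m)), ∃ g ∈ C, f = X .t * g := by
    rintro f (rfl | rfl)
    · refine ⟨_, add_mem C.one_mem
        (mul_mem R_mem (coeff_laurentPos_mem (m := m) C (zG_mem C) R_mem S_mem 0)), ?_⟩
      linear_combination hR
    · exact ⟨_, laurentConst_mem C (zG_mem C) R_mem S_mem, hS⟩
  exact ⟨isAlgebraic_of_forall_mem_X_mul_adjoin _ (Set.toFinite _) mem_X_t_mul (.inl rfl),
    isAlgebraic_of_forall_mem_X_mul_adjoin _ (Set.toFinite _) mem_X_t_mul (.inr rfl)⟩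

theorem isAlgebraic_ι {f : GSeries m} (hf : IsAlgebraic (MvPolynomial (GVar m) ℚ) f) :
    IsAlgebraic (MvPolynomial (FVar m) ℚ) (ι f) := by
  refine hf.ringHom_of_comp_eq (MvPolynomial.rename (R := ℚ) (GVar.emb m)) ι
    (MvPolynomial.rename_injective _ (GVar.emb m).injective) (RingHom.ext fun c => ?_)
  change algebraMap _ _ (MvPolynomial.rename (GVar.emb m) c) = ι (algebraMap _ _ c)
  rw [algebraMap_eq_coe, algebraMap_eq_coe, ι, rename_coe]

/-- Set `u = 0` in a polynomial. -/
noncomputable def killU : MvPolynomial (FVar m) ℚ →ₐ[ℚ] MvPolynomial (GVar m) ℚ :=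
  MvPolynomial.killCompl (GVar.emb m).injective

theorem coeff_killU (c : MvPolynomial (FVar m) ℚ) (e : GVar m →₀ ℕ) :
    (killU c).coeff e = c.coeff (e.embDomain (GVar.emb m)) := by
  rw [killU, MvPolynomial.coeff_killCompl, Finsupp.embDomain_eq_mapDomain]

theorem ε_algebraMap (c : MvPolynomial (FVar m) ℚ) :
    ε (algebraMap _ (FSeries m) c) = algebraMap _ (GSeries m) (killU c) := by
  ext e
  rw [algebraMap_eq_coe, algebraMap_eq_coe, ε, coeff_killCompl, MvPolynomial.coeff_coe,
    MvPolynomial.coeff_coe, coeff_killU]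

theorem X_u_dvd_of_killU_eq_zero {c : MvPolynomial (FVar m) ℚ} (hc : killU c = 0) :
    MvPolynomial.X .u ∣ c := by
  rw [MvPolynomial.X_dvd_iff_modMonomial_eq_zero]
  ext e
  by_cases h : e .u = 0
  · obtain ⟨e, rfl⟩ := (mem_range_embDomain_emb_iff e).2 h
    rw [MvPolynomial.coeff_modMonomial_of_not_le _ (by simp [h]), ← coeff_killU, hc,
      MvPolynomial.coeff_zero, MvPolynomial.coeff_zero]
  · rw [MvPolynomial.coeff_modMonomial_of_le _
      (Finsupp.single_le_iff.2 (Nat.one_le_iff_ne_zero.2 h)), MvPolynomial.coeff_zero]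

theorem exists_aeval_eq_zero_and_not_C_dvd {A C : Type*} [CommRing A] [IsDomain A] [WfDvdMonoid A]
    [CommRing C] [NoZeroDivisors C] [Algebra A C] {f : C} (hf : IsAlgebraic A f) {a : A}
    (ha : ¬ IsUnit a) (map_ne_zero : algebraMap A C a ≠ 0) :
    ∃ q : Polynomial A, Polynomial.aeval f q = 0 ∧ ¬ Polynomial.C a ∣ q := by
  obtain ⟨p, p_ne_zero, aeval_p⟩ := hf
  obtain ⟨q, p_eq, not_dvd⟩ := (FiniteMultiplicity.of_not_isUnit
    (mt Polynomial.isUnit_C.1 ha) p_ne_zero).exists_eq_pow_mul_and_not_dvd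
  rw [p_eq, map_mul, map_pow, Polynomial.aeval_C] at aeval_p
  exact ⟨q, (mul_eq_zero.1 aeval_p).resolve_left (pow_ne_zero _ map_ne_zero), not_dvd⟩

theorem isAlgebraic_ε {f : FSeries m} (hf : IsAlgebraic (MvPolynomial (FVar m) ℚ) f) :
    IsAlgebraic (MvPolynomial (GVar m) ℚ) (ε f) := by
  have X_u_not_isUnit : ¬ IsUnit (MvPolynomial.X .u : MvPolynomial (FVar m) ℚ) := fun h => by
    simpa using h.map (MvPolynomial.constantCoeff (σ := FVar m) (R := ℚ))
  obtain ⟨q, aeval_q, not_dvd⟩ := exists_aeval_eq_zero_and_not_C_dvd hf X_u_not_isUnit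
    (algebraMap_X (R := ℚ) (FVar.u (m := m)) ▸ X_ne_zero _)
  refine ⟨q.map killU.toRingHom, fun map_eq_zero => not_dvd ?_, ?_⟩
  · refine (Polynomial.C_dvd_iff_dvd_coeff _ _).2 fun i => X_u_dvd_of_killU_eq_zero ?_
    simpa using congrArg (fun p => Polynomial.coeff p i) map_eq_zero
  · have ε_aeval : ε.toRingHom (Polynomial.aeval f q) = 0 := by rw [aeval_q, map_zero]
    have comp_eq : (ε (m := m)).toRingHom.comp (algebraMap _ _) =
        (algebraMap _ _).comp killU.toRingHom := RingHom.ext ε_algebraMap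
    rw [Polynomial.aeval_def, Polynomial.hom_eval₂, comp_eq] at ε_aeval
    rw [Polynomial.aeval_def, Polynomial.eval₂_map]
    exact ε_aeval

theorem isAlgebraic_of_X_mul {s : FVar m} {f : FSeries m}
    (hf : IsAlgebraic (MvPolynomial (FVar m) ℚ) (X s * f)) :
    IsAlgebraic (MvPolynomial (FVar m) ℚ) f :=
  .of_mul (mem_nonZeroDivisors_of_ne_zero (X_ne_zero s))
    (algebraMap_X (R := ℚ) s ▸ isAlgebraic_algebraMap _) hf

theorem isAlgebraic_Δ_pow {f : FSeries m} (hf : IsAlgebraic (MvPolynomial (FVar m) ℚ) f) (k : ℕ) :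
    IsAlgebraic (MvPolynomial (FVar m) ℚ) ((Δ ^ k) f) := by
  induction k with
  | zero => exact hf
  | succ k ih =>
    rw [pow_succ', Module.End.mul_apply]
    refine isAlgebraic_of_X_mul (s := .u) ?_
    rw [eq_sub_of_add_eq' (ι_ε_add_X_u_mul_Δ ((Δ ^ k) f))]
    exact ih.sub (isAlgebraic_ι (isAlgebraic_ε ih))

theorem isAlgebraic_y {R S : GSeries m} (hR : IsAlgebraic (MvPolynomial (GVar m) ℚ) R)
    (hS : IsAlgebraic (MvPolynomial (GVar m) ℚ) S) {y : FSeries m}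
    (hy : y = X .u * (1 + ι S * y + ι R * y ^ 2)) : IsAlgebraic (MvPolynomial (FVar m) ℚ) y := by
  let E := Subalgebra.algebraicClosure (MvPolynomial (FVar m) ℚ) (FSeries m)
  let r : E := ⟨ι R, isAlgebraic_ι hR⟩
  let s : E := ⟨ι S, isAlgebraic_ι hS⟩
  let u : E := ⟨X .u, X_mem E _⟩
  have u_ne_zero : u ≠ 0 := fun h => X_ne_zero FVar.u (congrArg Subtype.val h)
  let q : Polynomial E := Polynomial.C u + Polynomial.C (u * s - 1) * Polynomial.X +
    Polynomial.C (u * r) * Polynomial.X ^ 2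
  have coeff_zero_q : q.coeff 0 = u := by simp [q]
  have q_ne_zero : q ≠ 0 := fun h => u_ne_zero (by rw [← coeff_zero_q, h, Polynomial.coeff_zero])
  have aeval_q : Polynomial.aeval y q = 0 := by
    simp only [q, map_add, map_mul, map_pow, Polynomial.aeval_C, Polynomial.aeval_X]
    change X .u + (X .u * ι S - 1) * y + X .u * ι R * y ^ 2 = 0
    linear_combination -hy
  exact .restrictScalars (MvPolynomial (FVar m) ℚ) (S := E) ⟨q, q_ne_zero, aeval_q⟩

theorem isAlgebraic_parametrized {R S : GSeries m} (hR : IsAlgebraic (MvPolynomial (GVar m) ℚ) R)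
    (hS : IsAlgebraic (MvPolynomial (GVar m) ℚ) S) {y : FSeries m}
    (hy : IsAlgebraic (MvPolynomial (FVar m) ℚ) y) : IsAlgebraic (MvPolynomial (FVar m) ℚ)
      (parametrized ι.toRingHom m (X .t) (zG m) R S y) := by
  let B := Subalgebra.algebraicClosure (MvPolynomial (GVar m) ℚ) (GSeries m)
  let E := Subalgebra.algebraicClosure (MvPolynomial (FVar m) ℚ) (FSeries m)
  have R_mem : ι R ∈ E := isAlgebraic_ι hR
  have S_mem : ι S ∈ E := isAlgebraic_ι hS
  have y_mem : y ∈ E := hy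
  have coeff_mem : ∀ k, ι ((laurentFactor m (X .t) (zG m) R S).coeff k) ∈ E := fun k =>
    isAlgebraic_ι (coeff_laurentFactor_mem B (zG_mem B) (X_mem B _) hR hS k)
  have eval_mem : (laurentFactor m (X .t) (zG m) R S).eval₂ ι.toRingHom (ι R * y) ∈ E := by
    rw [Polynomial.eval₂_eq_sum_range]
    exact sum_mem fun k _ => mul_mem (coeff_mem k) (pow_mem (mul_mem R_mem y_mem) k)
  exact mul_mem (mul_mem R_mem (add_mem (add_mem E.one_mem (mul_mem S_mem y_mem))
    (mul_mem R_mem (pow_mem y_mem 2)))) eval_mem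

theorem isAlgebraic_finiteFaceGF (m : ℕ) :
    IsAlgebraic (MvPolynomial (FVar m) ℚ) (finiteFaceGF m) := by
  obtain ⟨R, S, hR, hS⟩ := exists_R_S m
  obtain ⟨R_algebraic, S_algebraic⟩ := isAlgebraic_R_S hR hS
  obtain ⟨y, hy⟩ := exists_y R S
  refine isAlgebraic_of_X_mul (s := .t) ?_
  rw [← parametrized_eq_X_t_mul_finiteFaceGF hR hS hy]
  exact isAlgebraic_parametrized R_algebraic S_algebraic (isAlgebraic_y R_algebraic S_algebraic hy)

theorem isAlgebraic_allFaceGF (m : ℕ) :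
    IsAlgebraic (MvPolynomial (GVar m) ℚ) (allFaceGF m) := by
  let B := Subalgebra.algebraicClosure (MvPolynomial (GVar m) ℚ) (GSeries m)
  rw [allFaceGF_eq_one_add, closeOuterFace_apply]
  exact add_mem B.one_mem (sum_mem fun k _ => mul_mem (zG_mem B k)
    (isAlgebraic_ε (isAlgebraic_Δ_pow (isAlgebraic_finiteFaceGF m) _)))

end MapSeries

end Series

theorem mainTheorem5 (m : ℕ) (hm : 1 ≤ m) :
    IsAlgebraic (MvPolynomial (FVar m) ℚ) (finiteFaceGF m) ∧
      IsAlgebraic (MvPolynomial (GVar m) ℚ) (allFaceGF m) :=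
  ⟨MapSeries.isAlgebraic_finiteFaceGF m, MapSeries.isAlgebraic_allFaceGF m⟩
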